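/- **Model.** Let $G_\Delta$ be the infinite triangular grid with axes $x,y,z$, where $y$ and $z$ are at $60^\circ$ and $120^\circ$ to $x$. An amoebot structure consists of $n\ge 1$ amoebots, each occupying one node (contracted) or two adjacent nodes and the edge between them (expanded), no node being occupied twice. Any two adjacent nodes of different amoebots are joined by a bond, and the graph of occupied nodes, occupied edges and bonds is connected. Structures are considered up to translation. In a round, first an arbitrary set of bonds is released such that the graph given by the occupied edges and the set $R$ of remaining bonds is still connected. Then every amoebot does nothing, or expands along a grid axis (its node is replaced by two adjacent nodes, and each incident bond of $R$ is attached to one of them), or contracts (its two nodes are replaced by one, which gets all its bonds), or takes part in a handover (a contracted amoebot at $c_0$ and an expanded one at $x_1,x_2$ with a bond $\{c_0,x_1\}\in R$ become an expanded one at $c_0,x_1$ and a contracted one at $x_2$). All these movements happen jointly: all bonds of $R$, and the edges of the amoebots that neither expand nor contract, keep their orientations, and the round is legal only if the outcome is again a placement on $G_\Delta$ in which no node is occupied twice. Then all possible bonds are re-established. A structure of contracted amoebots is *monotone* if for at least one axis $A$ its intersection with every line parallel to $A$ is connected. It is a *line segment* if its nodes are consecutive nodes on one line parallel to an axis. **Algorithm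 (Monotone2LineSegment).** By symmetry let $A=y$; columns are the sections parallel to $y$. Between any two adjacent columns all bonds are released except one arbitrary horizontal bond. If there is no horizontal bond, the right column is first shifted up by one position, in a preprocessing phase of two rounds. For a column $(v_1,\dots,v_m)$ from bottom to top let $v_\ell$ (resp. $v_r$) be the amoebot bonded to the left (resp. right) column, with $\ell=1$ (resp. $r=m$) if there is no such column. Every column, independently and in parallel, applies the following rules to itself and then to the columns that arise, until $m=1$. 1. $\ell<r$ (2 rounds): shear $(v_\ell,\dots,v_r)$ to the $x$-axis. New columns: $(v_1,\dots,v_\ell)$, then $v_{\ell+1},\dots,v_{r-1}$ as single columns, then $(v_r,\dots,v_m)$. 2. $\ell>r$ (4 rounds): shear $(v_r,\dots,v_\ell)$ to the $z$-axis and then to the $x$-axis. New columns: $(v_\ell,\dots,v_m)$, then $v_{\ell-1},\dots,v_{r+1}$ as single columns, then $(v_1,\dots,v_r)$. 3. $\ell=r$ (3 rounds: horizontal expansion, handover, contraction): (a) $1<\ell<m$: split into $(v_1,\dots,v_\ell)$ and $(v_{\ell+1},\dots,v_m)$; (b) $\ell=1$, $m$ odd: split into $v_1$ and $(v_2,\dots,v_m)$;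 (c) $\ell=m$, $m$ odd: split into $v_m$ and $(v_1,\dots,v_{m-1})$; (d) $\ell=1$, $m$ even: split into $(v_1,v_3,\dots,v_{m-1})$ and $(v_2,v_4,\dots,v_m)$, of which only the topmost horizontal bond between them is kept; (e) $\ell=m$, $m$ even: split into $(v_2,v_4,\dots,v_m)$ and $(v_1,v_3,\dots,v_{m-1})$, of which only the bottommost horizontal bond between them is kept. (New columns are listed from left to right. To shear a segment from one axis to an adjacent one, every second amoebot expands in one round and contracts in the next, so that each step between consecutive amoebots of the segment changes its direction by $60^\circ$.) **Theorem.** For every monotone structure $S$, every axis along which $S$ is monotone and every choice of the horizontal bonds, the Monotone2LineSegment algorithm can be started on $S$, all its rounds are legal, and it reconfigures $S$ into a line segment and terminates (every column then consists of one amoebot) in at most $16$ rounds. Every amoebot takes part in at most $4$ rule applications. Moreover, split Rule 1 into 1a and 1b, where 1b is the case $\ell=1\wedge r=m$, and Rule 2 into 2a and 2b, where 2b is the case $\ell=m\wedge r=1$; then the state graph on the nine rules 1a, 1b, 2a, 2b, 3a–3e, with an edge from $\rho$ to $\sigma$ whenever an application of $\rho$ to some column can produce a column to which $\sigma$ has to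 be applied, is acyclic. -/

import Mathlib

namespace Amoebot

/-! ### The triangular grid -/

/-- Nodes of the infinite triangular grid in axial coordinates: `(a, b)` is the point
`a • e_x + b • e_y`, where `e_x`, `e_y` are unit vectors at an angle of 60 degrees. -/
abbrev Node := ℤ × ℤ

/-- The three axes of the grid. -/
inductive Axis
  | x
  | y
  | z

/-- The unit vector along an axis; `z` is at 120 degrees to `x`. -/
def Axis.dir : Axis → Node
  | .x => (1, 0)
  | .y => (0, 1)
  | .z => (-1, 1)

/-- The unit vector obtained by rotating `A.dir` clockwise by 60 degrees. -/
def Axis.across : Axis → Node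
  | .x => (1, -1)
  | .y => (1, 0)
  | .z => (0, 1)

/-- The triangular grid graph: each node has the six neighbours `u ± A.dir`. -/
def grid : SimpleGraph Node where
  Adj u v := ∃ A : Axis, v - u = A.dir ∨ u - v = A.dir
  symm := ⟨fun _ _ ⟨A, h⟩ => ⟨A, h.symm⟩⟩
  loopless := ⟨fun u ⟨A, h⟩ => by cases A <;> simp [Axis.dir, Prod.ext_iff] at h⟩

/-! ### Amoebot structures -/

/-- A placement of amoebots, indexed by `ι`, on the grid: `occ i` is the set of nodes occupied by
amoebot `i`. -/
structure Config (ι : Type*) where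
  occ : ι → Finset Node

namespace Config

variable {ι : Type*}

/-- Amoebot `i` is contracted: it occupies a single node. -/
def Contracted (P : Config ι) (i : ι) : Prop := ∃ u, P.occ i = {u}

/-- Amoebot `i` is expanded: it occupies two adjacent nodes (and the edge between them). -/
def Expanded (P : Config ι) (i : ι) : Prop := ∃ u v, grid.Adj u v ∧ P.occ i = {u, v}

/-- Every amoebot is contracted or expanded, and no node is occupied by two amoebots. -/
def Valid (P : Config ι) : Prop :=
  (∀ i, P.Contracted i ∨ P.Expanded i) ∧ ∀ i j, i ≠ j → Disjoint (P.occ i) (P.occ j)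

/-- The set of occupied nodes. -/
def occupied (P : Config ι) : Set Node := {u | ∃ i, u ∈ P.occ i}

/-- The edges occupied by expanded amoebots. -/
def bodyEdges (P : Config ι) : Set (Sym2 Node) :=
  {e | ∃ i u v, u ∈ P.occ i ∧ v ∈ P.occ i ∧ u ≠ v ∧ e = s(u, v)}

/-- All possible bonds: the grid edges between nodes of two different amoebots. -/
def bonds (P : Config ι) : Set (Sym2 Node) :=
  {e | ∃ i j u v, i ≠ j ∧ u ∈ P.occ i ∧ v ∈ P.occ j ∧ grid.Adj u v ∧ e = s(u, v)}

/-- The graph on the occupied nodes whose edges are the occupied edges and the bonds in `R` is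
connected. -/
def ConnectedBy (P : Config ι) (R : Set (Sym2 Node)) : Prop :=
  ∀ u ∈ P.occupied, ∀ v ∈ P.occupied,
    (SimpleGraph.fromEdgeSet (P.bodyEdges ∪ R)).Reachable u v

/-- An amoebot structure all of whose amoebots are contracted; its bonds are all possible ones
(adjacency closure), and it is connected. -/
def IsContractedStructure (P : Config ι) : Prop :=
  P.Valid ∧ P.ConnectedBy P.bonds ∧ ∀ i, P.Contracted i

/-! ### Classes of structures -/

/-- The line through `u` parallel to the axis `A`. -/
def line (A : Axis) (u : Node) : Set Node := {v | ∃ k : ℤ, v = u + k • A.dir}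

/-- Every section of the structure by a line parallel to `A` is connected (possibly empty). -/
def MonotoneAlong (P : Config ι) (A : Axis) : Prop :=
  ∀ u, (grid.induce (P.occupied ∩ line A u)).Preconnected

/-- The class of monotone structures: `x`-, `y`- or `z`-monotone. -/
def IsMonotone (P : Config ι) : Prop :=
  P.IsContractedStructure ∧ ∃ A, P.MonotoneAlong A

/-- The class of line segments: the occupied nodes are `n` consecutive nodes along some axis. -/
def IsLineSegment (P : Config ι) : Prop :=
  P.IsContractedStructure ∧
    ∃ (A : Axis) (u : Node) (n : ℕ), P.occupied = {v | ∃ k : ℕ, k < n ∧ v = u + k • A.dir}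

end Config

/-! ### Rounds with joint movements -/

/-- What an amoebot does in the second step of a round. -/
inductive Move (ι : Type*)
  | idle
  | expand
  | contract
  | handover (partner : ι)

section Round

variable {ι : Type*}

/-- Contracted amoebot `c` and expanded amoebot `x`, connected by a remaining bond `{c₀, x₁}`,
perform a handover: `c` then occupies `c₀, x₁` and `x` occupies `x₂`. The two amoebots are
at the same time displaced by `τ`, because of the movements of other amoebots. -/
def Handover (P : Config ι) (R : Set (Sym2 Node)) (Q : Config ι) (τ : Node) (c x : ι) : Prop :=
  ∃ c₀ x₁ x₂, P.occ c = {c₀} ∧ P.occ x = {x₁, x₂} ∧ x₁ ≠ x₂ ∧ s(c₀, x₁) ∈ R ∧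
    Q.occ c = {c₀ + τ, x₁ + τ} ∧ Q.occ x = {x₂ + τ}

/-- The change from `P` to `Q` of the nodes of amoebot `i` is the one prescribed by its move.
An idle amoebot is translated rigidly by `τ i`. -/
def MoveOK (P : Config ι) (R : Set (Sym2 Node)) (Q : Config ι) (mv : ι → Move ι) (τ : ι → Node)
    (i : ι) : Prop :=
  match mv i with
  | .idle => Q.occ i = (P.occ i).image (fun u => u + τ i)
  | .expand => P.Contracted i ∧ Q.Expanded i
  | .contract => P.Expanded i ∧ Q.Contracted i
  | .handover j => mv j = .handover i ∧ τ j = τ i ∧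
      (Handover P R Q (τ i) i j ∨ Handover P R Q (τ i) j i)

/-- A bond that is incident to the node `u` of amoebot `i` before the movements may be incident to
the node `u'` afterwards. If `i` expands then `u'` is one of its two new nodes, if `i` contracts
then `u'` is its new node; in the other cases the bond stays at its node. (In a handover the bonds
at `x₁` stay at `x₁`, which from then on belongs to the other amoebot.) -/
def Carries (Q : Config ι) (mv : ι → Move ι) (τ : ι → Node) (i : ι) (u u' : Node) : Prop :=
  match mv i with
  | .idle | .handover _ => u' = u + τ i
  | .expand | .contract => u' ∈ Q.occ i

/-- One synchronous round from `P` to `Q` in which exactly the bonds in `R` are not released.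
There is no connectivity conflict, every remaining bond keeps its orientation, and there is no
collision (`Q` is valid). As structures are given by the orientations of their edges, the global
translation of `Q` is irrelevant. -/
def Round (P : Config ι) (R : Set (Sym2 Node)) (Q : Config ι) : Prop :=
  R ⊆ P.bonds ∧ P.ConnectedBy R ∧ Q.Valid ∧
    ∃ (mv : ι → Move ι) (τ : ι → Node),
      (∀ i, MoveOK P R Q mv τ i) ∧
      ∀ i j u w, u ∈ P.occ i → w ∈ P.occ j → s(u, w) ∈ R → i ≠ j →
        ∃ u' w', Carries Q mv τ i u u' ∧ Carries Q mv τ j w w' ∧ w' - u' = w - u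

end Round

/-! ### The column rules -/

/-- A column `(v_0, …, v_{m-1})` of amoebots from bottom to top (indices start at `0`), linked to
the column on its left through `v_l` and to the column on its right through `v_r`. -/
structure Column (α : Type*) where
  ids : List α
  l : ℕ
  r : ℕ

/-- The rules, where rules 1 and 2 are each split into two cases (a) and (b). -/
inductive Rule
  | r1a
  | r1b
  | r2a
  | r2b
  | r3a
  | r3b
  | r3c
  | r3d
  | r3e
  deriving DecidableEq

/-- The number of rounds a rule takes: one shear takes two rounds, and the splitting rules consist
of expansions, handovers and contractions. -/
def Rule.rounds : Rule → ℕ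
  | .r1a | .r1b => 2
  | .r2a | .r2b => 4
  | .r3a | .r3b | .r3c | .r3d | .r3e => 3

/-- The sublist of the entries with index `0, 2, 4, …`. -/
def everySecond {α : Type*} : List α → List α
  | [] => []
  | [a] => [a]
  | a :: _ :: as => a :: everySecond as

namespace Column

variable {α : Type*}

/-- The number of amoebots in the column. -/
def m (c : Column α) : ℕ := c.ids.length

/-- Both link indices are indices of amoebots of the column (so it is not empty). -/
def WellFormed (c : Column α) : Prop := c.l < c.m ∧ c.r < c.m

/-- The rule that has to be applied to a column; none if it consists of a single amoebot. -/
def rule (c : Column α) : Option Rule :=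
  if c.m ≤ 1 then none
  else if c.l < c.r then (if c.l = 0 ∧ c.r + 1 = c.m then some .r1b else some .r1a)
  else if c.r < c.l then (if c.r = 0 ∧ c.l + 1 = c.m then some .r2b else some .r2a)
  else if c.l = 0 then (if c.m % 2 = 1 then some .r3b else some .r3d)
  else if c.l + 1 = c.m then (if c.m % 2 = 1 then some .r3c else some .r3e)
  else some .r3a

/-- The columns, from left to right, that the application of a rule produces from a column. -/
def children (c : Column α) : Rule → List (Column α)
  | .r1a | .r1b =>
      [⟨c.ids.take (c.l + 1), c.l, c.l⟩] ++
      ((c.ids.take c.r).drop (c.l + 1)).map (fun v => ⟨[v], 0, 0⟩) ++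
      [⟨c.ids.drop c.r, 0, 0⟩]
  | .r2a | .r2b =>
      [⟨c.ids.drop c.l, 0, 0⟩] ++
      ((c.ids.take c.l).drop (c.r + 1)).reverse.map (fun v => ⟨[v], 0, 0⟩) ++
      [⟨c.ids.take (c.r + 1), c.r, c.r⟩]
  | .r3a | .r3b => [⟨c.ids.take (c.l + 1), c.l, c.l⟩, ⟨c.ids.drop (c.l + 1), 0, 0⟩]
  | .r3c => [⟨c.ids.drop c.l, 0, 0⟩, ⟨c.ids.take c.l, c.l - 1, c.l - 1⟩]
  | .r3d => [⟨everySecond c.ids, 0, c.m / 2 - 1⟩, ⟨everySecond c.ids.tail, c.m / 2 - 1, 0⟩]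
  | .r3e => [⟨everySecond c.ids.tail, c.m / 2 - 1, 0⟩, ⟨everySecond c.ids, 0, c.m / 2 - 1⟩]

/-- The nodes of `v_i`, in column coordinates, after `t` rounds of the given rule
(`t < rounds`). In column coordinates `(1, 0)` is the horizontal direction and `(0, 1)` the
direction of the columns, and `(0, 0)` is the node through which the left link is attached. -/
def nodesDuring (c : Column α) (ρ : Rule) (t i : ℕ) : Finset (ℤ × ℤ) :=
  match ρ, t with
  | .r1a, 1 | .r1b, 1 =>
      -- half of the shear of `(v_l, …, v_r)` to the horizontal axis
      if i ≤ c.l then {(0, (i : ℤ) - c.l)}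
      else if i ≤ c.r then
        let k : ℤ := ((i - c.l) / 2 : ℕ)
        if (i - c.l) % 2 = 0 then {(k, k)} else {(k, k + 1), (k + 1, k)}
      else {((((c.r - c.l + 1) / 2 : ℕ) : ℤ), (((c.r - c.l) / 2 : ℕ) : ℤ) + ((i : ℤ) - c.r))}
  | .r2a, 1 | .r2b, 1 =>
      -- half of the shear of `(v_r, …, v_l)` to the third axis
      if c.l ≤ i then {(0, (i : ℤ) - c.l)}
      else if c.r ≤ i then
        let k : ℤ := ((c.l - i) / 2 : ℕ)
        if (c.l - i) % 2 = 0 then {(k, -2 * k)} else {(k, -2 * k - 1), (k + 1, -2 * k - 1)}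
      else {((((c.l - c.r + 1) / 2 : ℕ) : ℤ), (i : ℤ) - c.l)}
  | .r2a, 2 | .r2b, 2 =>
      -- `(v_r, …, v_l)` is aligned to the third axis
      if c.l ≤ i then {(0, (i : ℤ) - c.l)}
      else if c.r ≤ i then {((c.l : ℤ) - i, (i : ℤ) - c.l)}
      else {((c.l : ℤ) - c.r, (i : ℤ) - c.l)}
  | .r2a, 3 | .r2b, 3 =>
      -- half of the shear of `(v_r, …, v_l)` to the horizontal axis
      if c.l ≤ i then {(0, (i : ℤ) - c.l)}
      else if c.r ≤ i then
        let k : ℤ := ((c.l - i) / 2 : ℕ)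
        if (c.l - i) % 2 = 0 then {(2 * k, -k)} else {(2 * k + 1, -k - 1), (2 * k + 1, -k)}
      else {((c.l : ℤ) - c.r, -(((c.l - c.r + 1) / 2 : ℕ) : ℤ) + ((i : ℤ) - c.r))}
  | .r3a, 1 | .r3b, 1 =>
      -- `v_l` has expanded
      if i < c.l then {(0, (i : ℤ) - c.l)}
      else if i = c.l then {(0, 0), (1, 0)}
      else {(1, (i : ℤ) - c.l)}
  | .r3a, 2 | .r3b, 2 =>
      -- `v_l` and `v_{l+1}` have performed a handover
      if i ≤ c.l then {(0, (i : ℤ) - c.l)}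
      else if i = c.l + 1 then {(1, 0), (1, 1)}
      else {(1, (i : ℤ) - c.l)}
  | .r3c, 1 =>
      -- `v_l` has expanded
      if i = c.l then {(0, 0), (1, 0)} else {(1, (i : ℤ) - c.l)}
  | .r3c, 2 =>
      -- `v_l` and `v_{l-1}` have performed a handover
      if i = c.l then {(0, 0)}
      else if i + 1 = c.l then {(1, -1), (1, 0)}
      else {(1, (i : ℤ) - c.l)}
  | .r3d, 1 =>
      -- every second amoebot, from the bottom, has expanded
      if i % 2 = 0 then {(0, (i : ℤ)), (1, (i : ℤ))} else {(1, (i : ℤ))}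
  | .r3d, 2 =>
      -- it has performed a handover with the amoebot above it
      if i % 2 = 0 then {(0, (i : ℤ))} else {(1, (i : ℤ) - 1), (1, (i : ℤ))}
  | .r3e, 1 =>
      -- every second amoebot, from the top, has expanded
      if i % 2 = 1 then {(0, (i : ℤ) - c.l), (1, (i : ℤ) - c.l)} else {(1, (i : ℤ) - c.l)}
  | .r3e, 2 =>
      -- it has performed a handover with the amoebot below it
      if i % 2 = 1 then {(0, (i : ℤ) - c.l)} else {(1, (i : ℤ) - c.l), (1, (i : ℤ) - c.l + 1)}
  | _, _ =>
      -- the column as such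
      {(0, (i : ℤ) - c.l)}

/-- The node, in column coordinates, through which the right link is attached after `t` rounds of
the given rule. -/
def exitDuring (c : Column α) (ρ : Rule) (t : ℕ) : ℤ × ℤ :=
  match ρ, t with
  | .r1a, 1 | .r1b, 1 => ((((c.r - c.l + 1) / 2 : ℕ) : ℤ), (((c.r - c.l) / 2 : ℕ) : ℤ))
  | .r2a, 1 | .r2b, 1 => ((((c.l - c.r + 1) / 2 : ℕ) : ℤ), (c.r : ℤ) - c.l)
  | .r2a, 2 | .r2b, 2 => ((c.l : ℤ) - c.r, (c.r : ℤ) - c.l)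
  | .r2a, 3 | .r2b, 3 => ((c.l : ℤ) - c.r, -(((c.l - c.r) / 2 : ℕ) : ℤ))
  | .r3a, 1 | .r3b, 1 | .r3c, 1 | .r3d, 1 | .r3e, 1
  | .r3a, 2 | .r3b, 2 | .r3c, 2 | .r3d, 2 | .r3e, 2 => (1, 0)
  | _, _ => (0, (c.r : ℤ) - c.l)

end Column

/-- The state graph: an edge from rule `ρ` to rule `σ` if an amoebot can end up in a column to
which `σ` has to be applied after `ρ` was applied to its current column. -/
def StateEdge (ρ σ : Rule) : Prop :=
  ∃ c : Column ℕ, c.WellFormed ∧ c.rule = some ρ ∧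
    ∃ c' ∈ c.children ρ, c'.WellFormed ∧ c'.rule = some σ

/-! ### The Monotone2LineSegment algorithm -/

/-- What a column is doing. During the two rounds of the preprocessing phase it either waits or is
shifted up by one position; `shift1` is the situation after the first of these rounds, when the top
amoebot has expanded upwards. Then `run t` means that `t` rounds of the current rule of the column
have been executed. -/
inductive Stage
  | wait0
  | wait1
  | shift0
  | shift1
  | run (t : ℕ)
  deriving DecidableEq

/-- A column together with its stage. -/
structure Piece (α : Type*) where
  col : Column α
  stage : Stage

namespace Piece

variable {α : Type*}

/-- The nodes of the `i`-th amoebot of the column, in column coordinates. -/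
def nodes (p : Piece α) (i : ℕ) : Finset (ℤ × ℤ) :=
  match p.stage with
  | .wait0 | .wait1 | .shift0 => {(0, (i : ℤ) - p.col.l)}
  | .shift1 =>
      if i + 1 = p.col.m then {(0, -1), (0, 0)} else {(0, (i : ℤ) - p.col.l - 1)}
  | .run t =>
      match p.col.rule with
      | none => {(0, (i : ℤ) - p.col.l)}
      | some ρ => p.col.nodesDuring ρ t i

/-- The node of the right link, in column coordinates. -/
def exit (p : Piece α) : ℤ × ℤ :=
  match p.stage with
  | .wait0 | .wait1 | .shift0 => (0, (p.col.r : ℤ) - p.col.l)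
  | .shift1 => (0, (p.col.r : ℤ) - p.col.l - 1)
  | .run t =>
      match p.col.rule with
      | none => (0, (p.col.r : ℤ) - p.col.l)
      | some ρ => p.col.exitDuring ρ t

/-- The orientation of the left link: horizontal, except at the beginning of a shift. -/
def entry (p : Piece α) : ℤ × ℤ :=
  match p.stage with
  | .shift0 => (1, -1)
  | _ => (1, 0)

/-- What becomes of a column in one round. -/
def next (p : Piece α) : List (Piece α) :=
  match p.stage with
  | .wait0 => [⟨p.col, .wait1⟩]
  | .shift0 => [⟨p.col, .shift1⟩]
  | .wait1 | .shift1 => [⟨p.col, .run 0⟩]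
  | .run t =>
      match p.col.rule with
      | none => [p]
      | some ρ =>
          if t + 1 < ρ.rounds then [⟨p.col, .run (t + 1)⟩]
          else (p.col.children ρ).map (fun c => ⟨c, .run 0⟩)

end Piece

section Algorithm

variable {ι : Type*}

/-- The state of the algorithm (its columns from left to right) after `t` rounds. -/
def stateAt (L : List (Piece ι)) (t : ℕ) : List (Piece ι) :=
  (fun st => st.flatMap Piece.next)^[t] L

/-- Column coordinates as grid vectors, for columns parallel to the axis `A`. -/
def Axis.vec (A : Axis) (c : ℤ × ℤ) : Node := c.1 • A.across + c.2 • A.dir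

/-- The origin of the column after `p`, where `o` is the origin of `p` and `q` is the next one. -/
def nextOrigin (A : Axis) (o : Node) (p q : Piece ι) : Node :=
  o + A.vec p.exit + A.vec q.entry

/-- The nodes of an amoebot when the columns are put next to each other along their links, the
origin of the first column being `o`. -/
def place [DecidableEq ι] (A : Axis) : Node → List (Piece ι) → ι → Finset Node
  | _, [], _ => ∅
  | o, [p], i =>
      if i ∈ p.col.ids then (p.nodes (p.col.ids.idxOf i)).image (fun c => o + A.vec c) else ∅
  | o, p :: q :: st, i =>
      if i ∈ p.col.ids then (p.nodes (p.col.ids.idxOf i)).image (fun c => o + A.vec c)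
      else place A (nextOrigin A o p q) (q :: st) i

/-- The configuration belonging to a state of the algorithm. -/
def toConfig [DecidableEq ι] (A : Axis) (o : Node) (st : List (Piece ι)) : Config ι :=
  ⟨place A o st⟩

/-- The links: the single bonds between consecutive columns that are not released. -/
def links (A : Axis) : Node → List (Piece ι) → Set (Sym2 Node)
  | _, [] => ∅
  | _, [_] => ∅
  | o, p :: q :: st =>
      insert s(o + A.vec p.exit, nextOrigin A o p q) (links A (nextOrigin A o p q) (q :: st))

/-- `L` describes the structure `S` with respect to the axis `A`, with one bond chosen between any
two adjacent columns: `L` lists the columns from left to right. The chosen bond is an arbitrary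
horizontal one, except that the right column has to be shifted if there is no horizontal bond, i.e.
if its top amoebot is one row below the bottom amoebot of the left column. The first column has no
left link and uses its bottom amoebot instead, the last one has no right link and uses its top
amoebot instead. -/
structure IsStart [DecidableEq ι] (A : Axis) (o : Node) (S : Config ι) (L : List (Piece ι)) :
    Prop where
  config_eq : toConfig A o L = S
  nodup : (L.flatMap (fun p => p.col.ids)).Nodup
  wellFormed : ∀ p ∈ L, p.col.WellFormed
  stage : ∀ p ∈ L, p.stage = .wait0 ∨ p.stage = .shift0
  first : ∀ p, L.head? = some p → p.stage = .wait0 ∧ p.col.l = 0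
  last : ∀ p, L.getLast? = some p → p.col.r + 1 = p.col.m
  shift : L.IsChain (fun p q => q.stage = .shift0 → p.col.r = 0 ∧ q.col.l + 1 = q.col.m)

/-- In the state `st`, the only bonds in `R` between amoebots of different columns are links. -/
def KeepsOnlyLinks [DecidableEq ι] (A : Axis) (o : Node) (st : List (Piece ι))
    (R : Set (Sym2 Node)) : Prop :=
  ∀ i j u w, u ∈ (toConfig A o st).occ i → w ∈ (toConfig A o st).occ j → s(u, w) ∈ R →
    (∃ p ∈ st, i ∈ p.col.ids ∧ j ∈ p.col.ids) ∨ s(u, w) ∈ links A o st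

/-- In the state `st`, a rule application to the column of amoebot `i` begins. -/
def BeginsRule (st : List (Piece ι)) (i : ι) : Prop :=
  ∃ p ∈ st, i ∈ p.col.ids ∧ p.stage = .run 0 ∧ p.col.rule ≠ none

/-- No column has a rule left to apply: every column consists of a single amoebot. -/
def Terminated (st : List (Piece ι)) : Prop :=
  ∀ p ∈ st, p.stage = .run 0 ∧ p.col.m = 1

end Algorithm

end Amoebot

set_option linter.unusedSimpArgs false
set_option linter.unreachableTactic false
set_option linter.unusedTactic false
set_option linter.unnecessarySeqFocus false
set_option linter.unusedVariables false

namespace Amoebot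

/-! ### Column coordinates -/

/-! Columns hang together by single links only, so each column can be studied alone, in coordinates
whose origin is the node of its left link. Two local facts suffice. At every stage the column has no
collisions and stays in the strip between its two link nodes (`LocalValid`). In every round it moves
while a tree of its bonds keeps all orientations, and the link nodes go where the next stage expects
them (`LocalRound`).

Each link leads one step to the right, so the strips of different columns are disjoint, and no
collision arises whatever the other columns do (`Good.valid`). The local trees together with the
links connect everything, so the local rounds, each translated with its column, form one legal round
(`glue_round`, `Good.round`). The local facts are coordinate checks, rule by rule; `place_children`
shows that the last position of a rule is the resting position of the new columns, so the argument
can be iterated.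

For termination, Rules 1a, 2a and 3a leave only single amoebots and columns whose two links sit at
one common end. If such a column is odd, 3b or 3c cuts off the amoebot at that end. An even one is
halved by 3d or 3e into columns with links at opposite ends, which 1b or 2b lays out flat. This
gives at most four rules and 4 + 3 + 3 + 4 = 14 rounds, plus two for the preprocessing. The
potentials `roundsLeft` and `rulesLeft` record these counts (`Column.left_children`); as `rulesLeft`
drops along every edge of the state graph, that graph is acyclic.

The algorithm can be started because the columns of a monotone structure are intervals and
connectedness gives an edge between neighbouring columns. If their intervals share no height, the
edge is oblique and the right column lies immediately below the left one (`exists_isStart`). -/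

theorem grid_adj_iff (u v : Node) : grid.Adj u v ↔
    (v.1 = u.1 + 1 ∧ v.2 = u.2) ∨ (v.1 = u.1 ∧ v.2 = u.2 + 1) ∨ (v.1 + 1 = u.1 ∧ v.2 = u.2 + 1) ∨
    (v.1 + 1 = u.1 ∧ v.2 = u.2) ∨ (v.1 = u.1 ∧ v.2 + 1 = u.2) ∨
    (v.1 = u.1 + 1 ∧ v.2 + 1 = u.2) := by
  constructor
  · rintro ⟨A, h⟩
    cases A <;> simp only [Axis.dir, Prod.ext_iff, Prod.fst_sub, Prod.snd_sub] at h <;> omega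
  · intro h
    rcases h with h | h | h | h | h | h
    · exact ⟨.x, .inl (by simp only [Axis.dir, Prod.ext_iff, Prod.fst_sub, Prod.snd_sub]; omega)⟩
    · exact ⟨.y, .inl (by simp only [Axis.dir, Prod.ext_iff, Prod.fst_sub, Prod.snd_sub]; omega)⟩
    · exact ⟨.z, .inl (by simp only [Axis.dir, Prod.ext_iff, Prod.fst_sub, Prod.snd_sub]; omega)⟩
    · exact ⟨.x, .inr (by simp only [Axis.dir, Prod.ext_iff, Prod.fst_sub, Prod.snd_sub]; omega)⟩
    · exact ⟨.y, .inr (by simp only [Axis.dir, Prod.ext_iff, Prod.fst_sub, Prod.snd_sub]; omega)⟩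
    · exact ⟨.z, .inr (by simp only [Axis.dir, Prod.ext_iff, Prod.fst_sub, Prod.snd_sub]; omega)⟩

namespace Axis

theorem vec_add (A : Axis) (c d : ℤ × ℤ) : A.vec (c + d) = A.vec c + A.vec d := by
  simp only [vec, Prod.fst_add, Prod.snd_add, add_smul]; abel

theorem vec_sub (A : Axis) (c d : ℤ × ℤ) : A.vec (c - d) = A.vec c - A.vec d := by
  simp only [vec, Prod.fst_sub, Prod.snd_sub, sub_smul]; abel

@[simp] theorem vec_zero (A : Axis) : A.vec 0 = 0 := by simp [vec]

@[simp] theorem vec_y (c : ℤ × ℤ) : Axis.y.vec c = c := by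
  simp [vec, across, dir]

theorem vec_inj (A : Axis) {c d : ℤ × ℤ} : A.vec c = A.vec d ↔ c = d := by
  refine ⟨fun h => ?_, fun h => h ▸ rfl⟩
  cases A <;> simp [vec, across, dir, Prod.ext_iff] at h ⊢ <;> omega

theorem vec_surj (A : Axis) (u : Node) : ∃ c, A.vec c = u := by
  cases A
  · exact ⟨(-u.2, u.1 + u.2), by simp [vec, across, dir]⟩
  · exact ⟨u, by simp⟩
  · exact ⟨(u.1 + u.2, -u.1), by simp [vec, across, dir]⟩

/-- `A.vec` is the rotation by 0 or ±60 degrees that takes the `y`-direction to `A.dir`, so it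
permutes the six unit vectors. -/
theorem adj_vec (A : Axis) {c d : ℤ × ℤ} : grid.Adj (A.vec c) (A.vec d) ↔ grid.Adj c d := by
  rw [grid_adj_iff, grid_adj_iff]
  cases A <;> simp [vec, across, dir] <;> omega

theorem adj_add_vec (A : Axis) (o : Node) {c d : ℤ × ℤ} :
    grid.Adj (o + A.vec c) (o + A.vec d) ↔ grid.Adj c d := by
  rw [← A.adj_vec (c := c)]
  simp only [grid, add_sub_add_left_eq_sub]

theorem vec_add_inj (A : Axis) (o : Node) {c d : ℤ × ℤ} : o + A.vec c = o + A.vec d ↔ c = d := by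
  rw [add_right_inj, vec_inj]

end Axis

/-! ### Placing a list of columns -/

section Place

variable {ι : Type*}

/-- The amoebots of a state, column by column. -/
def allIds (st : List (Piece ι)) : List ι := st.flatMap (fun p => p.col.ids)

@[simp] theorem allIds_nil : allIds ([] : List (Piece ι)) = [] := rfl

@[simp] theorem allIds_cons (p : Piece ι) (st : List (Piece ι)) :
    allIds (p :: st) = p.col.ids ++ allIds st := rfl

@[simp] theorem allIds_append (st st' : List (Piece ι)) :
    allIds (st ++ st') = allIds st ++ allIds st' := by simp [allIds]

theorem mem_allIds {st : List (Piece ι)} {i : ι} :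
    i ∈ allIds st ↔ ∃ p ∈ st, i ∈ p.col.ids := by simp [allIds]

/-- The origin of the first column of `st`, when `st` is put behind `p`. -/
def originAfter (A : Axis) (o : Node) (p : Piece ι) : List (Piece ι) → Node
  | [] => o
  | q :: _ => nextOrigin A o p q

theorem place_cons [DecidableEq ι] (A : Axis) (o : Node) (p : Piece ι) (st : List (Piece ι)) (i : ι) :
    place A o (p :: st) i =
      if i ∈ p.col.ids then (p.nodes (p.col.ids.idxOf i)).image (fun c => o + A.vec c)
      else place A (originAfter A o p st) st i := by
  cases st <;> rfl

/-- The origin of the `k`-th column. -/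
def origin (A : Axis) : Node → List (Piece ι) → ℕ → Node
  | o, [], _ => o
  | o, _ :: _, 0 => o
  | o, p :: st, k + 1 => origin A (originAfter A o p st) st k

@[simp] theorem origin_zero (A : Axis) (o : Node) (st : List (Piece ι)) : origin A o st 0 = o := by
  cases st <;> rfl

theorem origin_succ (A : Axis) (o : Node) (st : List (Piece ι)) (k : ℕ) {p q : Piece ι}
    (hp : st[k]? = some p) (hq : st[k + 1]? = some q) :
    origin A o st (k + 1) = nextOrigin A (origin A o st k) p q := by
  induction st generalizing o k with
  | nil => simp at hp
  | cons a st ih =>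
    cases k with
    | zero =>
      cases st with
      | nil => simp at hq
      | cons b st =>
        simp only [List.getElem?_cons_zero, Option.some.injEq, zero_add,
          List.getElem?_cons_succ] at hp hq
        subst hp; subst hq; rfl
    | succ k =>
      simp only [List.getElem?_cons_succ] at hp hq
      exact ih _ k hp hq

theorem mem_links (A : Axis) (o : Node) (st : List (Piece ι)) (k : ℕ) {p q : Piece ι}
    (hp : st[k]? = some p) (hq : st[k + 1]? = some q) :
    s(origin A o st k + A.vec p.exit, origin A o st (k + 1)) ∈ links A o st := by
  induction st generalizing o k with
  | nil => simp at hp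
  | cons a st ih =>
    cases st with
    | nil => simp at hq
    | cons b st =>
      cases k with
      | zero =>
        simp only [List.getElem?_cons_zero, Option.some.injEq, zero_add,
          List.getElem?_cons_succ] at hp hq
        subst hp; subst hq
        exact Set.mem_insert _ _
      | succ k =>
        simp only [List.getElem?_cons_succ] at hp hq
        exact Set.mem_insert_of_mem _ (ih _ k hp hq)

theorem place_eq [DecidableEq ι] (A : Axis) (o : Node) (st : List (Piece ι)) (hn : (allIds st).Nodup) (k : ℕ)
    {p : Piece ι} (hp : st[k]? = some p) {i : ι} (hi : i ∈ p.col.ids) :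
    place A o st i =
      (p.nodes (p.col.ids.idxOf i)).image (fun c => origin A o st k + A.vec c) := by
  induction st generalizing o k with
  | nil => simp at hp
  | cons a st ih =>
    rw [allIds_cons, List.nodup_append] at hn
    rw [place_cons]
    cases k with
    | zero =>
      simp only [List.getElem?_cons_zero, Option.some.injEq] at hp
      subst hp
      rw [if_pos hi]; rfl
    | succ k =>
      simp only [List.getElem?_cons_succ] at hp
      rw [if_neg, ih _ hn.2.1 k hp]
      · rfl
      · intro ha
        exact hn.2.2 i ha i (mem_allIds.2 ⟨p, List.mem_of_getElem? hp, hi⟩) rfl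

theorem place_eq_empty [DecidableEq ι] (A : Axis) (o : Node) (st : List (Piece ι)) {i : ι} (hi : i ∉ allIds st) :
    place A o st i = ∅ := by
  induction st generalizing o with
  | nil => rfl
  | cons a st ih =>
    rw [allIds_cons, List.mem_append, not_or] at hi
    rw [place_cons, if_neg hi.1, ih _ hi.2]

/-- The node of the right link of the last column. -/
def lastExit (A : Axis) : Node → List (Piece ι) → Node
  | o, [] => o
  | o, [p] => o + A.vec p.exit
  | o, p :: q :: st => lastExit A (nextOrigin A o p q) (q :: st)

/-- As `Axis.y.vec` is the identity, this reduces placements along any axis to column coordinates;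
the geometry of the rules is computed only for `.y`. -/
theorem place_vec [DecidableEq ι] (A : Axis) (o : Node) (c : ℤ × ℤ) (st : List (Piece ι)) (i : ι) :
    place A (o + A.vec c) st i = (place .y c st i).image (fun u => o + A.vec u) := by
  induction st generalizing c with
  | nil => rfl
  | cons p st ih =>
    rw [place_cons, place_cons]
    split
    · rw [Finset.image_image]
      congr 1
      funext u
      simp [A.vec_add, add_assoc]
    · cases st with
      | nil => rfl
      | cons q st =>
        rw [← ih]
        simp [originAfter, nextOrigin, A.vec_add, add_assoc]

theorem lastExit_vec (A : Axis) (o : Node) (c : ℤ × ℤ) (st : List (Piece ι)) :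
    lastExit A (o + A.vec c) st = o + A.vec (lastExit .y c st) := by
  induction st generalizing c with
  | nil => rfl
  | cons p st ih =>
    cases st with
    | nil => simp [lastExit, A.vec_add, add_assoc]
    | cons q st =>
      simp only [lastExit]
      rw [← ih]
      simp [nextOrigin, A.vec_add, add_assoc]

/-- Whatever follows `st` depends on it only through its last link node. This allows a column to be
replaced by several without looking at the others. -/
theorem place_append [DecidableEq ι] (A : Axis) (o : Node) (st : List (Piece ι)) (q : Piece ι)
    (st' : List (Piece ι)) (i : ι) (hst : st ≠ []) :
    place A o (st ++ q :: st') i =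
      if i ∈ allIds st then place A o st i
      else place A (lastExit A o st + A.vec q.entry) (q :: st') i := by
  induction st generalizing o with
  | nil => exact absurd rfl hst
  | cons p st ih =>
    rw [List.cons_append, place_cons, place_cons, allIds_cons]
    cases st with
    | nil => by_cases h : i ∈ p.col.ids <;> simp [lastExit, originAfter, nextOrigin, h]
    | cons r st =>
      have := ih (nextOrigin A o p r) (by simp)
      by_cases h : i ∈ p.col.ids
      · simp [h]
      · simp only [h, if_false, List.mem_append, false_or]
        exact this

end Place

/-! ### Rounds of a single column -/

theorem mem_single {u : Node} {a b : ℤ} : u ∈ ({(a, b)} : Finset Node) ↔ u.1 = a ∧ u.2 = b := by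
  rw [Finset.mem_singleton, Prod.ext_iff]

theorem mem_pair {u : Node} {a b c d : ℤ} :
    u ∈ ({(a, b), (c, d)} : Finset Node) ↔ (u.1 = a ∧ u.2 = b) ∨ (u.1 = c ∧ u.2 = d) := by
  rw [Finset.mem_insert, mem_single, Prod.ext_iff]

/-- The placement `N` of `m` amoebots in column coordinates is valid, keeps to the strip between its
links, and occupies the nodes of the links. -/
structure LocalValid (m : ℕ) (N : ℕ → Finset Node) (x : Node) : Prop where
  shape : ∀ i < m, (Config.mk N).Contracted i ∨ (Config.mk N).Expanded i
  disjoint : ∀ i < m, ∀ j < m, ∀ u ∈ N i, u ∈ N j → i = j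
  strip : ∀ i < m, ∀ u ∈ N i, 0 ≤ u.1 ∧ u.1 ≤ x.1
  origin_mem : ∃ i < m, 0 ∈ N i
  exit_mem : ∃ i < m, x ∈ N i

/-- The first `m` amoebots, placed at `N`, can move jointly to `N'` while a tree of bonds between
them remains; `par` gives the parents in this tree. A bond at the node `x` is carried to `x'`, and
one at the origin is carried to `f`. -/
def LocalRound (m : ℕ) (N N' : ℕ → Finset Node) (x x' f : Node) : Prop :=
  ∃ (par : ℕ → ℕ) (hi lo hi' lo' : ℕ → Node) (mv : ℕ → Move ℕ) (τ : ℕ → Node),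
    (∀ i < m, MoveOK ⟨N⟩ {e | ∃ k, 0 < k ∧ k < m ∧ e = s(hi k, lo k)} ⟨N'⟩ mv τ i ∧
      ∀ j, mv i = .handover j → j < m) ∧
    (∀ k, 0 < k → k < m → par k < k ∧ hi k ∈ N (par k) ∧ lo k ∈ N k ∧ grid.Adj (hi k) (lo k) ∧
      Carries ⟨N'⟩ mv τ (par k) (hi k) (hi' k) ∧ Carries ⟨N'⟩ mv τ k (lo k) (lo' k) ∧
      lo' k - hi' k = lo k - hi k) ∧
    (∃ i < m, 0 ∈ N i ∧ Carries ⟨N'⟩ mv τ i 0 f) ∧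
    (∃ i < m, x ∈ N i ∧ Carries ⟨N'⟩ mv τ i x x')

/-- A round without handovers, in which no amoebot is expanded both before and after. -/
theorem LocalRound.of_reshape {m : ℕ} {N N' : ℕ → Finset Node} {x x' f : Node}
    (par : ℕ → ℕ) (hi lo hi' lo' : ℕ → Node)
    (hN : ∀ i < m, (Config.mk N).Contracted i ∨ (Config.mk N).Expanded i)
    (hN' : ∀ i < m, (Config.mk N').Contracted i ∨ (Config.mk N').Expanded i)
    (hc : ∀ i < m, (Config.mk N).Contracted i ∨ (Config.mk N').Contracted i)
    (hb : ∀ k, 0 < k → k < m → par k < k ∧ (hi k ∈ N (par k) ∧ lo k ∈ N k) ∧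
      (hi' k ∈ N' (par k) ∧ lo' k ∈ N' k) ∧ grid.Adj (hi k) (lo k) ∧
      lo' k - hi' k = lo k - hi k)
    (ho : ∃ i < m, 0 ∈ N i ∧ f ∈ N' i) (hx : ∃ i < m, x ∈ N i ∧ x' ∈ N' i) :
    LocalRound m N N' x x' f := by
  classical
  set mv : ℕ → Move ℕ := fun i =>
    if (Config.mk N).Contracted i then
      if (Config.mk N').Contracted i then .idle else .expand
    else .contract with hmv
  -- For a contracted amoebot that stays contracted, this difference of sums is its displacement;
  -- expanding and contracting amoebots never use the value.
  set τ : ℕ → Node := fun i => ∑ u ∈ N' i, u - ∑ u ∈ N i, u with hτ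
  have carry : ∀ i u u', u ∈ N i → u' ∈ N' i → Carries ⟨N'⟩ mv τ i u u' := by
    intro i u u' hu hu'
    by_cases h : (Config.mk N).Contracted i
    · by_cases h' : (Config.mk N').Contracted i
      · obtain ⟨v, hv⟩ := h
        obtain ⟨v', hv'⟩ := h'
        have : mv i = .idle := by simp only [hmv]; rw [if_pos ⟨v, hv⟩, if_pos ⟨v', hv'⟩]
        simp only [Carries, this, hτ]
        simp only at hv hv'
        rw [hv, Finset.mem_singleton] at hu
        rw [hv', Finset.mem_singleton] at hu'
        rw [hv, hv', hu, hu']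
        simp
      · have : mv i = .expand := by simp only [hmv]; rw [if_pos h, if_neg h']
        simpa only [Carries, this] using hu'
    · have : mv i = .contract := by simp only [hmv]; rw [if_neg h]
      simpa only [Carries, this] using hu'
  refine ⟨par, hi, lo, hi', lo', mv, τ, ?_, ?_, ?_, ?_⟩
  · intro i him
    by_cases h : (Config.mk N).Contracted i
    · by_cases h' : (Config.mk N').Contracted i
      · have h1 := h
        have h2 := h'
        obtain ⟨v, hv⟩ := h
        obtain ⟨v', hv'⟩ := h'
        have : mv i = .idle := by simp only [hmv]; rw [if_pos h1, if_pos h2]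
        simp only at hv hv'
        refine ⟨?_, fun j hj => by rw [this] at hj; cases hj⟩
        simp only [MoveOK, this, hτ, hv, hv']
        simp
      · have : mv i = .expand := by simp only [hmv]; rw [if_pos h, if_neg h']
        refine ⟨?_, fun j hj => by rw [this] at hj; cases hj⟩
        simp only [MoveOK, this]
        exact ⟨h, (hN' i him).resolve_left h'⟩
    · have : mv i = .contract := by simp only [hmv]; rw [if_neg h]
      refine ⟨?_, fun j hj => by rw [this] at hj; cases hj⟩
      simp only [MoveOK, this]
      exact ⟨(hN i him).resolve_left h, (hc i him).resolve_left h⟩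
  · intro k h0 hk
    obtain ⟨h1, h2, h3, h4, h5⟩ := hb k h0 hk
    exact ⟨h1, h2.1, h2.2, h4, carry _ _ _ h2.1 h3.1, carry _ _ _ h2.2 h3.2, h5⟩
  · obtain ⟨i, h, h1, h2⟩ := ho
    exact ⟨i, h, h1, carry _ _ _ h1 h2⟩
  · obtain ⟨i, h, h1, h2⟩ := hx
    exact ⟨i, h, h1, carry _ _ _ h1 h2⟩

/-- A round in which nothing but handovers takes place; `h` gives the partners. -/
theorem LocalRound.of_handover {m : ℕ} {N N' : ℕ → Finset Node} {x : Node}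
    (par : ℕ → ℕ) (hi lo : ℕ → Node) (h : ℕ → ℕ)
    (hh : ∀ i < m, h i < m ∧ h (h i) = i)
    (hid : ∀ i < m, h i = i → N' i = N i)
    (hho : ∀ i < m, h i ≠ i → ∃ c d c₀ x₁ x₂, (c = i ∧ d = h i ∨ d = i ∧ c = h i) ∧
      N c = {c₀} ∧ N d = {x₁, x₂} ∧ x₁ ≠ x₂ ∧
      (∃ k, 0 < k ∧ k < m ∧ (hi k = c₀ ∧ lo k = x₁ ∨ hi k = x₁ ∧ lo k = c₀)) ∧
      N' c = {c₀, x₁} ∧ N' d = {x₂})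
    (hb : ∀ k, 0 < k → k < m → par k < k ∧ (hi k ∈ N (par k) ∧ lo k ∈ N k) ∧
      grid.Adj (hi k) (lo k))
    (ho : ∃ i < m, 0 ∈ N i) (hx : ∃ i < m, x ∈ N i) :
    LocalRound m N N' x x 0 := by
  set mv : ℕ → Move ℕ := fun i => if h i = i then .idle else .handover (h i) with hmv
  have carry : ∀ i u, Carries ⟨N'⟩ mv (fun _ => 0) i u u := by
    intro i u
    by_cases hi : h i = i
    · have : mv i = .idle := by simp only [hmv]; rw [if_pos hi]
      simp [Carries, this]
    · have : mv i = .handover (h i) := by simp only [hmv]; rw [if_neg hi]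
      simp [Carries, this]
  refine ⟨par, hi, lo, hi, lo, mv, fun _ => 0, ?_, ?_, ?_, ?_⟩
  · intro i him
    by_cases hii : h i = i
    · have : mv i = .idle := by simp only [hmv]; rw [if_pos hii]
      refine ⟨?_, fun j hj => by rw [this] at hj; cases hj⟩
      simp [MoveOK, this, hid i him hii]
    · have h1 : mv i = .handover (h i) := by simp only [hmv]; rw [if_neg hii]
      refine ⟨?_, fun j hj => by rw [h1] at hj; cases hj; exact (hh i him).1⟩
      have h2 : mv (h i) = .handover i := by
        simp only [hmv]; rw [(hh i him).2, if_neg (fun e => hii e.symm)]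
      simp only [MoveOK, h1]
      refine ⟨h2, trivial, ?_⟩
      obtain ⟨c, d, c₀, x₁, x₂, hcd, hc, hd, hne, ⟨k, hk0, hkm, hk⟩, hc', hd'⟩ := hho i him hii
      have key : Handover ⟨N⟩ {e | ∃ k, 0 < k ∧ k < m ∧ e = s(hi k, lo k)} ⟨N'⟩ 0 c d := by
        refine ⟨c₀, x₁, x₂, hc, hd, hne, ⟨k, hk0, hkm, ?_⟩, by simpa using hc', by simpa using hd'⟩
        rcases hk with ⟨rfl, rfl⟩ | ⟨rfl, rfl⟩
        · rfl
        · exact Sym2.eq_swap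
      rcases hcd with ⟨rfl, rfl⟩ | ⟨rfl, rfl⟩
      · exact .inl key
      · exact .inr key
  · intro k h0 hk
    obtain ⟨h1, h2, h3⟩ := hb k h0 hk
    exact ⟨h1, h2.1, h2.2, h3, carry _ _, carry _ _, rfl⟩
  · obtain ⟨i, h, h1⟩ := ho
    exact ⟨i, h, h1, carry _ _⟩
  · obtain ⟨i, h, h1⟩ := hx
    exact ⟨i, h, h1, carry _ _⟩

/-! ### Resting and final positions of a column -/

namespace Column

variable {α : Type*}

/-- The node of `v_i` after the last round of a rule. -/
def nodeFinal (c : Column α) (ρ : Rule) (i : ℕ) : Node :=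
  match ρ with
  | .r1a | .r1b =>
      if i ≤ c.l then (0, (i : ℤ) - c.l)
      else if i ≤ c.r then ((i : ℤ) - c.l, 0)
      else ((c.r : ℤ) - c.l, (i : ℤ) - c.r)
  | .r2a | .r2b =>
      if c.l ≤ i then (0, (i : ℤ) - c.l)
      else if c.r ≤ i then ((c.l : ℤ) - i, 0)
      else ((c.l : ℤ) - c.r, (i : ℤ) - c.r)
  | .r3a | .r3b =>
      if i ≤ c.l then (0, (i : ℤ) - c.l) else (1, (i : ℤ) - c.l - 1)
  | .r3c =>
      if i = c.l then (0, 0) else (1, (i : ℤ) + 1 - c.l)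
  | .r3d =>
      if i % 2 = 0 then (0, ((i / 2 : ℕ) : ℤ)) else (1, ((i / 2 : ℕ) : ℤ))
  | .r3e =>
      if i % 2 = 1 then (0, ((i / 2 : ℕ) : ℤ) - ((c.m / 2 - 1 : ℕ) : ℤ))
      else (1, ((i / 2 : ℕ) : ℤ) - ((c.m / 2 - 1 : ℕ) : ℤ))

/-- The node of the right link after the last round of a rule. -/
def exitFinal (c : Column α) (ρ : Rule) : Node :=
  match ρ with
  | .r1a | .r1b => ((c.r : ℤ) - c.l, 0)
  | .r2a | .r2b => ((c.l : ℤ) - c.r, 0)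
  | .r3a | .r3b | .r3c | .r3d | .r3e => (1, 0)

/-- The column at rest. -/
def nodesRest (c : Column α) (i : ℕ) : Finset Node := {(0, (i : ℤ) - c.l)}

theorem localValid_rest (c : Column α) (h : c.WellFormed) :
    LocalValid c.m c.nodesRest (0, (c.r : ℤ) - c.l) where
  shape i _ := .inl ⟨_, rfl⟩
  disjoint i _ j _ u hi hj := by
    simp only [nodesRest, Finset.mem_singleton] at hi hj
    rw [hi] at hj
    simp only [Prod.ext_iff] at hj
    omega
  strip i _ u hu := by
    simp only [nodesRest, Finset.mem_singleton] at hu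
    simp [hu]
  origin_mem := ⟨c.l, h.1, by simp [nodesRest, mem_single, Prod.ext_iff]⟩
  exit_mem := ⟨c.r, h.2, by simp [nodesRest, mem_single]⟩

/-- A waiting or finished column still has to supply its spanning path of bonds, because its
neighbours' movements may translate it as a whole. -/
theorem localRound_rest (c : Column α) (h : c.WellFormed) :
    LocalRound c.m c.nodesRest c.nodesRest (0, (c.r : ℤ) - c.l) (0, (c.r : ℤ) - c.l) 0 := by
  refine .of_reshape (fun k => k - 1) (fun k => (0, (k : ℤ) - 1 - c.l)) (fun k => (0, (k : ℤ) - c.l))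
    (fun k => (0, (k : ℤ) - 1 - c.l)) (fun k => (0, (k : ℤ) - c.l))
    (fun i _ => .inl ⟨_, rfl⟩) (fun i _ => .inl ⟨_, rfl⟩) (fun i _ => .inl ⟨_, rfl⟩) ?_
    ⟨c.l, h.1, by simp [nodesRest, mem_single, Prod.ext_iff]⟩ ⟨c.r, h.2, by simp [nodesRest, mem_single]⟩
  intro k h0 hk
  simp only [nodesRest, grid_adj_iff, mem_single, true_and, and_true, Prod.mk_sub_mk,
    Prod.ext_iff]
  omega

end Column

/-! ### Shears: Rules 1 and 2 -/

namespace Column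

variable {α : Type*}

/-- Halfway through the shear of Rule 1. -/
theorem localValid_r1_one (c : Column α) (h : c.l < c.r) (hr : c.r < c.m) :
    LocalValid c.m (c.nodesDuring .r1a 1) (c.exitDuring .r1a 1) where
  shape i hi := by
    simp only [Config.Contracted, Config.Expanded, nodesDuring]
    split_ifs <;> first
      | exact .inl ⟨_, rfl⟩
      | exact .inr ⟨_, _, by
        simp only [grid_adj_iff, true_and, and_true, true_or, or_true, and_self] <;> omega, rfl⟩
  disjoint i hi j hj u hu hu' := by
    simp only [nodesDuring] at hu hu'
    split_ifs at hu hu' <;> simp only [mem_pair, mem_single] at hu hu' <;> omega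
  strip i hi u hu := by
    simp only [nodesDuring] at hu
    simp only [exitDuring]
    split_ifs at hu <;> simp only [mem_pair, mem_single] at hu <;> omega
  origin_mem := ⟨c.l, by omega, by
    simp only [nodesDuring]
    (try split_ifs) <;> simp only [mem_pair, mem_single, Prod.fst_zero,
      Prod.snd_zero, true_and, and_true, true_or, or_true, and_self] <;> omega⟩
  exit_mem := ⟨c.r, by omega, by
    simp only [nodesDuring, exitDuring]
    (try split_ifs) <;> simp only [mem_pair, mem_single,
      true_and, and_true, true_or, or_true, and_self] <;> omega⟩

/-- Halfway through the shear, consecutive amoebots of the sheared segment are joined both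
vertically and horizontally; this round keeps the vertical bonds. The `min`, with truncated
subtraction, counts the shear steps below an amoebot: 0 up to `v_l` and constant from `v_r` on.
Rounding half of it up gives the abscissa of the amoebot's right-hand node. -/
theorem localRound_r1_zero (c : Column α) (h : c.l < c.r) (hr : c.r < c.m) :
    LocalRound c.m c.nodesRest (c.nodesDuring .r1a 1) (0, (c.r : ℤ) - c.l) (c.exitDuring .r1a 1) 0 := by
  refine .of_reshape (fun k => k - 1)
    (fun k => (0, (k : ℤ) - 1 - c.l))
    (fun k => (0, (k : ℤ) - c.l))
    (fun k => ((((min (k - 1 - c.l) (c.r - c.l) + 1) / 2 : ℕ) : ℤ), ((k - 1 : ℕ) : ℤ) - c.l - ((min (k - 1 - c.l) (c.r - c.l) + 1) / 2 : ℕ)))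
    (fun k => ((((min (k - 1 - c.l) (c.r - c.l) + 1) / 2 : ℕ) : ℤ), ((k - 1 : ℕ) : ℤ) - c.l - ((min (k - 1 - c.l) (c.r - c.l) + 1) / 2 : ℕ)) + (0, 1))
    (fun i _ => .inl ⟨_, rfl⟩)
    (c.localValid_r1_one h hr).shape (fun i _ => .inl ⟨_, rfl⟩)
    (fun k h0 hk => ⟨?_, ⟨?_, ?_⟩, ⟨?_, ?_⟩, ?_, ?_⟩) ⟨c.l, by omega, ?_, ?_⟩ ⟨c.r, by omega, ?_, ?_⟩
  all_goals
    (try simp only [nodesDuring, nodesRest, nodeFinal, exitDuring, exitFinal, grid_adj_iff,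
      Prod.mk_sub_mk, Prod.mk_add_mk])
    (try split_ifs) <;>
      (try simp only [mem_pair, mem_single, true_and, and_true, true_or, or_true, and_self, Prod.mk_sub_mk, Prod.ext_iff,
        grid_adj_iff, Prod.mk_add_mk, Prod.fst_zero, Prod.snd_zero, Prod.fst_sub, Prod.snd_sub]) <;>
      omega

/-- The contraction keeps the horizontal bonds of the halfway position inside the segment and the
vertical ones outside it. -/
theorem localRound_r1_one (c : Column α) (h : c.l < c.r) (hr : c.r < c.m) :
    LocalRound c.m (c.nodesDuring .r1a 1) (fun i => {c.nodeFinal .r1a i}) (c.exitDuring .r1a 1) (c.exitFinal .r1a) 0 := by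
  refine .of_reshape (fun k => k - 1)
    (fun k => ((((min (k - c.l) (c.r - c.l) + 1) / 2 : ℕ) : ℤ), ((k : ℕ) : ℤ) - c.l - ((min (k - c.l) (c.r - c.l) + 1) / 2 : ℕ)) - if c.l < k ∧ k ≤ c.r then (1, 0) else (0, 1))
    (fun k => ((((min (k - c.l) (c.r - c.l) + 1) / 2 : ℕ) : ℤ), ((k : ℕ) : ℤ) - c.l - ((min (k - c.l) (c.r - c.l) + 1) / 2 : ℕ)))
    (fun k => c.nodeFinal .r1a (k - 1))
    (fun k => c.nodeFinal .r1a k)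
    (c.localValid_r1_one h hr).shape
    (fun i _ => .inl ⟨_, rfl⟩) (fun i _ => .inr ⟨_, rfl⟩)
    (fun k h0 hk => ⟨?_, ⟨?_, ?_⟩, ⟨?_, ?_⟩, ?_, ?_⟩) ⟨c.l, by omega, ?_, ?_⟩ ⟨c.r, by omega, ?_, ?_⟩
  all_goals
    (try simp only [nodesDuring, nodesRest, nodeFinal, exitDuring, exitFinal, grid_adj_iff,
      Prod.mk_sub_mk, Prod.mk_add_mk])
    (try split_ifs) <;>
      (try simp only [mem_pair, mem_single, true_and, and_true, true_or, or_true, and_self, Prod.mk_sub_mk, Prod.ext_iff,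
        grid_adj_iff, Prod.mk_add_mk, Prod.fst_zero, Prod.snd_zero, Prod.fst_sub, Prod.snd_sub]) <;>
      omega

/-- Halfway through the first shear of Rule 2. -/
theorem localValid_r2_one (c : Column α) (h : c.r < c.l) (hl : c.l < c.m) :
    LocalValid c.m (c.nodesDuring .r2a 1) (c.exitDuring .r2a 1) where
  shape i hi := by
    simp only [Config.Contracted, Config.Expanded, nodesDuring]
    split_ifs <;> first
      | exact .inl ⟨_, rfl⟩
      | exact .inr ⟨_, _, by
        simp only [grid_adj_iff, true_and, and_true, true_or, or_true, and_self] <;> omega, rfl⟩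
  disjoint i hi j hj u hu hu' := by
    simp only [nodesDuring] at hu hu'
    split_ifs at hu hu' <;> simp only [mem_pair, mem_single] at hu hu' <;> omega
  strip i hi u hu := by
    simp only [nodesDuring] at hu
    simp only [exitDuring]
    split_ifs at hu <;> simp only [mem_pair, mem_single] at hu <;> omega
  origin_mem := ⟨c.l, by omega, by
    simp only [nodesDuring]
    (try split_ifs) <;> simp only [mem_pair, mem_single, Prod.fst_zero,
      Prod.snd_zero, true_and, and_true, true_or, or_true, and_self] <;> omega⟩
  exit_mem := ⟨c.r, by omega, by
    simp only [nodesDuring, exitDuring]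
    (try split_ifs) <;> simp only [mem_pair, mem_single,
      true_and, and_true, true_or, or_true, and_self] <;> omega⟩

/-- Between the two shears of Rule 2. -/
theorem localValid_r2_two (c : Column α) (h : c.r < c.l) (hl : c.l < c.m) :
    LocalValid c.m (c.nodesDuring .r2a 2) (c.exitDuring .r2a 2) where
  shape i hi := by
    simp only [Config.Contracted, Config.Expanded, nodesDuring]
    split_ifs <;> first
      | exact .inl ⟨_, rfl⟩
      | exact .inr ⟨_, _, by
        simp only [grid_adj_iff, true_and, and_true, true_or, or_true, and_self] <;> omega, rfl⟩
  disjoint i hi j hj u hu hu' := by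
    simp only [nodesDuring] at hu hu'
    split_ifs at hu hu' <;> simp only [mem_pair, mem_single] at hu hu' <;> omega
  strip i hi u hu := by
    simp only [nodesDuring] at hu
    simp only [exitDuring]
    split_ifs at hu <;> simp only [mem_pair, mem_single] at hu <;> omega
  origin_mem := ⟨c.l, by omega, by
    simp only [nodesDuring]
    (try split_ifs) <;> simp only [mem_pair, mem_single, Prod.fst_zero,
      Prod.snd_zero, true_and, and_true, true_or, or_true, and_self] <;> omega⟩
  exit_mem := ⟨c.r, by omega, by
    simp only [nodesDuring, exitDuring]
    (try split_ifs) <;> simp only [mem_pair, mem_single,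
      true_and, and_true, true_or, or_true, and_self] <;> omega⟩

/-- Halfway through the second shear of Rule 2. -/
theorem localValid_r2_three (c : Column α) (h : c.r < c.l) (hl : c.l < c.m) :
    LocalValid c.m (c.nodesDuring .r2a 3) (c.exitDuring .r2a 3) where
  shape i hi := by
    simp only [Config.Contracted, Config.Expanded, nodesDuring]
    split_ifs <;> first
      | exact .inl ⟨_, rfl⟩
      | exact .inr ⟨_, _, by
        simp only [grid_adj_iff, true_and, and_true, true_or, or_true, and_self] <;> omega, rfl⟩
  disjoint i hi j hj u hu hu' := by
    simp only [nodesDuring] at hu hu'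
    split_ifs at hu hu' <;> simp only [mem_pair, mem_single] at hu hu' <;> omega
  strip i hi u hu := by
    simp only [nodesDuring] at hu
    simp only [exitDuring]
    split_ifs at hu <;> simp only [mem_pair, mem_single] at hu <;> omega
  origin_mem := ⟨c.l, by omega, by
    simp only [nodesDuring]
    (try split_ifs) <;> simp only [mem_pair, mem_single, Prod.fst_zero,
      Prod.snd_zero, true_and, and_true, true_or, or_true, and_self] <;> omega⟩
  exit_mem := ⟨c.r, by omega, by
    simp only [nodesDuring, exitDuring]
    (try split_ifs) <;> simp only [mem_pair, mem_single,
      true_and, and_true, true_or, or_true, and_self] <;> omega⟩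

/-- Shear steps are now counted downwards from `v_l`. Every second amoebot expands horizontally, and
all vertical bonds survive. -/
theorem localRound_r2_zero (c : Column α) (h : c.r < c.l) (hl : c.l < c.m) :
    LocalRound c.m c.nodesRest (c.nodesDuring .r2a 1) (0, (c.r : ℤ) - c.l) (c.exitDuring .r2a 1) 0 := by
  refine .of_reshape (fun k => k - 1)
    (fun k => (0, (k : ℤ) - 1 - c.l))
    (fun k => (0, (k : ℤ) - c.l))
    (fun k => ((((min (c.l - k) (c.l - c.r) + 1) / 2 : ℕ) : ℤ), ((k : ℕ) : ℤ) - c.l) - (0, 1))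
    (fun k => ((((min (c.l - k) (c.l - c.r) + 1) / 2 : ℕ) : ℤ), ((k : ℕ) : ℤ) - c.l))
    (fun i _ => .inl ⟨_, rfl⟩)
    (c.localValid_r2_one h hl).shape (fun i _ => .inl ⟨_, rfl⟩)
    (fun k h0 hk => ⟨?_, ⟨?_, ?_⟩, ⟨?_, ?_⟩, ?_, ?_⟩) ⟨c.l, by omega, ?_, ?_⟩ ⟨c.r, by omega, ?_, ?_⟩
  all_goals
    (try simp only [nodesDuring, nodesRest, nodeFinal, exitDuring, exitFinal, grid_adj_iff,
      Prod.mk_sub_mk, Prod.mk_add_mk])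
    (try split_ifs) <;>
      (try simp only [mem_pair, mem_single, true_and, and_true, true_or, or_true, and_self, Prod.mk_sub_mk, Prod.ext_iff,
        grid_adj_iff, Prod.mk_add_mk, Prod.fst_zero, Prod.snd_zero, Prod.fst_sub, Prod.snd_sub]) <;>
      omega

/-- The two shears meet in a fully contracted position, so `LocalRound.of_reshape` applies on both
sides of it. -/
theorem contracted_r2_two (c : Column α) (i : ℕ) :
    (Config.mk (c.nodesDuring .r2a 2)).Contracted i := by
  simp only [Config.Contracted, nodesDuring]
  split_ifs <;> exact ⟨_, rfl⟩

/-- Besides the vertical bonds, the halfway position has bonds in direction `(-1, 1)` along the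
segment. These are kept by the contraction, which leaves the segment on the third axis. -/
theorem localRound_r2_one (c : Column α) (h : c.r < c.l) (hl : c.l < c.m) :
    LocalRound c.m (c.nodesDuring .r2a 1) (c.nodesDuring .r2a 2) (c.exitDuring .r2a 1) (c.exitDuring .r2a 2) 0 := by
  refine .of_reshape (fun k => k - 1)
    (fun k => ((((min (c.l - (k - 1)) (c.l - c.r) + 1) / 2 : ℕ) : ℤ), (k : ℤ) - 1 - c.l))
    (fun k => ((((min (c.l - (k - 1)) (c.l - c.r) + 1) / 2 : ℕ) : ℤ), (k : ℤ) - 1 - c.l) + (if c.r < k ∧ k ≤ c.l then (-1, 1) else (0, 1)))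
    (fun k => (((min (c.l - (k - 1)) (c.l - c.r) : ℕ) : ℤ), (k : ℤ) - 1 - c.l))
    (fun k => (((min (c.l - k) (c.l - c.r) : ℕ) : ℤ), (k : ℤ) - c.l))
    (c.localValid_r2_one h hl).shape
    (c.localValid_r2_two h hl).shape (fun i _ => .inr (c.contracted_r2_two i))
    (fun k h0 hk => ⟨?_, ⟨?_, ?_⟩, ⟨?_, ?_⟩, ?_, ?_⟩) ⟨c.l, by omega, ?_, ?_⟩ ⟨c.r, by omega, ?_, ?_⟩
  all_goals
    (try simp only [nodesDuring, nodesRest, nodeFinal, exitDuring, exitFinal, grid_adj_iff,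
      Prod.mk_sub_mk, Prod.mk_add_mk])
    (try split_ifs) <;>
      (try simp only [mem_pair, mem_single, true_and, and_true, true_or, or_true, and_self, Prod.mk_sub_mk, Prod.ext_iff,
        grid_adj_iff, Prod.mk_add_mk, Prod.fst_zero, Prod.snd_zero, Prod.fst_sub, Prod.snd_sub]) <;>
      omega

/-- The bonds in direction `(-1, 1)` are kept once more, this time while every second amoebot of the
segment expands vertically. -/
theorem localRound_r2_two (c : Column α) (h : c.r < c.l) (hl : c.l < c.m) :
    LocalRound c.m (c.nodesDuring .r2a 2) (c.nodesDuring .r2a 3) (c.exitDuring .r2a 2) (c.exitDuring .r2a 3) 0 := by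
  refine .of_reshape (fun k => k - 1)
    (fun k => (((min (c.l - (k - 1)) (c.l - c.r) : ℕ) : ℤ), (k : ℤ) - 1 - c.l))
    (fun k => (((min (c.l - k) (c.l - c.r) : ℕ) : ℤ), (k : ℤ) - c.l))
    (fun k => (((min (c.l - (k - 1)) (c.l - c.r) : ℕ) : ℤ), -(((min (c.l - (k - 1)) (c.l - c.r) + 1) / 2 : ℕ) : ℤ) + ((((k - 1) : ℕ) : ℤ) - c.l + (min (c.l - (k - 1)) (c.l - c.r) : ℕ))))
    (fun k => (((min (c.l - (k - 1)) (c.l - c.r) : ℕ) : ℤ), -(((min (c.l - (k - 1)) (c.l - c.r) + 1) / 2 : ℕ) : ℤ) + ((((k - 1) : ℕ) : ℤ) - c.l + (min (c.l - (k - 1)) (c.l - c.r) : ℕ))) + (if c.r < k ∧ k ≤ c.l then (-1, 1) else (0, 1)))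
    (c.localValid_r2_two h hl).shape
    (c.localValid_r2_three h hl).shape (fun i _ => .inl (c.contracted_r2_two i))
    (fun k h0 hk => ⟨?_, ⟨?_, ?_⟩, ⟨?_, ?_⟩, ?_, ?_⟩) ⟨c.l, by omega, ?_, ?_⟩ ⟨c.r, by omega, ?_, ?_⟩
  all_goals
    (try simp only [nodesDuring, nodesRest, nodeFinal, exitDuring, exitFinal, grid_adj_iff,
      Prod.mk_sub_mk, Prod.mk_add_mk])
    (try split_ifs) <;>
      (try simp only [mem_pair, mem_single, true_and, and_true, true_or, or_true, and_self, Prod.mk_sub_mk, Prod.ext_iff,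
        grid_adj_iff, Prod.mk_add_mk, Prod.fst_zero, Prod.snd_zero, Prod.fst_sub, Prod.snd_sub]) <;>
      omega

/-- The vertical expansions have created horizontal bonds along the segment; keeping these, the
contraction makes it horizontal. -/
theorem localRound_r2_three (c : Column α) (h : c.r < c.l) (hl : c.l < c.m) :
    LocalRound c.m (c.nodesDuring .r2a 3) (fun i => {c.nodeFinal .r2a i}) (c.exitDuring .r2a 3) (c.exitFinal .r2a) 0 := by
  refine .of_reshape (fun k => k - 1)
    (fun k => (((min (c.l - k) (c.l - c.r) : ℕ) : ℤ), -(((min (c.l - k) (c.l - c.r) + 1) / 2 : ℕ) : ℤ) + (((k : ℕ) : ℤ) - c.l + (min (c.l - k) (c.l - c.r) : ℕ))) - if c.r < k ∧ k ≤ c.l then (-1, 0) else (0, 1))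
    (fun k => (((min (c.l - k) (c.l - c.r) : ℕ) : ℤ), -(((min (c.l - k) (c.l - c.r) + 1) / 2 : ℕ) : ℤ) + (((k : ℕ) : ℤ) - c.l + (min (c.l - k) (c.l - c.r) : ℕ))))
    (fun k => c.nodeFinal .r2a (k - 1))
    (fun k => c.nodeFinal .r2a k)
    (c.localValid_r2_three h hl).shape
    (fun i _ => .inl ⟨_, rfl⟩) (fun i _ => .inr ⟨_, rfl⟩)
    (fun k h0 hk => ⟨?_, ⟨?_, ?_⟩, ⟨?_, ?_⟩, ?_, ?_⟩) ⟨c.l, by omega, ?_, ?_⟩ ⟨c.r, by omega, ?_, ?_⟩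
  all_goals
    (try simp only [nodesDuring, nodesRest, nodeFinal, exitDuring, exitFinal, grid_adj_iff,
      Prod.mk_sub_mk, Prod.mk_add_mk])
    (try split_ifs) <;>
      (try simp only [mem_pair, mem_single, true_and, and_true, true_or, or_true, and_self, Prod.mk_sub_mk, Prod.ext_iff,
        grid_adj_iff, Prod.mk_add_mk, Prod.fst_zero, Prod.snd_zero, Prod.fst_sub, Prod.snd_sub]) <;>
      omega

end Column

/-! ### Splits: Rule 3 -/

namespace Column

variable {α : Type*}

/-- One amoebot or every second one has expanded. -/
theorem localValid_r3a_one (c : Column α) (h : c.l = c.r) (hl : c.l + 1 < c.m) :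
    LocalValid c.m (c.nodesDuring .r3a 1) (c.exitDuring .r3a 1) where
  shape i hi := by
    simp only [Config.Contracted, Config.Expanded, nodesDuring]
    split_ifs <;> first
      | exact .inl ⟨_, rfl⟩
      | exact .inr ⟨_, _, by
        simp only [grid_adj_iff, true_and, and_true, true_or, or_true, and_self] <;> omega, rfl⟩
  disjoint i hi j hj u hu hu' := by
    simp only [nodesDuring] at hu hu'
    split_ifs at hu hu' <;> simp only [mem_pair, mem_single] at hu hu' <;> omega
  strip i hi u hu := by
    simp only [nodesDuring] at hu
    simp only [exitDuring]
    split_ifs at hu <;> simp only [mem_pair, mem_single] at hu <;> omega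
  origin_mem := ⟨c.l, by omega, by
    simp only [nodesDuring]
    (try split_ifs) <;> simp only [mem_pair, mem_single, Prod.fst_zero,
      Prod.snd_zero, true_and, and_true, true_or, or_true, and_self] <;> omega⟩
  exit_mem := ⟨c.l, by omega, by
    simp only [nodesDuring, exitDuring]
    (try split_ifs) <;> simp only [mem_pair, mem_single,
      true_and, and_true, true_or, or_true, and_self] <;> omega⟩

/-- The handovers have been performed. -/
theorem localValid_r3a_two (c : Column α) (h : c.l = c.r) (hl : c.l + 1 < c.m) :
    LocalValid c.m (c.nodesDuring .r3a 2) (c.exitDuring .r3a 2) where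
  shape i hi := by
    simp only [Config.Contracted, Config.Expanded, nodesDuring]
    split_ifs <;> first
      | exact .inl ⟨_, rfl⟩
      | exact .inr ⟨_, _, by
        simp only [grid_adj_iff, true_and, and_true, true_or, or_true, and_self] <;> omega, rfl⟩
  disjoint i hi j hj u hu hu' := by
    simp only [nodesDuring] at hu hu'
    split_ifs at hu hu' <;> simp only [mem_pair, mem_single] at hu hu' <;> omega
  strip i hi u hu := by
    simp only [nodesDuring] at hu
    simp only [exitDuring]
    split_ifs at hu <;> simp only [mem_pair, mem_single] at hu <;> omega
  origin_mem := ⟨c.l, by omega, by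
    simp only [nodesDuring]
    (try split_ifs) <;> simp only [mem_pair, mem_single, Prod.fst_zero,
      Prod.snd_zero, true_and, and_true, true_or, or_true, and_self] <;> omega⟩
  exit_mem := ⟨c.l + 1, by omega, by
    simp only [nodesDuring, exitDuring]
    (try split_ifs) <;> simp only [mem_pair, mem_single,
      true_and, and_true, true_or, or_true, and_self] <;> omega⟩

/-- By expanding, `v_l` pushes everything above it, and the right link, one step to the right. All
bonds of the column stay vertical; the one to `v_{l+1}` is attached to the new node `(1, 0)`. -/
theorem localRound_r3a_zero (c : Column α) (h : c.l = c.r) (hl : c.l + 1 < c.m) :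
    LocalRound c.m c.nodesRest (c.nodesDuring .r3a 1) (0, (c.r : ℤ) - c.l) (c.exitDuring .r3a 1) 0 := by
  refine .of_reshape (fun k => k - 1)
    (fun k => (0, (k : ℤ) - 1 - c.l))
    (fun k => (0, (k : ℤ) - c.l))
    (fun k => if k ≤ c.l then (0, (k : ℤ) - 1 - c.l) else (1, (k : ℤ) - 1 - c.l))
    (fun k => if k ≤ c.l then (0, (k : ℤ) - c.l) else (1, (k : ℤ) - c.l))
    (fun i _ => .inl ⟨_, rfl⟩)
    (c.localValid_r3a_one h hl).shape (fun i _ => .inl ⟨_, rfl⟩)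
    (fun k h0 hk => ⟨?_, ⟨?_, ?_⟩, ⟨?_, ?_⟩, ?_, ?_⟩) ⟨c.l, by omega, ?_, ?_⟩ ⟨c.l, by omega, ?_, ?_⟩
  all_goals
    (try simp only [nodesDuring, nodesRest, nodeFinal, exitDuring, exitFinal, grid_adj_iff,
      Prod.mk_sub_mk, Prod.mk_add_mk])
    (try split_ifs) <;>
      (try simp only [mem_pair, mem_single, true_and, and_true, true_or, or_true, and_self, Prod.mk_sub_mk, Prod.ext_iff,
        grid_adj_iff, Prod.mk_add_mk, Prod.fst_zero, Prod.snd_zero, Prod.fst_sub, Prod.snd_sub]) <;>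
      omega

theorem localRound_r3a_one (c : Column α) (h : c.l = c.r) (hl : c.l + 1 < c.m) :
    LocalRound c.m (c.nodesDuring .r3a 1) (c.nodesDuring .r3a 2) (c.exitDuring .r3a 1) (c.exitDuring .r3a 2) 0 := by
  refine .of_handover (fun k => k - 1)
    (fun k => if k ≤ c.l then (0, (k : ℤ) - 1 - c.l) else (1, (k : ℤ) - 1 - c.l))
    (fun k => if k ≤ c.l then (0, (k : ℤ) - c.l) else (1, (k : ℤ) - c.l))
    (fun i => if i = c.l then c.l + 1 else if i = c.l + 1 then c.l else i)
    (fun i hi => ?_) (fun i hi hii => ?_) (fun i hi hii => ?_)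
    (fun k h0 hk => ⟨?_, ⟨?_, ?_⟩, ?_⟩) ⟨c.l, by omega, ?_⟩ ⟨c.l, by omega, ?_⟩
  · split_ifs <;> omega
  · split_ifs at hii <;> simp only [nodesDuring] <;> split_ifs <;> first | rfl | omega
  -- The only pair: `v_{l+1}`, contracted at `(1, 1)`, takes over `(1, 0)` from `v_l`. The bond used
  -- is the tree bond with index `l + 1`.
  · refine ⟨c.l + 1, c.l, (1, 1), (1, 0), (0, 0), ?_, ?_, ?_, ?_, ⟨c.l + 1, by omega, hl, .inr ?_⟩,
      ?_, ?_⟩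
    · split_ifs at hii ⊢ <;> omega
    · simp [nodesDuring]
    · simp [nodesDuring, Finset.pair_comm]
    · simp
    · simp
    · simp [nodesDuring, Finset.pair_comm]
    · simp [nodesDuring]
  all_goals
    (try simp only [nodesDuring, exitDuring, grid_adj_iff, Prod.mk_add_mk])
    (try split_ifs) <;>
      (try simp only [mem_pair, mem_single, true_and, and_true, true_or, or_true, and_self, grid_adj_iff,
        Prod.mk_add_mk, Prod.fst_zero, Prod.snd_zero]) <;>
      omega

/-- `v_{l+1}` contracts into `(1, 0)` and pulls the amoebots above it down by one. The horizontal
bond from `v_l` to `(1, 0)`, available since the handover, replaces the vertical one and becomes the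
link between the two new columns. -/
theorem localRound_r3a_two (c : Column α) (h : c.l = c.r) (hl : c.l + 1 < c.m) :
    LocalRound c.m (c.nodesDuring .r3a 2) (fun i => {c.nodeFinal .r3a i}) (c.exitDuring .r3a 2) (c.exitFinal .r3a) 0 := by
  refine .of_reshape (fun k => k - 1)
    (fun k => if k ≤ c.l + 1 then (0, (k : ℤ) - 1 - c.l) else (1, (k : ℤ) - 1 - c.l))
    (fun k => if k ≤ c.l then (0, (k : ℤ) - c.l) else if k = c.l + 1 then (1, 0) else (1, (k : ℤ) - c.l))
    (fun k => c.nodeFinal .r3a (k - 1))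
    (fun k => c.nodeFinal .r3a k)
    (c.localValid_r3a_two h hl).shape
    (fun i _ => .inl ⟨_, rfl⟩) (fun i _ => .inr ⟨_, rfl⟩)
    (fun k h0 hk => ⟨?_, ⟨?_, ?_⟩, ⟨?_, ?_⟩, ?_, ?_⟩) ⟨c.l, by omega, ?_, ?_⟩ ⟨c.l + 1, by omega, ?_, ?_⟩
  all_goals
    (try simp only [nodesDuring, nodesRest, nodeFinal, exitDuring, exitFinal, grid_adj_iff,
      Prod.mk_sub_mk, Prod.mk_add_mk])
    (try split_ifs) <;>
      (try simp only [mem_pair, mem_single, true_and, and_true, true_or, or_true, and_self, Prod.mk_sub_mk, Prod.ext_iff,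
        grid_adj_iff, Prod.mk_add_mk, Prod.fst_zero, Prod.snd_zero, Prod.fst_sub, Prod.snd_sub]) <;>
      omega

/-- One amoebot or every second one has expanded. -/
theorem localValid_r3c_one (c : Column α) (h : c.l = c.r) (h0 : 0 < c.l) (hl : c.l + 1 = c.m) :
    LocalValid c.m (c.nodesDuring .r3c 1) (c.exitDuring .r3c 1) where
  shape i hi := by
    simp only [Config.Contracted, Config.Expanded, nodesDuring]
    split_ifs <;> first
      | exact .inl ⟨_, rfl⟩
      | exact .inr ⟨_, _, by
        simp only [grid_adj_iff, true_and, and_true, true_or, or_true, and_self] <;> omega, rfl⟩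
  disjoint i hi j hj u hu hu' := by
    simp only [nodesDuring] at hu hu'
    split_ifs at hu hu' <;> simp only [mem_pair, mem_single] at hu hu' <;> omega
  strip i hi u hu := by
    simp only [nodesDuring] at hu
    simp only [exitDuring]
    split_ifs at hu <;> simp only [mem_pair, mem_single] at hu <;> omega
  origin_mem := ⟨c.l, by omega, by
    simp only [nodesDuring]
    (try split_ifs) <;> simp only [mem_pair, mem_single, Prod.fst_zero,
      Prod.snd_zero, true_and, and_true, true_or, or_true, and_self] <;> omega⟩
  exit_mem := ⟨c.l, by omega, by
    simp only [nodesDuring, exitDuring]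
    (try split_ifs) <;> simp only [mem_pair, mem_single,
      true_and, and_true, true_or, or_true, and_self] <;> omega⟩

/-- The handovers have been performed. -/
theorem localValid_r3c_two (c : Column α) (h : c.l = c.r) (h0 : 0 < c.l) (hl : c.l + 1 = c.m) :
    LocalValid c.m (c.nodesDuring .r3c 2) (c.exitDuring .r3c 2) where
  shape i hi := by
    simp only [Config.Contracted, Config.Expanded, nodesDuring]
    split_ifs <;> first
      | exact .inl ⟨_, rfl⟩
      | exact .inr ⟨_, _, by
        simp only [grid_adj_iff, true_and, and_true, true_or, or_true, and_self] <;> omega, rfl⟩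
  disjoint i hi j hj u hu hu' := by
    simp only [nodesDuring] at hu hu'
    split_ifs at hu hu' <;> simp only [mem_pair, mem_single] at hu hu' <;> omega
  strip i hi u hu := by
    simp only [nodesDuring] at hu
    simp only [exitDuring]
    split_ifs at hu <;> simp only [mem_pair, mem_single] at hu <;> omega
  origin_mem := ⟨c.l, by omega, by
    simp only [nodesDuring]
    (try split_ifs) <;> simp only [mem_pair, mem_single, Prod.fst_zero,
      Prod.snd_zero, true_and, and_true, true_or, or_true, and_self] <;> omega⟩
  exit_mem := ⟨c.l - 1, by omega, by
    simp only [nodesDuring, exitDuring]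
    (try split_ifs) <;> simp only [mem_pair, mem_single,
      true_and, and_true, true_or, or_true, and_self] <;> omega⟩

theorem localRound_r3c_zero (c : Column α) (h : c.l = c.r) (h0 : 0 < c.l) (hl : c.l + 1 = c.m) :
    LocalRound c.m c.nodesRest (c.nodesDuring .r3c 1) (0, (c.r : ℤ) - c.l) (c.exitDuring .r3c 1) 0 := by
  refine .of_reshape (fun k => k - 1)
    (fun k => (0, (k : ℤ) - 1 - c.l))
    (fun k => (0, (k : ℤ) - c.l))
    (fun k => (1, (k : ℤ) - 1 - c.l))
    (fun k => (1, (k : ℤ) - c.l))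
    (fun i _ => .inl ⟨_, rfl⟩)
    (c.localValid_r3c_one h h0 hl).shape (fun i _ => .inl ⟨_, rfl⟩)
    (fun k h0 hk => ⟨?_, ⟨?_, ?_⟩, ⟨?_, ?_⟩, ?_, ?_⟩) ⟨c.l, by omega, ?_, ?_⟩ ⟨c.l, by omega, ?_, ?_⟩
  all_goals
    (try simp only [nodesDuring, nodesRest, nodeFinal, exitDuring, exitFinal, grid_adj_iff,
      Prod.mk_sub_mk, Prod.mk_add_mk])
    (try split_ifs) <;>
      (try simp only [mem_pair, mem_single, true_and, and_true, true_or, or_true, and_self, Prod.mk_sub_mk, Prod.ext_iff,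
        grid_adj_iff, Prod.mk_add_mk, Prod.fst_zero, Prod.snd_zero, Prod.fst_sub, Prod.snd_sub]) <;>
      omega

theorem localRound_r3c_one (c : Column α) (h : c.l = c.r) (h0 : 0 < c.l) (hl : c.l + 1 = c.m) :
    LocalRound c.m (c.nodesDuring .r3c 1) (c.nodesDuring .r3c 2) (c.exitDuring .r3c 1) (c.exitDuring .r3c 2) 0 := by
  refine .of_handover (fun k => k - 1)
    (fun k => (1, (k : ℤ) - 1 - c.l))
    (fun k => (1, (k : ℤ) - c.l))
    (fun i => if i = c.l then c.l - 1 else if i + 1 = c.l then c.l else i)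
    (fun i hi => ?_) (fun i hi hii => ?_) (fun i hi hii => ?_)
    (fun k h0 hk => ⟨?_, ⟨?_, ?_⟩, ?_⟩) ⟨c.l, by omega, ?_⟩ ⟨c.l, by omega, ?_⟩
  · split_ifs <;> omega
  · split_ifs at hii <;> simp only [nodesDuring] <;> split_ifs <;> first | rfl | omega
  · obtain ⟨l, hl'⟩ : ∃ l, c.l = l + 1 := ⟨c.l - 1, by omega⟩
    refine ⟨l, c.l, (1, -1), (1, 0), (0, 0), ?_, ?_, ?_, ?_, ⟨c.l, by omega, by omega, .inl ?_⟩,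
      ?_, ?_⟩
    · split_ifs at hii ⊢ <;> omega
    · simp [nodesDuring, hl']
    · simp [nodesDuring, Finset.pair_comm]
    · simp
    · simp
    · simp [nodesDuring, hl']
    · simp [nodesDuring]
  all_goals
    (try simp only [nodesDuring, exitDuring, grid_adj_iff, Prod.mk_add_mk])
    (try split_ifs) <;>
      (try simp only [mem_pair, mem_single, true_and, and_true, true_or, or_true, and_self, grid_adj_iff,
        Prod.mk_add_mk, Prod.fst_zero, Prod.snd_zero]) <;>
      omega

/-- The upside-down counterpart of the contraction in Rule 3a: `v_{l-1}` contracts into `(1, 0)` and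
pulls the amoebots below it up by one, while the top amoebot stays behind on the left. -/
theorem localRound_r3c_two (c : Column α) (h : c.l = c.r) (h0 : 0 < c.l) (hl : c.l + 1 = c.m) :
    LocalRound c.m (c.nodesDuring .r3c 2) (fun i => {c.nodeFinal .r3c i}) (c.exitDuring .r3c 2) (c.exitFinal .r3c) 0 := by
  refine .of_reshape (fun k => k - 1)
    (fun k => if k = c.l then (1, 0) else (1, (k : ℤ) - 1 - c.l))
    (fun k => if k = c.l then (0, 0) else (1, (k : ℤ) - c.l))
    (fun k => c.nodeFinal .r3c (k - 1))
    (fun k => c.nodeFinal .r3c k)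
    (c.localValid_r3c_two h h0 hl).shape
    (fun i _ => .inl ⟨_, rfl⟩) (fun i _ => .inr ⟨_, rfl⟩)
    (fun k h0 hk => ⟨?_, ⟨?_, ?_⟩, ⟨?_, ?_⟩, ?_, ?_⟩) ⟨c.l, by omega, ?_, ?_⟩ ⟨c.l - 1, by omega, ?_, ?_⟩
  all_goals
    (try simp only [nodesDuring, nodesRest, nodeFinal, exitDuring, exitFinal, grid_adj_iff,
      Prod.mk_sub_mk, Prod.mk_add_mk])
    (try split_ifs) <;>
      (try simp only [mem_pair, mem_single, true_and, and_true, true_or, or_true, and_self, Prod.mk_sub_mk, Prod.ext_iff,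
        grid_adj_iff, Prod.mk_add_mk, Prod.fst_zero, Prod.snd_zero, Prod.fst_sub, Prod.snd_sub]) <;>
      omega

/-- One amoebot or every second one has expanded. -/
theorem localValid_r3d_one (c : Column α) (h : c.l = c.r) (hl : c.l = 0) (hm : c.m % 2 = 0) (hm0 : 0 < c.m) :
    LocalValid c.m (c.nodesDuring .r3d 1) (c.exitDuring .r3d 1) where
  shape i hi := by
    simp only [Config.Contracted, Config.Expanded, nodesDuring]
    split_ifs <;> first
      | exact .inl ⟨_, rfl⟩
      | exact .inr ⟨_, _, by
        simp only [grid_adj_iff, true_and, and_true, true_or, or_true, and_self] <;> omega, rfl⟩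
  disjoint i hi j hj u hu hu' := by
    simp only [nodesDuring] at hu hu'
    split_ifs at hu hu' <;> simp only [mem_pair, mem_single] at hu hu' <;> omega
  strip i hi u hu := by
    simp only [nodesDuring] at hu
    simp only [exitDuring]
    split_ifs at hu <;> simp only [mem_pair, mem_single] at hu <;> omega
  origin_mem := ⟨c.l, by omega, by
    simp only [nodesDuring]
    (try split_ifs) <;> simp only [mem_pair, mem_single, Prod.fst_zero,
      Prod.snd_zero, true_and, and_true, true_or, or_true, and_self] <;> omega⟩
  exit_mem := ⟨c.l, by omega, by
    simp only [nodesDuring, exitDuring]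
    (try split_ifs) <;> simp only [mem_pair, mem_single,
      true_and, and_true, true_or, or_true, and_self] <;> omega⟩

/-- The handovers have been performed. -/
theorem localValid_r3d_two (c : Column α) (h : c.l = c.r) (hl : c.l = 0) (hm : c.m % 2 = 0) (hm0 : 0 < c.m) :
    LocalValid c.m (c.nodesDuring .r3d 2) (c.exitDuring .r3d 2) where
  shape i hi := by
    simp only [Config.Contracted, Config.Expanded, nodesDuring]
    split_ifs <;> first
      | exact .inl ⟨_, rfl⟩
      | exact .inr ⟨_, _, by
        simp only [grid_adj_iff, true_and, and_true, true_or, or_true, and_self] <;> omega, rfl⟩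
  disjoint i hi j hj u hu hu' := by
    simp only [nodesDuring] at hu hu'
    split_ifs at hu hu' <;> simp only [mem_pair, mem_single] at hu hu' <;> omega
  strip i hi u hu := by
    simp only [nodesDuring] at hu
    simp only [exitDuring]
    split_ifs at hu <;> simp only [mem_pair, mem_single] at hu <;> omega
  origin_mem := ⟨c.l, by omega, by
    simp only [nodesDuring]
    (try split_ifs) <;> simp only [mem_pair, mem_single, Prod.fst_zero,
      Prod.snd_zero, true_and, and_true, true_or, or_true, and_self] <;> omega⟩
  exit_mem := ⟨1, by omega, by simp [nodesDuring, exitDuring]⟩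

/-- All vertical bonds move to the right-hand nodes, so the whole column is carried one step to the
right at once; only the left link remains at the left node of `v_0`. -/
theorem localRound_r3d_zero (c : Column α) (h : c.l = c.r) (hl : c.l = 0) (hm : c.m % 2 = 0) (hm0 : 0 < c.m) :
    LocalRound c.m c.nodesRest (c.nodesDuring .r3d 1) (0, (c.r : ℤ) - c.l) (c.exitDuring .r3d 1) 0 := by
  refine .of_reshape (fun k => k - 1)
    (fun k => (0, (k : ℤ) - 1 - c.l))
    (fun k => (0, (k : ℤ) - c.l))
    (fun k => (1, (k : ℤ) - 1))
    (fun k => (1, (k : ℤ)))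
    (fun i _ => .inl ⟨_, rfl⟩)
    (c.localValid_r3d_one h hl hm hm0).shape (fun i _ => .inl ⟨_, rfl⟩)
    (fun k h0 hk => ⟨?_, ⟨?_, ?_⟩, ⟨?_, ?_⟩, ?_, ?_⟩) ⟨c.l, by omega, ?_, ?_⟩ ⟨c.l, by omega, ?_, ?_⟩
  all_goals
    (try simp only [nodesDuring, nodesRest, nodeFinal, exitDuring, exitFinal, grid_adj_iff,
      Prod.mk_sub_mk, Prod.mk_add_mk])
    (try split_ifs) <;>
      (try simp only [mem_pair, mem_single, true_and, and_true, true_or, or_true, and_self, Prod.mk_sub_mk, Prod.ext_iff,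
        grid_adj_iff, Prod.mk_add_mk, Prod.fst_zero, Prod.snd_zero, Prod.fst_sub, Prod.snd_sub]) <;>
      omega

theorem localRound_r3d_one (c : Column α) (h : c.l = c.r) (hl : c.l = 0) (hm : c.m % 2 = 0) (hm0 : 0 < c.m) :
    LocalRound c.m (c.nodesDuring .r3d 1) (c.nodesDuring .r3d 2) (c.exitDuring .r3d 1) (c.exitDuring .r3d 2) 0 := by
  refine .of_handover (fun k => k - 1)
    (fun k => (1, (k : ℤ) - 1))
    (fun k => (1, (k : ℤ)))
    (fun i => if i % 2 = 0 then i + 1 else i - 1)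
    (fun i hi => ?_) (fun i hi hii => ?_) (fun i hi hii => ?_)
    (fun k h0 hk => ⟨?_, ⟨?_, ?_⟩, ?_⟩) ⟨c.l, by omega, ?_⟩ ⟨c.l, by omega, ?_⟩
  · split_ifs <;> omega
  · split_ifs at hii <;> simp only [nodesDuring] <;> split_ifs <;> first | rfl | omega
  · obtain ⟨k, hk⟩ : ∃ k, i = 2 * k ∨ i = 2 * k + 1 := ⟨i / 2, by omega⟩
    -- Whichever partner `i` is, the pair is `{2k, 2k + 1}`; the odd amoebot is contracted and takes
    -- over the right-hand node of the even one below it.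
    refine ⟨2 * k + 1, 2 * k, (1, 2 * k + 1), (1, 2 * k), (0, 2 * k), ?_, ?_, ?_, ?_,
      ⟨2 * k + 1, by omega, by omega, .inr ?_⟩, ?_, ?_⟩
    · split_ifs at hii ⊢ <;> omega
    · simp [nodesDuring, Nat.add_mod]
    · simp [nodesDuring, Finset.pair_comm]
    · simp
    · simp
    · simp [nodesDuring, Nat.add_mod, Finset.pair_comm]
    · simp [nodesDuring]
  all_goals
    (try simp only [nodesDuring, exitDuring, grid_adj_iff, Prod.mk_add_mk])
    (try split_ifs) <;>
      (try simp only [mem_pair, mem_single, true_and, and_true, true_or, or_true, and_self, grid_adj_iff,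
        Prod.mk_add_mk, Prod.fst_zero, Prod.snd_zero]) <;>
      omega

/-- The kept tree is a zigzag: a horizontal bond from `v_{2j}` to the lower node of `v_{2j+1}`, then
a bond in direction `(-1, 1)` from the upper node of `v_{2j+1}` to `v_{2j+2}`. When all odd amoebots
contract, the heights of both columns are halved. -/
theorem localRound_r3d_two (c : Column α) (h : c.l = c.r) (hl : c.l = 0) (hm : c.m % 2 = 0) (hm0 : 0 < c.m) :
    LocalRound c.m (c.nodesDuring .r3d 2) (fun i => {c.nodeFinal .r3d i}) (c.exitDuring .r3d 2) (c.exitFinal .r3d) 0 := by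
  refine .of_reshape (fun k => k - 1)
    (fun k => if k % 2 = 0 then (1, (k : ℤ) - 1) else (0, (k : ℤ) - 1))
    (fun k => if k % 2 = 0 then (0, (k : ℤ)) else (1, (k : ℤ) - 1))
    (fun k => c.nodeFinal .r3d (k - 1))
    (fun k => c.nodeFinal .r3d k)
    (c.localValid_r3d_two h hl hm hm0).shape
    (fun i _ => .inl ⟨_, rfl⟩) (fun i _ => .inr ⟨_, rfl⟩)
    (fun k h0 hk => ⟨?_, ⟨?_, ?_⟩, ⟨?_, ?_⟩, ?_, ?_⟩) ⟨c.l, by omega, ?_, ?_⟩ ⟨1, by omega, ?_, ?_⟩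
  all_goals
    (try simp only [nodesDuring, nodesRest, nodeFinal, exitDuring, exitFinal, grid_adj_iff,
      Prod.mk_sub_mk, Prod.mk_add_mk])
    (try split_ifs) <;>
      (try simp only [mem_pair, mem_single, true_and, and_true, true_or, or_true, and_self, Prod.mk_sub_mk, Prod.ext_iff,
        grid_adj_iff, Prod.mk_add_mk, Prod.fst_zero, Prod.snd_zero, Prod.fst_sub, Prod.snd_sub]) <;>
      first | omega | contradiction

/-- One amoebot or every second one has expanded. -/
theorem localValid_r3e_one (c : Column α) (h : c.l = c.r) (hl : c.l + 1 = c.m) (hm : c.m % 2 = 0) :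
    LocalValid c.m (c.nodesDuring .r3e 1) (c.exitDuring .r3e 1) where
  shape i hi := by
    simp only [Config.Contracted, Config.Expanded, nodesDuring]
    split_ifs <;> first
      | exact .inl ⟨_, rfl⟩
      | exact .inr ⟨_, _, by
        simp only [grid_adj_iff, true_and, and_true, true_or, or_true, and_self] <;> omega, rfl⟩
  disjoint i hi j hj u hu hu' := by
    simp only [nodesDuring] at hu hu'
    split_ifs at hu hu' <;> simp only [mem_pair, mem_single] at hu hu' <;> omega
  strip i hi u hu := by
    simp only [nodesDuring] at hu
    simp only [exitDuring]
    split_ifs at hu <;> simp only [mem_pair, mem_single] at hu <;> omega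
  origin_mem := ⟨c.l, by omega, by
    simp only [nodesDuring]
    (try split_ifs) <;> simp only [mem_pair, mem_single, Prod.fst_zero,
      Prod.snd_zero, true_and, and_true, true_or, or_true, and_self] <;> omega⟩
  exit_mem := ⟨c.l, by omega, by
    simp only [nodesDuring, exitDuring]
    (try split_ifs) <;> simp only [mem_pair, mem_single,
      true_and, and_true, true_or, or_true, and_self] <;> omega⟩

/-- The handovers have been performed. -/
theorem localValid_r3e_two (c : Column α) (h : c.l = c.r) (hl : c.l + 1 = c.m) (hm : c.m % 2 = 0) :
    LocalValid c.m (c.nodesDuring .r3e 2) (c.exitDuring .r3e 2) where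
  shape i hi := by
    simp only [Config.Contracted, Config.Expanded, nodesDuring]
    split_ifs <;> first
      | exact .inl ⟨_, rfl⟩
      | exact .inr ⟨_, _, by
        simp only [grid_adj_iff, true_and, and_true, true_or, or_true, and_self] <;> omega, rfl⟩
  disjoint i hi j hj u hu hu' := by
    simp only [nodesDuring] at hu hu'
    split_ifs at hu hu' <;> simp only [mem_pair, mem_single] at hu hu' <;> omega
  strip i hi u hu := by
    simp only [nodesDuring] at hu
    simp only [exitDuring]
    split_ifs at hu <;> simp only [mem_pair, mem_single] at hu <;> omega
  origin_mem := ⟨c.l, by omega, by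
    simp only [nodesDuring]
    (try split_ifs) <;> simp only [mem_pair, mem_single, Prod.fst_zero,
      Prod.snd_zero, true_and, and_true, true_or, or_true, and_self] <;> omega⟩
  exit_mem := ⟨c.l - 1, by omega, by
    simp only [nodesDuring, exitDuring]
    (try split_ifs) <;> simp only [mem_pair, mem_single,
      true_and, and_true, true_or, or_true, and_self] <;> omega⟩

theorem localRound_r3e_zero (c : Column α) (h : c.l = c.r) (hl : c.l + 1 = c.m) (hm : c.m % 2 = 0) :
    LocalRound c.m c.nodesRest (c.nodesDuring .r3e 1) (0, (c.r : ℤ) - c.l) (c.exitDuring .r3e 1) 0 := by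
  refine .of_reshape (fun k => k - 1)
    (fun k => (0, (k : ℤ) - 1 - c.l))
    (fun k => (0, (k : ℤ) - c.l))
    (fun k => (1, (k : ℤ) - 1 - c.l))
    (fun k => (1, (k : ℤ) - c.l))
    (fun i _ => .inl ⟨_, rfl⟩)
    (c.localValid_r3e_one h hl hm).shape (fun i _ => .inl ⟨_, rfl⟩)
    (fun k h0 hk => ⟨?_, ⟨?_, ?_⟩, ⟨?_, ?_⟩, ?_, ?_⟩) ⟨c.l, by omega, ?_, ?_⟩ ⟨c.l, by omega, ?_, ?_⟩
  all_goals
    (try simp only [nodesDuring, nodesRest, nodeFinal, exitDuring, exitFinal, grid_adj_iff,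
      Prod.mk_sub_mk, Prod.mk_add_mk])
    (try split_ifs) <;>
      (try simp only [mem_pair, mem_single, true_and, and_true, true_or, or_true, and_self, Prod.mk_sub_mk, Prod.ext_iff,
        grid_adj_iff, Prod.mk_add_mk, Prod.fst_zero, Prod.snd_zero, Prod.fst_sub, Prod.snd_sub]) <;>
      omega

theorem localRound_r3e_one (c : Column α) (h : c.l = c.r) (hl : c.l + 1 = c.m) (hm : c.m % 2 = 0) :
    LocalRound c.m (c.nodesDuring .r3e 1) (c.nodesDuring .r3e 2) (c.exitDuring .r3e 1) (c.exitDuring .r3e 2) 0 := by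
  refine .of_handover (fun k => k - 1)
    (fun k => (1, (k : ℤ) - 1 - c.l))
    (fun k => (1, (k : ℤ) - c.l))
    (fun i => if i % 2 = 0 then i + 1 else i - 1)
    (fun i hi => ?_) (fun i hi hii => ?_) (fun i hi hii => ?_)
    (fun k h0 hk => ⟨?_, ⟨?_, ?_⟩, ?_⟩) ⟨c.l, by omega, ?_⟩ ⟨c.l, by omega, ?_⟩
  · split_ifs <;> omega
  · split_ifs at hii <;> simp only [nodesDuring] <;> split_ifs <;> first | rfl | omega
  · obtain ⟨k, hk⟩ : ∃ k, i = 2 * k ∨ i = 2 * k + 1 := ⟨i / 2, by omega⟩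
    -- As for Rule 3d with the roles exchanged: the even amoebot is contracted and takes over the
    -- right-hand node of the odd one above it.
    refine ⟨2 * k, 2 * k + 1, (1, 2 * k - c.l), (1, 2 * k + 1 - c.l), (0, 2 * k + 1 - c.l),
      ?_, ?_, ?_, ?_, ⟨2 * k + 1, by omega, by omega, .inl ?_⟩, ?_, ?_⟩
    · split_ifs at hii ⊢ <;> omega
    · simp [nodesDuring]
    · simp [nodesDuring, Nat.add_mod, Finset.pair_comm]
    · simp
    · simp
    · simp [nodesDuring]
      congr 2; ring_nf
    · simp [nodesDuring, Nat.add_mod]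
  all_goals
    (try simp only [nodesDuring, exitDuring, grid_adj_iff, Prod.mk_add_mk])
    (try split_ifs) <;>
      (try simp only [mem_pair, mem_single, true_and, and_true, true_or, or_true, and_self, grid_adj_iff,
        Prod.mk_add_mk, Prod.fst_zero, Prod.snd_zero]) <;>
      omega

/-- A zigzag is impossible here, since going from `v_{2j-1}` to the lower node of `v_{2j}` would
need the non-edge `(1, 1)`. Instead the even amoebots form a vertical path in the right column, and
each odd one hangs on the even one just before it; this is why the parent of an even index `k` is `k
- 2`. -/
theorem localRound_r3e_two (c : Column α) (h : c.l = c.r) (hl : c.l + 1 = c.m) (hm : c.m % 2 = 0) :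
    LocalRound c.m (c.nodesDuring .r3e 2) (fun i => {c.nodeFinal .r3e i}) (c.exitDuring .r3e 2) (c.exitFinal .r3e) 0 := by
  refine .of_reshape (fun k => if k % 2 = 0 then k - 2 else k - 1)
    (fun k => if k % 2 = 0 then (1, (k : ℤ) - 1 - c.l) else (1, (k : ℤ) - c.l))
    (fun k => if k % 2 = 0 then (1, (k : ℤ) - c.l) else (0, (k : ℤ) - c.l))
    (fun k => c.nodeFinal .r3e ((fun k => if k % 2 = 0 then k - 2 else k - 1) k))
    (fun k => c.nodeFinal .r3e k)
    (c.localValid_r3e_two h hl hm).shape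
    (fun i _ => .inl ⟨_, rfl⟩) (fun i _ => .inr ⟨_, rfl⟩)
    (fun k h0 hk => ⟨?_, ⟨?_, ?_⟩, ⟨?_, ?_⟩, ?_, ?_⟩) ⟨c.l, by omega, ?_, ?_⟩ ⟨c.l - 1, by omega, ?_, ?_⟩
  all_goals
    (try simp only [nodesDuring, nodesRest, nodeFinal, exitDuring, exitFinal, grid_adj_iff,
      Prod.mk_sub_mk, Prod.mk_add_mk])
    (try split_ifs) <;>
      (try simp only [mem_pair, mem_single, true_and, and_true, true_or, or_true, and_self, Prod.mk_sub_mk, Prod.ext_iff,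
        grid_adj_iff, Prod.mk_add_mk, Prod.fst_zero, Prod.snd_zero, Prod.fst_sub, Prod.snd_sub]) <;>
      omega

end Column

/-! ### What becomes of a column in one round -/

section Lists

variable {α : Type*}

theorem getElem?_everySecond (l : List α) (j : ℕ) : (everySecond l)[j]? = l[2 * j]? := by
  induction l using everySecond.induct generalizing j with
  | case1 => simp [everySecond]
  | case2 a => cases j <;> simp [everySecond, mul_add]
  | case3 a b l ih => cases j <;> simp [everySecond, mul_add, ih]

theorem length_everySecond (l : List α) : (everySecond l).length = (l.length + 1) / 2 := by
  induction l using everySecond.induct with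
  | case1 => simp [everySecond]
  | case2 a => simp [everySecond]
  | case3 a b l ih => simp only [everySecond, List.length_cons, ih]; omega

theorem everySecond_perm (l : List α) : (everySecond l ++ everySecond l.tail).Perm l := by
  induction l using everySecond.induct with
  | case1 => simp [everySecond]
  | case2 a => simp [everySecond]
  | case3 a b l ih =>
    have h : everySecond (b :: l) = b :: everySecond l.tail := by
      cases l with
      | nil => rfl
      | cons c l => simp [everySecond]
    simp only [everySecond, List.tail_cons, h, List.cons_append]
    refine List.Perm.cons a (List.perm_middle.trans (List.Perm.cons b ih))

variable [DecidableEq α]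

theorem idxOf_of_getElem? {l : List α} {i : α} {k : ℕ} (hn : l.Nodup) (h : l[k]? = some i) :
    l.idxOf i = k := by
  obtain ⟨hk, rfl⟩ := List.getElem?_eq_some_iff.1 h
  exact hn.idxOf_getElem k hk

end Lists

variable {ι : Type*}

/-- A column that is about to start its rule. -/
def Column.ready (c : Column ι) : Piece ι := ⟨c, .run 0⟩

namespace Column

/-- Replaces the nested case distinction by linear conditions on `l`, `r` and `m`; these are the
form in which all later case checks use the rule. -/
theorem rule_spec (c : Column ι) (hc : c.WellFormed) {ρ : Rule} (h : c.rule = some ρ) :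
    match ρ with
    | .r1a => c.l < c.r ∧ ¬ (c.l = 0 ∧ c.r + 1 = c.m)
    | .r1b => c.l < c.r ∧ c.l = 0 ∧ c.r + 1 = c.m
    | .r2a => c.r < c.l ∧ ¬ (c.r = 0 ∧ c.l + 1 = c.m)
    | .r2b => c.r < c.l ∧ c.r = 0 ∧ c.l + 1 = c.m
    | .r3a => c.l = c.r ∧ 0 < c.l ∧ c.l + 1 < c.m
    | .r3b => c.l = c.r ∧ c.l = 0 ∧ 1 < c.m ∧ c.m % 2 = 1
    | .r3c => c.l = c.r ∧ 0 < c.l ∧ c.l + 1 = c.m ∧ c.m % 2 = 1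
    | .r3d => c.l = c.r ∧ c.l = 0 ∧ 1 < c.m ∧ c.m % 2 = 0
    | .r3e => c.l = c.r ∧ 0 < c.l ∧ c.l + 1 = c.m ∧ c.m % 2 = 0 := by
  obtain ⟨h1, h2⟩ := hc
  unfold rule at h
  split_ifs at h <;> cases h <;> simp only <;> omega

theorem rule_eq_none (c : Column ι) : c.rule = none ↔ c.m ≤ 1 := by
  unfold rule
  split_ifs <;> simp <;> omega

theorem nodesDuring_zero (c : Column ι) (ρ : Rule) : c.nodesDuring ρ 0 = c.nodesRest := by
  cases ρ <;> rfl

theorem exitDuring_zero (c : Column ι) (ρ : Rule) :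
    c.exitDuring ρ 0 = (0, (c.r : ℤ) - c.l) := by
  cases ρ <;> rfl

@[simp] theorem ready_entry (c : Column ι) : c.ready.entry = (1, 0) := rfl

@[simp] theorem ready_col (c : Column ι) : c.ready.col = c := rfl

theorem ready_nodes (c : Column ι) : c.ready.nodes = c.nodesRest := by
  funext i
  simp only [ready, Piece.nodes]
  cases h : c.rule with
  | none => rfl
  | some ρ => exact congrFun (c.nodesDuring_zero ρ) i

theorem ready_exit (c : Column ι) : c.ready.exit = (0, (c.r : ℤ) - c.l) := by
  simp only [ready, Piece.exit]
  cases h : c.rule with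
  | none => rfl
  | some ρ => exact c.exitDuring_zero ρ

section PlaceReady

variable [DecidableEq ι]

theorem place_ready_cons (o : Node) (c : Column ι) (L : List (Column ι)) (i : ι) :
    place .y o ((c :: L).map ready) i =
      if i ∈ c.ids then {o + (0, (c.ids.idxOf i : ℤ) - c.l)}
      else place .y (o + (1, (c.r : ℤ) - c.l)) (L.map ready) i := by
  rw [List.map_cons, place_cons, ready_nodes]
  congr 1
  · simp [nodesRest]
  · cases L with
    | nil => rfl
    | cons c' L =>
      simp only [List.map_cons, originAfter, nextOrigin, ready_exit, ready_entry, Axis.vec_y]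
      congr 1
      ext <;> simp [add_assoc]

theorem place_ready_singles (o : Node) (vs : List ι) (L : List (Column ι)) (i : ι) :
    place .y o ((vs.map (fun v => (⟨[v], 0, 0⟩ : Column ι)) ++ L).map ready) i =
      if i ∈ vs then {o + ((vs.idxOf i : ℤ), 0)}
      else place .y (o + ((vs.length : ℤ), 0)) (L.map ready) i := by
  induction vs generalizing o with
  | nil =>
    simp only [List.map_nil, List.nil_append, List.not_mem_nil, if_false, List.length_nil]
    congr 1
    ext <;> simp
  | cons v vs ih =>
    rw [List.map_cons, List.cons_append, place_ready_cons, ih]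
    by_cases h : i = v
    · subst h
      simp
    · have h' : v ≠ i := fun e => h e.symm
      simp only [List.mem_singleton, h, if_false, List.mem_cons, false_or, List.idxOf_cons_ne _ h']
      have e1 : o + (1, ((0 : ℕ) : ℤ) - (0 : ℕ)) + ((vs.idxOf i : ℤ), 0) =
          o + (((vs.idxOf i).succ : ℤ), 0) := by
        ext <;> simp <;> ring
      have e2 : o + (1, ((0 : ℕ) : ℤ) - (0 : ℕ)) + ((vs.length : ℤ), 0) =
          o + (((v :: vs).length : ℤ), 0) := by
        ext <;> simp <;> ring
      rw [e1, e2, if_neg (by simp)]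

end PlaceReady

theorem lastExit_ready_cons (o : Node) (c c' : Column ι) (L : List (Column ι)) :
    lastExit .y o ((c :: c' :: L).map ready) =
      lastExit .y (o + (1, (c.r : ℤ) - c.l)) ((c' :: L).map ready) := by
  simp only [List.map_cons, lastExit, nextOrigin, ready_exit, ready_entry, Axis.vec_y]
  congr 1
  ext <;> simp [add_assoc]

theorem lastExit_ready_single (o : Node) (c : Column ι) :
    lastExit .y o ([c].map ready) = o + (0, (c.r : ℤ) - c.l) := by
  simp only [List.map_cons, List.map_nil, lastExit, ready_exit, Axis.vec_y]

theorem lastExit_ready_singles (o : Node) (vs : List ι) (c : Column ι) :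
    lastExit .y o ((vs.map (fun v => (⟨[v], 0, 0⟩ : Column ι)) ++ [c]).map ready) =
      o + ((vs.length : ℤ), (c.r : ℤ) - c.l) := by
  induction vs generalizing o with
  | nil => simpa using lastExit_ready_single o c
  | cons v vs ih =>
    rw [List.map_cons, List.cons_append]
    have : ∃ c' L, vs.map (fun v => (⟨[v], 0, 0⟩ : Column ι)) ++ [c] = c' :: L := by
      cases vs <;> simp
    obtain ⟨c', L, hL⟩ := this
    rw [hL, lastExit_ready_cons, ← hL, ih]
    ext <;> simp <;> ring

/-- Ensures that each amoebot remains in exactly one column when a rule ends. -/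
theorem children_ids_perm (c : Column ι) (hc : c.WellFormed) {ρ : Rule} (h : c.rule = some ρ) :
    (((c.children ρ).flatMap Column.ids)).Perm c.ids := by
  have hs := c.rule_spec hc h
  have single : ∀ vs : List ι, (vs.map (fun v => (⟨[v], 0, 0⟩ : Column ι))).flatMap Column.ids = vs := by
    intro vs
    induction vs with
    | nil => rfl
    | cons v vs ih => simpa using ih
  have mid : ∀ a b, a < b → c.ids.take (a + 1) ++ ((c.ids.take b).drop (a + 1) ++ c.ids.drop b) =
      c.ids := by
    intro a b hab
    rw [← List.append_assoc]
    have : c.ids.take (a + 1) = (c.ids.take b).take (a + 1) := by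
      rw [List.take_take, min_eq_left (by omega)]
    rw [this, List.take_append_drop, List.take_append_drop]
  have r1 : c.l < c.r → (((c.children .r1a).flatMap Column.ids)).Perm c.ids := by
    intro hlr
    simp only [children, List.flatMap_append, single, List.flatMap_cons, List.flatMap_nil,
      List.append_nil, List.append_assoc]
    rw [mid _ _ hlr]
  have r2 : c.r < c.l → (((c.children .r2a).flatMap Column.ids)).Perm c.ids := by
    intro hlr
    simp only [children, List.flatMap_append, single, List.flatMap_cons, List.flatMap_nil,
      List.append_nil, List.append_assoc, ← List.map_reverse]
    conv_rhs => rw [← mid _ _ hlr]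
    refine List.Perm.trans ?_ List.perm_append_comm
    rw [List.append_assoc]
    refine List.Perm.trans ?_ List.perm_append_comm
    rw [List.append_assoc]
    exact ((List.reverse_perm _).append_right _).append_left _ |>.trans
      (List.perm_append_comm.append_left _)
  have r3 : (((c.children .r3a).flatMap Column.ids)).Perm c.ids := by
    simp [children]
  cases ρ with
  | r1a => exact r1 hs.1
  | r1b => exact r1 hs.1
  | r2a => exact r2 hs.1
  | r2b => exact r2 hs.1
  | r3a => exact r3
  | r3b => exact r3
  | r3c =>
    simp only [children, List.flatMap_cons, List.flatMap_nil, List.append_nil]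
    exact List.perm_append_comm.trans (by rw [List.take_append_drop])
  | r3d =>
    simp only [children, List.flatMap_cons, List.flatMap_nil, List.append_nil]
    exact everySecond_perm _
  | r3e =>
    simp only [children, List.flatMap_cons, List.flatMap_nil, List.append_nil]
    exact List.perm_append_comm.trans (everySecond_perm _)

/-- A child contributes the height `r - l`, and each link between children the step `(1, 0)`. For
every rule the heights cancel, so both outer links end up in the same row. -/
theorem lastExit_children (c : Column ι) (hc : c.WellFormed) {ρ : Rule} (h : c.rule = some ρ) :
    lastExit .y 0 ((c.children ρ).map ready) = c.exitFinal ρ := by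
  have hs := c.rule_spec hc h
  have h1 := hc.1
  have h2 := hc.2
  have key : ∀ (c₁ c₂ : Column ι) (vs : List ι),
      lastExit .y 0 (([c₁] ++ vs.map (fun v => (⟨[v], 0, 0⟩ : Column ι)) ++ [c₂]).map ready) =
        (((vs.length : ℤ) + 1, (c₁.r : ℤ) - c₁.l + (c₂.r - c₂.l)) : Node) := by
    intro c₁ c₂ vs
    obtain ⟨c', L, hL⟩ : ∃ c' L, vs.map (fun v => (⟨[v], 0, 0⟩ : Column ι)) ++ [c₂] = c' :: L := by
      cases vs <;> simp
    rw [List.append_assoc, hL, List.singleton_append, lastExit_ready_cons, ← hL,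
      lastExit_ready_singles]
    ext <;> simp <;> ring
  have key2 : ∀ (c₁ c₂ : Column ι), lastExit .y 0 ([c₁, c₂].map ready) =
        ((1, (c₁.r : ℤ) - c₁.l + (c₂.r - c₂.l)) : Node) := by
    intro c₁ c₂
    simpa using key c₁ c₂ []
  simp only [m] at *
  cases ρ <;> dsimp only at hs <;> simp only [children, key, key2, exitFinal, m] <;>
    simp only [Prod.ext_iff, List.length_drop, List.length_take, List.length_reverse, true_and,
      and_true] <;> omega

section PlaceChildren

variable [DecidableEq ι]

/-- From the lookup function alone one reads off both whether and where `i` occurs; `place_children`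
applies this to every kind of sublist that a rule forms. -/
theorem _root_.Amoebot.mem_and_idxOf {l : List ι} {i : ι} {Q : Prop} {k : ℕ}
    (h : ∀ j, l[j]? = some i ↔ Q ∧ j = k) : (i ∈ l ↔ Q) ∧ (Q → l.idxOf i = k) := by
  have hm : i ∈ l ↔ Q := by
    rw [List.mem_iff_getElem?]
    exact ⟨fun ⟨j, hj⟩ => ((h j).1 hj).1, fun hQ => ⟨k, (h k).2 ⟨hQ, rfl⟩⟩⟩
  refine ⟨hm, fun hQ => ((h _).1 ?_).2⟩
  have := List.idxOf_lt_length_iff.2 (hm.2 hQ)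
  rw [List.getElem?_eq_getElem this, List.getElem_idxOf]

/-- The new columns at rest, put next to each other along their links, occupy precisely the nodes
reached by the old column. Passing from one description to the other needs no movement. -/
theorem place_children (c : Column ι) (hc : c.WellFormed) {ρ : Rule} (h : c.rule = some ρ)
    (hn : c.ids.Nodup) {i : ι} {k : ℕ} (hk : c.ids[k]? = some i) :
    place .y 0 ((c.children ρ).map ready) i = {c.nodeFinal ρ k} := by
  have hs := c.rule_spec hc h
  have h1 := hc.1
  have h2 := hc.2
  have hkm : k < c.ids.length := (List.getElem?_eq_some_iff.1 hk).1
  -- There are no repetitions, so the index `k` of `i` determines its membership and its index in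
  -- each of the sublists below.
  have hu : ∀ j, c.ids[j]? = some i ↔ j = k := by
    intro j
    refine ⟨fun hj => ?_, fun hj => hj ▸ hk⟩
    rw [← idxOf_of_getElem? hn hj, ← idxOf_of_getElem? hn hk]
  have htake : ∀ n, (i ∈ c.ids.take n ↔ k < n) ∧ (k < n → (c.ids.take n).idxOf i = k) := by
    refine fun n => mem_and_idxOf fun j => ?_
    rw [List.getElem?_take]
    split_ifs with hj
    · rw [hu]; omega
    · simp; omega
  have hdrop : ∀ n, (i ∈ c.ids.drop n ↔ n ≤ k) ∧ (n ≤ k → (c.ids.drop n).idxOf i = k - n) := by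
    refine fun n => mem_and_idxOf fun j => ?_
    rw [List.getElem?_drop, hu]
    omega
  have hmid : ∀ a b, (i ∈ (c.ids.take b).drop a ↔ a ≤ k ∧ k < b) ∧
      (a ≤ k ∧ k < b → ((c.ids.take b).drop a).idxOf i = k - a) := by
    refine fun a b => mem_and_idxOf fun j => ?_
    rw [List.getElem?_drop, List.getElem?_take]
    split_ifs with hj
    · rw [hu]; omega
    · simp; omega
  have hrev : ∀ a b, b ≤ c.ids.length → (i ∈ ((c.ids.take b).drop a).reverse ↔ a ≤ k ∧ k < b) ∧
      (a ≤ k ∧ k < b → ((c.ids.take b).drop a).reverse.idxOf i = b - 1 - k) := by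
    refine fun a b hb => mem_and_idxOf fun j => ?_
    by_cases hj : j < ((c.ids.take b).drop a).length
    · rw [List.getElem?_reverse hj, List.getElem?_drop, List.getElem?_take]
      simp only [List.length_drop, List.length_take] at hj ⊢
      rw [if_pos (by omega), hu]
      omega
    · rw [List.getElem?_eq_none (by simpa using hj)]
      simp only [List.length_drop, List.length_take] at hj
      simp only [reduceCtorEq, false_iff]
      omega
  have heven : (i ∈ everySecond c.ids ↔ k % 2 = 0) ∧
      (k % 2 = 0 → (everySecond c.ids).idxOf i = k / 2) := by
    refine mem_and_idxOf fun j => ?_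
    rw [getElem?_everySecond, hu]
    omega
  have hodd : (i ∈ everySecond c.ids.tail ↔ k % 2 = 1) ∧
      (k % 2 = 1 → (everySecond c.ids.tail).idxOf i = k / 2) := by
    refine mem_and_idxOf fun j => ?_
    rw [getElem?_everySecond, List.getElem?_tail, hu]
    omega
  have hsplit : ∀ (c₁ c₂ : Column ι) (vs : List ι) (i : ι),
      place .y 0 (([c₁] ++ vs.map (fun v => (⟨[v], 0, 0⟩ : Column ι)) ++ [c₂]).map ready) i =
        if i ∈ c₁.ids then {(0, (c₁.ids.idxOf i : ℤ) - c₁.l)}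
        else if i ∈ vs then {(1 + (vs.idxOf i : ℤ), (c₁.r : ℤ) - c₁.l)}
        else if i ∈ c₂.ids then
          {(1 + (vs.length : ℤ), (c₁.r : ℤ) - c₁.l + ((c₂.ids.idxOf i : ℤ) - c₂.l))}
        else ∅ := by
    intro c₁ c₂ vs i
    rw [List.append_assoc, List.singleton_append, place_ready_cons, place_ready_singles,
      place_ready_cons]
    simp only [zero_add, Prod.mk_add_mk, add_zero]
    rfl
  have hsplit2 : ∀ (c₁ c₂ : Column ι) (i : ι),
      place .y 0 ([c₁, c₂].map ready) i =
        if i ∈ c₁.ids then {(0, (c₁.ids.idxOf i : ℤ) - c₁.l)}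
        else if i ∈ c₂.ids then
          {(1, (c₁.r : ℤ) - c₁.l + ((c₂.ids.idxOf i : ℤ) - c₂.l))}
        else ∅ := by
    intro c₁ c₂ i
    simpa using hsplit c₁ c₂ [] i
  simp only [m] at *
  have hr1 : c.l < c.r → place .y 0 ((c.children .r1a).map ready) i = {c.nodeFinal .r1a k} := by
    intro hlr
    have e1 := (htake (c.l + 1)).2
    have e2 := (hmid (c.l + 1) c.r).2
    have e3 := (hdrop c.r).2
    simp only [children, hsplit, nodeFinal, (htake _).1, (hdrop _).1, (hmid _ _).1]
    split_ifs <;>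
      (try simp only [Finset.singleton_inj, Prod.ext_iff, true_and, and_true, List.length_drop,
        List.length_take]) <;> omega
  have hr2 : c.r < c.l → place .y 0 ((c.children .r2a).map ready) i = {c.nodeFinal .r2a k} := by
    intro hlr
    have e1 := (htake (c.r + 1)).2
    have e2 := (hrev (c.r + 1) c.l h1.le).2
    have e3 := (hdrop c.l).2
    simp only [children, hsplit, nodeFinal, (htake _).1, (hdrop _).1, (hrev _ _ h1.le).1]
    split_ifs <;>
      (try simp only [Finset.singleton_inj, Prod.ext_iff, true_and, and_true, List.length_drop,
        List.length_take, List.length_reverse]) <;> omega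
  have hr3 : c.l = c.r → place .y 0 ((c.children .r3a).map ready) i = {c.nodeFinal .r3a k} := by
    intro hlr
    have e1 := (htake (c.l + 1)).2
    have e3 := (hdrop (c.l + 1)).2
    simp only [children, hsplit2, nodeFinal, (htake _).1, (hdrop _).1]
    split_ifs <;> (try simp only [Finset.singleton_inj, Prod.ext_iff, true_and, and_true]) <;> omega
  cases ρ <;> dsimp only at hs
  · exact hr1 hs.1
  · exact hr1 hs.1
  · exact hr2 hs.1
  · exact hr2 hs.1
  · exact hr3 hs.1
  · exact hr3 hs.1
  · have e1 := (htake c.l).2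
    have e3 := (hdrop c.l).2
    simp only [children, hsplit2, nodeFinal, (htake _).1, (hdrop _).1]
    split_ifs <;> (try simp only [Finset.singleton_inj, Prod.ext_iff, true_and, and_true]) <;> omega
  · have e1 := heven.2
    have e2 := hodd.2
    simp only [children, hsplit2, nodeFinal, heven.1, hodd.1, m]
    split_ifs <;> (try simp only [Finset.singleton_inj, Prod.ext_iff, true_and, and_true]) <;> omega
  · have e1 := heven.2
    have e2 := hodd.2
    simp only [children, hsplit2, nodeFinal, heven.1, hodd.1, m]
    split_ifs <;> (try simp only [Finset.singleton_inj, Prod.ext_iff, true_and, and_true]) <;> omega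

end PlaceChildren

end Column

/-! ### One round of a column in any stage -/

variable {ι : Type*}

namespace Column

/-- `nodesDuring` halfway through a shift. -/
def nodesShift (c : Column ι) (i : ℕ) : Finset Node :=
  if i + 1 = c.m then {(0, -1), (0, 0)} else {(0, (i : ℤ) - c.l - 1)}

theorem localValid_shift (c : Column ι) (hc : c.WellFormed) (h : c.l + 1 = c.m) :
    LocalValid c.m c.nodesShift (0, (c.r : ℤ) - c.l - 1) where
  shape i hi := by
    simp only [Config.Contracted, Config.Expanded, nodesShift]
    split_ifs
    · exact .inr ⟨_, _, by simp [grid_adj_iff], rfl⟩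
    · exact .inl ⟨_, rfl⟩
  disjoint i hi j hj u hu hu' := by
    simp only [nodesShift] at hu hu'
    split_ifs at hu hu' <;> simp only [mem_pair, mem_single] at hu hu' <;> omega
  strip i hi u hu := by
    simp only [nodesShift] at hu
    split_ifs at hu <;> simp only [mem_pair, mem_single] at hu <;> omega
  origin_mem := ⟨c.l, hc.1, by simp [nodesShift, h, Prod.ext_iff]⟩
  exit_mem := ⟨c.r, hc.2, by
    have := hc.2
    simp only [nodesShift]
    split_ifs <;> simp only [mem_pair, mem_single, true_and, and_true] <;> omega⟩

/-- The oblique link stays at the lower node of the expanding top amoebot, while the origin becomes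
its upper node, in the row of the left neighbour. Hence the old link is carried to `(0, -1)`. -/
theorem localRound_shift_zero (c : Column ι) (hc : c.WellFormed) (h : c.l + 1 = c.m) :
    LocalRound c.m c.nodesRest c.nodesShift (0, (c.r : ℤ) - c.l) (0, (c.r : ℤ) - c.l - 1)
      (0, -1) := by
  have h2 := hc.2
  refine .of_reshape (fun k => k - 1)
    (fun k => (0, (k : ℤ) - 1 - c.l)) (fun k => (0, (k : ℤ) - c.l))
    (fun k => (0, (k : ℤ) - 2 - c.l)) (fun k => (0, (k : ℤ) - 1 - c.l))
    (fun i _ => .inl ⟨_, rfl⟩) (c.localValid_shift hc h).shape (fun i _ => .inl ⟨_, rfl⟩)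
    (fun k h0 hk => ⟨?_, ⟨?_, ?_⟩, ⟨?_, ?_⟩, ?_, ?_⟩) ⟨c.l, hc.1, ?_, ?_⟩ ⟨c.r, hc.2, ?_, ?_⟩
  all_goals
    (try simp only [nodesShift, nodesRest, grid_adj_iff, Prod.mk_sub_mk])
    (try split_ifs) <;>
      (try simp only [mem_pair, mem_single, true_and, and_true, true_or, or_true, and_self,
        Prod.ext_iff, Prod.fst_zero, Prod.snd_zero]) <;>
      omega

theorem localRound_shift_one (c : Column ι) (hc : c.WellFormed) (h : c.l + 1 = c.m) :
    LocalRound c.m c.nodesShift c.nodesRest (0, (c.r : ℤ) - c.l - 1) (0, (c.r : ℤ) - c.l) 0 := by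
  have h2 := hc.2
  refine .of_reshape (fun k => k - 1)
    (fun k => (0, (k : ℤ) - 2 - c.l)) (fun k => (0, (k : ℤ) - 1 - c.l))
    (fun k => (0, (k : ℤ) - 1 - c.l)) (fun k => (0, (k : ℤ) - c.l))
    (c.localValid_shift hc h).shape (fun i _ => .inl ⟨_, rfl⟩) (fun i _ => .inr ⟨_, rfl⟩)
    (fun k h0 hk => ⟨?_, ⟨?_, ?_⟩, ⟨?_, ?_⟩, ?_, ?_⟩) ⟨c.l, hc.1, ?_, ?_⟩ ⟨c.r, hc.2, ?_, ?_⟩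
  all_goals
    (try simp only [nodesShift, nodesRest, grid_adj_iff, Prod.mk_sub_mk])
    (try split_ifs) <;>
      (try simp only [mem_pair, mem_single, true_and, and_true, true_or, or_true, and_self,
        Prod.ext_iff, Prod.fst_zero, Prod.snd_zero]) <;>
      omega

theorem localValid_rule (c : Column ι) (hc : c.WellFormed) {ρ : Rule} (h : c.rule = some ρ)
    {t : ℕ} (ht : t < ρ.rounds) : LocalValid c.m (c.nodesDuring ρ t) (c.exitDuring ρ t) := by
  have hs := c.rule_spec hc h
  have h1 := hc.1
  have h2 := hc.2
  rcases Nat.eq_zero_or_pos t with rfl | h0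
  · rw [nodesDuring_zero, exitDuring_zero]
    exact c.localValid_rest hc
  cases ρ <;> dsimp only at hs <;> simp only [Rule.rounds] at ht <;> interval_cases t
  · exact c.localValid_r1_one hs.1 h2
  · exact c.localValid_r1_one hs.1 h2
  · exact c.localValid_r2_one hs.1 h1
  · exact c.localValid_r2_two hs.1 h1
  · exact c.localValid_r2_three hs.1 h1
  · exact c.localValid_r2_one hs.1 h1
  · exact c.localValid_r2_two hs.1 h1
  · exact c.localValid_r2_three hs.1 h1
  · exact c.localValid_r3a_one hs.1 (by omega)
  · exact c.localValid_r3a_two hs.1 (by omega)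
  · exact c.localValid_r3a_one hs.1 (by omega)
  · exact c.localValid_r3a_two hs.1 (by omega)
  · exact c.localValid_r3c_one hs.1 (by omega) (by omega)
  · exact c.localValid_r3c_two hs.1 (by omega) (by omega)
  · exact c.localValid_r3d_one hs.1 (by omega) (by omega) (by omega)
  · exact c.localValid_r3d_two hs.1 (by omega) (by omega) (by omega)
  · exact c.localValid_r3e_one hs.1 (by omega) (by omega)
  · exact c.localValid_r3e_two hs.1 (by omega) (by omega)

theorem localRound_rule (c : Column ι) (hc : c.WellFormed) {ρ : Rule} (h : c.rule = some ρ)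
    {t : ℕ} (ht : t + 1 < ρ.rounds) :
    LocalRound c.m (c.nodesDuring ρ t) (c.nodesDuring ρ (t + 1)) (c.exitDuring ρ t)
      (c.exitDuring ρ (t + 1)) 0 := by
  have hs := c.rule_spec hc h
  have h1 := hc.1
  have h2 := hc.2
  cases ρ <;> dsimp only at hs <;> simp only [Rule.rounds] at ht <;>
    replace ht := Nat.lt_of_succ_lt_succ ht <;> interval_cases t
  · exact c.localRound_r1_zero hs.1 h2
  · exact c.localRound_r1_zero hs.1 h2
  · exact c.localRound_r2_zero hs.1 h1
  · exact c.localRound_r2_one hs.1 h1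
  · exact c.localRound_r2_two hs.1 h1
  · exact c.localRound_r2_zero hs.1 h1
  · exact c.localRound_r2_one hs.1 h1
  · exact c.localRound_r2_two hs.1 h1
  · exact c.localRound_r3a_zero hs.1 (by omega)
  · exact c.localRound_r3a_one hs.1 (by omega)
  · exact c.localRound_r3a_zero hs.1 (by omega)
  · exact c.localRound_r3a_one hs.1 (by omega)
  · exact c.localRound_r3c_zero hs.1 (by omega) (by omega)
  · exact c.localRound_r3c_one hs.1 (by omega) (by omega)
  · exact c.localRound_r3d_zero hs.1 (by omega) (by omega) (by omega)
  · exact c.localRound_r3d_one hs.1 (by omega) (by omega) (by omega)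
  · exact c.localRound_r3e_zero hs.1 (by omega) (by omega)
  · exact c.localRound_r3e_one hs.1 (by omega) (by omega)

theorem localRound_rule_last (c : Column ι) (hc : c.WellFormed) {ρ : Rule} (h : c.rule = some ρ)
    {t : ℕ} (ht : t + 1 = ρ.rounds) :
    LocalRound c.m (c.nodesDuring ρ t) (fun i => {c.nodeFinal ρ i}) (c.exitDuring ρ t)
      (c.exitFinal ρ) 0 := by
  have hs := c.rule_spec hc h
  have h1 := hc.1
  have h2 := hc.2
  cases ρ <;> dsimp only at hs <;> simp only [Rule.rounds] at ht <;>
    obtain rfl := Nat.succ_injective ht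
  · exact c.localRound_r1_one hs.1 h2
  · exact c.localRound_r1_one hs.1 h2
  · exact c.localRound_r2_three hs.1 h1
  · exact c.localRound_r2_three hs.1 h1
  · exact c.localRound_r3a_two hs.1 (by omega)
  · exact c.localRound_r3a_two hs.1 (by omega)
  · exact c.localRound_r3c_two hs.1 (by omega) (by omega)
  · exact c.localRound_r3d_two hs.1 (by omega) (by omega) (by omega)
  · exact c.localRound_r3e_two hs.1 (by omega) (by omega)

theorem children_wellFormed (c : Column ι) (hc : c.WellFormed) {ρ : Rule} (h : c.rule = some ρ) :
    ∀ c' ∈ c.children ρ, c'.WellFormed := by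
  have hs := c.rule_spec hc h
  have h1 := hc.1
  have h2 := hc.2
  intro c' hc'
  simp only [m] at *
  cases ρ <;> dsimp only at hs <;>
    simp only [children, List.mem_append, List.mem_cons, List.mem_map, List.not_mem_nil,
      or_false, m] at hc' <;>
    rcases hc' with (rfl | ⟨v, -, rfl⟩) | rfl
  all_goals
    simp only [WellFormed, m, List.length_take, List.length_drop, List.length_cons,
      List.length_nil, length_everySecond, List.length_tail]
    omega

theorem children_ne_nil (c : Column ι) (ρ : Rule) : c.children ρ ≠ [] := by
  cases ρ <;> simp [children]

end Column

namespace Piece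

/-- The stage fits the column. -/
def OK (p : Piece ι) : Prop :=
  p.col.WellFormed ∧
    match p.stage with
    | .wait0 | .wait1 => True
    | .shift0 | .shift1 => p.col.l + 1 = p.col.m
    | .run t =>
        match p.col.rule with
        | none => t = 0
        | some ρ => t < ρ.rounds

theorem ready_OK {c : Column ι} (hc : c.WellFormed) : c.ready.OK := by
  refine ⟨hc, ?_⟩
  simp only [Column.ready]
  cases c.rule with
  | none => simp
  | some ρ => cases ρ <;> simp [Rule.rounds]

theorem nodes_of_rule {c : Column ι} {t : ℕ} {ρ : Rule} (h : c.rule = some ρ) :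
    Piece.nodes ⟨c, .run t⟩ = c.nodesDuring ρ t := by
  funext i; simp only [nodes, h]

theorem exit_of_rule {c : Column ι} {t : ℕ} {ρ : Rule} (h : c.rule = some ρ) :
    Piece.exit ⟨c, .run t⟩ = c.exitDuring ρ t := by
  simp only [exit, h]

theorem OK.localValid {p : Piece ι} (hp : p.OK) : LocalValid p.col.m p.nodes p.exit := by
  obtain ⟨c, s⟩ := p
  obtain ⟨hc, hs⟩ := hp
  dsimp only at hc hs ⊢
  cases s with
  | wait0 => exact c.localValid_rest hc
  | wait1 => exact c.localValid_rest hc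
  | shift0 => exact c.localValid_rest hc
  | shift1 => exact c.localValid_shift hc hs
  | run t =>
    cases h : c.rule with
    | none =>
      simp only [h] at hs
      subst hs
      have := c.localValid_rest hc
      rwa [← c.ready_nodes, ← c.ready_exit] at this
    | some ρ =>
      simp only [h] at hs
      rw [nodes_of_rule h, exit_of_rule h]
      exact c.localValid_rule hc h hs

/-- Only `shift0` has an oblique left link, and no column enters this stage during a round; so
afterwards all links are horizontal. -/
theorem OK.next {p : Piece ι} (hp : p.OK) :
    p.next ≠ [] ∧ (∀ q ∈ p.next, q.OK ∧ q.entry = (1, 0)) ∧ (allIds p.next).Perm p.col.ids := by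
  obtain ⟨c, s⟩ := p
  obtain ⟨hc, hs⟩ := hp
  dsimp only at hc hs ⊢
  have hready : ∀ q ∈ [c.ready], q.OK ∧ q.entry = (1, 0) := by
    intro q hq
    rw [List.mem_singleton] at hq
    subst hq
    exact ⟨ready_OK hc, rfl⟩
  cases s with
  | wait0 => exact ⟨by simp [Piece.next], by simp [Piece.next, OK, hc, entry], by simp [Piece.next]⟩
  | wait1 => exact ⟨by simp [Piece.next], hready, by simp [Piece.next]⟩
  | shift0 =>
    dsimp only at hs
    exact ⟨by simp [Piece.next], by simp [Piece.next, OK, hc, entry, hs], by simp [Piece.next]⟩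
  | shift1 => exact ⟨by simp [Piece.next], hready, by simp [Piece.next]⟩
  | run t =>
    cases h : c.rule with
    | none =>
      simp only [h] at hs
      subst hs
      simp only [Piece.next, h]
      exact ⟨by simp, hready, by simp⟩
    | some ρ =>
      simp only [h] at hs
      simp only [Piece.next, h]
      split_ifs with ht
      · exact ⟨by simp, by simp [OK, hc, h, ht, entry], by simp⟩
      · refine ⟨by simpa using c.children_ne_nil ρ, ?_, ?_⟩
        · intro q hq
          obtain ⟨c', hc', rfl⟩ := List.mem_map.1 hq
          exact ⟨ready_OK (c.children_wellFormed hc h c' hc'), rfl⟩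
        · rw [allIds, List.flatMap_map]
          exact c.children_ids_perm hc h

/-- All rules and stages in one form: the successors of a piece, placed by themselves at 0, are the
target of a local round. The old left link is carried to `p.entry - (1, 0)` because the new link has
direction `(1, 0)` while the old orientation `p.entry` must be kept. -/
theorem OK.localRound [DecidableEq ι] {p : Piece ι} (hp : p.OK) (hn : p.col.ids.Nodup) :
    ∃ N', LocalRound p.col.m p.nodes N' p.exit (lastExit .y 0 p.next) (p.entry - (1, 0)) ∧
      ∀ i k, p.col.ids[k]? = some i → place .y 0 p.next i = N' k := by
  have single : ∀ (q : Piece ι), q.col = p.col → ∀ i k, p.col.ids[k]? = some i →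
      place .y 0 [q] i = q.nodes k := by
    intro q hq i k hk
    have hi : i ∈ q.col.ids := by rw [hq]; exact List.mem_of_getElem? hk
    have hk' : q.col.ids.idxOf i = k := by rw [hq]; exact idxOf_of_getElem? hn hk
    simp only [place, if_pos hi, hk', Axis.vec_y, zero_add, Finset.image_id']
  have exit1 : ∀ q : Piece ι, lastExit .y 0 [q] = q.exit := by
    intro q; simp [lastExit]
  have e0 : ((1, 0) : ℤ × ℤ) - (1, 0) = 0 := rfl
  obtain ⟨c, s⟩ := p
  obtain ⟨hc, hs⟩ := hp
  dsimp only at hc hs hn single ⊢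
  cases s with
  | wait0 =>
    refine ⟨_, ?_, single ⟨c, .wait1⟩ rfl⟩
    simp only [Piece.next, exit1, entry, e0]
    exact c.localRound_rest hc
  | wait1 =>
    refine ⟨_, ?_, single c.ready rfl⟩
    have := c.localRound_rest hc
    simp only [Piece.next, entry, e0]
    change LocalRound _ _ _ _ (lastExit .y 0 [c.ready]) 0
    rw [exit1 c.ready, c.ready_exit, c.ready_nodes]
    exact this
  | shift0 =>
    refine ⟨_, ?_, single ⟨c, .shift1⟩ rfl⟩
    simp only [Piece.next, exit1]
    exact c.localRound_shift_zero hc hs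
  | shift1 =>
    refine ⟨_, ?_, single c.ready rfl⟩
    simp only [Piece.next, entry, e0]
    change LocalRound _ _ _ _ (lastExit .y 0 [c.ready]) 0
    rw [exit1 c.ready, c.ready_exit, c.ready_nodes]
    exact c.localRound_shift_one hc hs
  | run t =>
    cases h : c.rule with
    | none =>
      simp only [h] at hs
      subst hs
      have hnext : Piece.next ⟨c, .run 0⟩ = [c.ready] := by simp only [Piece.next, h]; rfl
      rw [hnext]
      refine ⟨_, ?_, single c.ready rfl⟩
      simp only [entry, e0]
      rw [exit1 c.ready]
      change LocalRound c.m c.ready.nodes _ c.ready.exit _ _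
      rw [c.ready_exit, c.ready_nodes]
      exact c.localRound_rest hc
    | some ρ =>
      simp only [h] at hs
      simp only [Piece.next, h, entry, e0]
      rw [nodes_of_rule h, exit_of_rule h]
      split_ifs with ht
      · refine ⟨_, ?_, single ⟨c, .run (t + 1)⟩ rfl⟩
        rw [exit1, nodes_of_rule h, exit_of_rule h]
        exact c.localRound_rule hc h ht
      · refine ⟨fun i => {c.nodeFinal ρ i}, ?_, fun i k hk => c.place_children hc h hn hk⟩
        change LocalRound _ _ _ _ (lastExit .y 0 ((c.children ρ).map Column.ready)) 0
        rw [c.lastExit_children hc h]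
        exact c.localRound_rule_last hc h (by omega)

end Piece

/-! ### Joining local rounds to a global one -/

variable {ι : Type*}

/-- The move of the amoebot `id b`, where `b` performs a move in its column. -/
def Move.lift (id : ℕ → ι) : Move ℕ → Move ι
  | .idle => .idle
  | .expand => .expand
  | .contract => .contract
  | .handover j => .handover (id j)

/-- Local rounds of columns that are joined by single bonds can be performed jointly. -/
theorem glue_round (A : Axis) (n : ℕ) (m : ℕ → ℕ) (id : ℕ → ℕ → ι) (K B : ι → ℕ)
    (O O' : ℕ → Node) (N N' : ℕ → ℕ → Finset Node) (x x' e : ℕ → Node) (P Q : Config ι)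
    (S : Set (Sym2 Node))
    (hK : ∀ i, K i < n ∧ B i < m (K i) ∧ id (K i) (B i) = i)
    (hid : ∀ k < n, ∀ b < m k, K (id k b) = k ∧ B (id k b) = b)
    (hP : ∀ k < n, ∀ b < m k, P.occ (id k b) = (N k b).image (fun u => O k + A.vec u))
    (hQ : ∀ k < n, ∀ b < m k, Q.occ (id k b) = (N' k b).image (fun u => O' k + A.vec u))
    (hO : ∀ k, k + 1 < n → O (k + 1) = O k + A.vec (x k) + A.vec (e (k + 1)))
    (hO' : ∀ k, k + 1 < n → O' (k + 1) = O' k + A.vec (x' k) + A.vec (1, 0))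
    (he : ∀ k < n, grid.Adj 0 (e k))
    (hS : ∀ k, k + 1 < n → s(O k + A.vec (x k), O (k + 1)) ∈ S)
    (hPV : P.Valid) (hQV : Q.Valid)
    (hL : ∀ k < n, LocalRound (m k) (N k) (N' k) (x k) (x' k) (e k - (1, 0))) :
    ∃ R, Round P R Q ∧ ∀ i j u w, u ∈ P.occ i → w ∈ P.occ j → s(u, w) ∈ R →
      K i = K j ∨ s(u, w) ∈ S := by
  have : Nonempty (Move ℕ) := ⟨.idle⟩
  unfold LocalRound at hL
  choose! par hi lo hi' lo' mv τ hmove hbond horig hexit using hL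
  set MV : ι → Move ι := fun i => (mv (K i) (B i)).lift (id (K i)) with hMV
  -- The displacement within the column plus the drift of the column's origin, which is caused by
  -- the columns to its left.
  set T : ι → Node := fun i => A.vec (τ (K i) (B i)) + (O' (K i) - O (K i)) with hT
  have mv_id : ∀ k < n, ∀ b < m k, MV (id k b) = (mv k b).lift (id k) := by
    intro k hk b hb
    simp only [hMV, (hid k hk b hb).1, (hid k hk b hb).2]
  have T_id : ∀ k < n, ∀ b < m k, T (id k b) = A.vec (τ k b) + (O' k - O k) := by
    intro k hk b hb
    simp only [hT, (hid k hk b hb).1, (hid k hk b hb).2]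
  have memP : ∀ k < n, ∀ b < m k, ∀ u ∈ N k b, O k + A.vec u ∈ P.occ (id k b) := by
    intro k hk b hb u hu
    rw [hP k hk b hb]
    exact Finset.mem_image_of_mem _ hu
  have carry : ∀ k < n, ∀ b < m k, ∀ u u', Carries ⟨N' k⟩ (mv k) (τ k) b u u' →
      Carries Q MV T (id k b) (O k + A.vec u) (O' k + A.vec u') := by
    intro k hk b hb u u' h
    have hshift : u' = u + τ k b →
        O' k + A.vec u' = O k + A.vec u + (A.vec (τ k b) + (O' k - O k)) := by
      rintro rfl
      rw [A.vec_add]; abel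
    have hmem : u' ∈ N' k b → O' k + A.vec u' ∈ Q.occ (id k b) := by
      intro h
      rw [hQ k hk b hb]
      exact Finset.mem_image_of_mem _ h
    unfold Carries at h ⊢
    rw [mv_id k hk b hb, T_id k hk b hb]
    cases hm : mv k b <;> rw [hm] at h
    · exact hshift h
    · exact hmem h
    · exact hmem h
    · exact hshift h
  -- All bonds inside columns and all links that can keep their orientation are kept. This makes the
  -- orientation condition immediate; only connectedness has to be shown, through tree bonds and
  -- links.
  set R : Set (Sym2 Node) := {s | ∃ i j u w u' w', i ≠ j ∧ u ∈ P.occ i ∧ w ∈ P.occ j ∧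
    grid.Adj u w ∧ Carries Q MV T i u u' ∧ Carries Q MV T j w w' ∧ w' - u' = w - u ∧
    (K i = K j ∨ s(u, w) ∈ S) ∧ s = s(u, w)} with hR
  have treeR : ∀ k < n, ∀ b, 0 < b → b < m k →
      s(O k + A.vec (hi k b), O k + A.vec (lo k b)) ∈ R := by
    intro k hk b hb0 hb
    obtain ⟨h1, h2, h3, h4, h5, h6, h7⟩ := hbond k hk b hb0 hb
    have hp := h1.trans hb
    refine ⟨id k (par k b), id k b, _, _, O' k + A.vec (hi' k b), O' k + A.vec (lo' k b), ?_,
      memP k hk _ hp _ h2, memP k hk b hb _ h3, (A.adj_add_vec _).2 h4, carry k hk _ hp _ _ h5,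
      carry k hk b hb _ _ h6, ?_, .inl ?_, rfl⟩
    · intro hne
      have := (hid k hk _ hp).2
      rw [hne, (hid k hk b hb).2] at this
      omega
    · rw [add_sub_add_left_eq_sub, add_sub_add_left_eq_sub, ← A.vec_sub, ← A.vec_sub, h7]
    · rw [(hid k hk _ hp).1, (hid k hk _ hb).1]
  have linkR : ∀ k, k + 1 < n → s(O k + A.vec (x k), O (k + 1)) ∈ R := by
    intro k hk1
    have hk : k < n := by omega
    obtain ⟨b, hb, hxb, hcx⟩ := hexit k hk
    obtain ⟨c, hc, h0c, hc0⟩ := horig (k + 1) hk1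
    have h0 := memP _ hk1 c hc _ h0c
    have hcc := carry _ hk1 c hc _ _ hc0
    simp only [Axis.vec_zero, add_zero] at h0 hcc
    -- The new origin lies `(1, 0)` beyond the new exit, so the offset `e - (1, 0)` gives the link
    -- its old orientation `e`.
    refine ⟨id k b, id (k + 1) c, _, _, O' k + A.vec (x' k), O' (k + 1) + A.vec (e (k + 1) - (1, 0)),
      ?_, memP k hk b hb _ hxb, h0, ?_, carry k hk b hb _ _ hcx, hcc, ?_, .inr (hS k hk1), rfl⟩
    · intro hne
      have := (hid k hk b hb).1
      rw [hne, (hid _ hk1 c hc).1] at this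
      omega
    · rw [hO k hk1]
      have := (A.adj_add_vec (O k + A.vec (x k))).2 (he _ hk1)
      simpa using this
    · rw [hO k hk1, hO' k hk1, A.vec_sub]
      abel
  have uniq : ∀ i j u, u ∈ P.occ i → u ∈ P.occ j → i = j := by
    intro i j u hui huj
    by_contra hij
    exact Finset.disjoint_left.1 (hPV.2 i j hij) hui huj
  have same : ∀ k < n, ∀ b < m k, ∀ u ∈ N k b, ∀ v ∈ N k b,
      (SimpleGraph.fromEdgeSet (P.bodyEdges ∪ R)).Reachable (O k + A.vec u) (O k + A.vec v) := by
    intro k hk b hb u hu v hv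
    by_cases huv : O k + A.vec u = O k + A.vec v
    · rw [huv]
    · refine SimpleGraph.Adj.reachable ?_
      rw [SimpleGraph.fromEdgeSet_adj]
      exact ⟨.inl ⟨_, _, _, memP k hk b hb u hu, memP k hk b hb v hv, huv, rfl⟩, huv⟩
  have bondReach : ∀ u w, s(u, w) ∈ R →
      (SimpleGraph.fromEdgeSet (P.bodyEdges ∪ R)).Reachable u w := by
    intro u w h
    by_cases huw : u = w
    · rw [huw]
    · refine SimpleGraph.Adj.reachable ?_
      rw [SimpleGraph.fromEdgeSet_adj]
      exact ⟨.inr h, huw⟩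
  have toRoot : ∀ k < n, ∀ b < m k, ∀ u ∈ N k b, ∃ v ∈ N k 0,
      (SimpleGraph.fromEdgeSet (P.bodyEdges ∪ R)).Reachable (O k + A.vec v) (O k + A.vec u) := by
    intro k hk b
    induction b using Nat.strong_induction_on with
    | _ b ih =>
      intro hb u hu
      rcases Nat.eq_zero_or_pos b with rfl | hb0
      · exact ⟨u, hu, SimpleGraph.Reachable.refl _⟩
      · obtain ⟨h1, h2, h3, -⟩ := hbond k hk b hb0 hb
        obtain ⟨v, hv, hvr⟩ := ih _ h1 (h1.trans hb) _ h2
        exact ⟨v, hv, hvr.trans ((bondReach _ _ (treeR k hk b hb0 hb)).trans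
          (same k hk b hb _ h3 _ hu))⟩
  have inBlock : ∀ k < n, ∀ b < m k, ∀ c < m k, ∀ u ∈ N k b, ∀ v ∈ N k c,
      (SimpleGraph.fromEdgeSet (P.bodyEdges ∪ R)).Reachable (O k + A.vec u) (O k + A.vec v) := by
    intro k hk b hb c hc u hu v hv
    obtain ⟨u', hu', hru⟩ := toRoot k hk b hb u hu
    obtain ⟨v', hv', hrv⟩ := toRoot k hk c hc v hv
    exact hru.symm.trans ((same k hk 0 (by omega) _ hu' _ hv').trans hrv)
  have toFirst : ∀ k < n, ∀ b < m k, ∀ u ∈ N k b, ∃ c < m 0, ∃ v ∈ N 0 c,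
      (SimpleGraph.fromEdgeSet (P.bodyEdges ∪ R)).Reachable (O 0 + A.vec v) (O k + A.vec u) := by
    intro k
    induction k with
    | zero => exact fun _ b hb u hu => ⟨b, hb, u, hu, SimpleGraph.Reachable.refl _⟩
    | succ k ih =>
      intro hk1 b hb u hu
      have hk : k < n := by omega
      obtain ⟨d, hd, hxd, -⟩ := hexit k hk
      obtain ⟨c, hc, h0c, -⟩ := horig (k + 1) hk1
      obtain ⟨f, hf, v, hv, hr⟩ := ih hk d hd _ hxd
      have h0 := inBlock _ hk1 c hc b hb _ h0c u hu
      simp only [Axis.vec_zero, add_zero] at h0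
      exact ⟨f, hf, v, hv, hr.trans ((bondReach _ _ (linkR k hk1)).trans h0)⟩
  refine ⟨R, ⟨?_, ?_, hQV, MV, T, ?_, ?_⟩, ?_⟩
  · rintro s ⟨i, j, u, w, u', w', hij, hu, hw, hadj, -, -, -, -, rfl⟩
    exact ⟨i, j, u, w, hij, hu, hw, hadj, rfl⟩
  · have key : ∀ u ∈ P.occupied, ∃ k < n, ∃ b < m k, ∃ v ∈ N k b, O k + A.vec v = u := by
      rintro u ⟨i, hi⟩
      obtain ⟨hk, hb, hkb⟩ := hK i
      rw [← hkb, hP _ hk _ hb, Finset.mem_image] at hi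
      exact ⟨_, hk, _, hb, hi⟩
    intro u hu v hv
    obtain ⟨k, hk, b, hb, u, hu₁, rfl⟩ := key u hu
    obtain ⟨l, hl, c, hc, v, hv₁, rfl⟩ := key v hv
    obtain ⟨d, hd, u', hu', hru⟩ := toFirst k hk b hb u hu₁
    obtain ⟨f, hf, v', hv', hrv⟩ := toFirst l hl c hc v hv₁
    exact hru.symm.trans ((inBlock 0 (by omega) d hd f hf _ hu' _ hv').trans hrv)
  · intro i
    obtain ⟨hk, hb, hkb⟩ := hK i
    generalize K i = k at *
    generalize B i = b at *
    subst hkb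
    obtain ⟨hm, hpart⟩ := hmove k hk b hb
    -- The bond required for a handover is a tree bond, so it has not been released.
    have hmono : {e | ∃ j, 0 < j ∧ j < m k ∧ e = s(O k + A.vec (hi k j), O k + A.vec (lo k j))} ⊆ R := by
      rintro _ ⟨j, hj0, hj, rfl⟩
      exact treeR k hk j hj0 hj
    unfold MoveOK at hm ⊢
    have hiff : ∀ c < m k, ((Config.mk (N k)).Contracted c → P.Contracted (id k c)) ∧
        ((Config.mk (N k)).Expanded c → P.Expanded (id k c)) ∧
        ((Config.mk (N' k)).Contracted c → Q.Contracted (id k c)) ∧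
        ((Config.mk (N' k)).Expanded c → Q.Expanded (id k c)) := by
      intro c hc
      refine ⟨?_, ?_, ?_, ?_⟩
      · rintro ⟨u, hu⟩
        refine ⟨O k + A.vec u, ?_⟩
        change N k c = _ at hu
        rw [hP k hk c hc, hu, Finset.image_singleton]
      · rintro ⟨u, v, huv, hu⟩
        refine ⟨_, _, (A.adj_add_vec (O k)).2 huv, ?_⟩
        change N k c = _ at hu
        rw [hP k hk c hc, hu, Finset.image_insert, Finset.image_singleton]
      · rintro ⟨u, hu⟩
        refine ⟨O' k + A.vec u, ?_⟩
        change N' k c = _ at hu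
        rw [hQ k hk c hc, hu, Finset.image_singleton]
      · rintro ⟨u, v, huv, hu⟩
        refine ⟨_, _, (A.adj_add_vec (O' k)).2 huv, ?_⟩
        change N' k c = _ at hu
        rw [hQ k hk c hc, hu, Finset.image_insert, Finset.image_singleton]
    rw [mv_id k hk b hb]
    cases hmb : mv k b with
    | idle =>
      simp only [hmb, Move.lift] at hm ⊢
      rw [hP k hk b hb, hQ k hk b hb, hm, T_id k hk b hb, Finset.image_image, Finset.image_image]
      congr 1
      funext u
      simp only [Function.comp, A.vec_add]
      abel
    | expand =>
      simp only [hmb, Move.lift] at hm ⊢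
      exact ⟨(hiff b hb).1 hm.1, (hiff b hb).2.2.2 hm.2⟩
    | contract =>
      simp only [hmb, Move.lift] at hm ⊢
      exact ⟨(hiff b hb).2.1 hm.1, (hiff b hb).2.2.1 hm.2⟩
    | handover j =>
      have hj := hpart j hmb
      simp only [hmb, Move.lift] at hm ⊢
      obtain ⟨h1, h2, h3⟩ := hm
      have hho : ∀ c < m k, ∀ d < m k, Handover ⟨N k⟩
          {e | ∃ j, 0 < j ∧ j < m k ∧ e = s(hi k j, lo k j)} ⟨N' k⟩ (τ k b) c d →
          Handover P R Q (A.vec (τ k b) + (O' k - O k)) (id k c) (id k d) := by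
        rintro c hc d hd ⟨c₀, x₁, x₂, e1, e2, e3, ⟨l, hl0, hl, e4⟩, e5, e6⟩
        refine ⟨O k + A.vec c₀, O k + A.vec x₁, O k + A.vec x₂, ?_, ?_, ?_, hmono ⟨l, hl0, hl, ?_⟩,
          ?_, ?_⟩
        · change N k c = _ at e1
          rw [hP k hk c hc, e1, Finset.image_singleton]
        · change N k d = _ at e2
          rw [hP k hk d hd, e2, Finset.image_insert, Finset.image_singleton]
        · exact fun h => e3 ((A.vec_add_inj _).1 h)
        · have := congrArg (Sym2.map (fun u => O k + A.vec u)) e4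
          simpa only [Sym2.map_mk] using this
        · change N' k c = _ at e5
          rw [hQ k hk c hc, e5, Finset.image_insert, Finset.image_singleton, A.vec_add, A.vec_add]
          congr 1
          · abel
          · congr 1; abel
        · change N' k d = _ at e6
          rw [hQ k hk d hd, e6, Finset.image_singleton, A.vec_add]
          congr 1; abel
      refine ⟨?_, ?_, ?_⟩
      · rw [mv_id k hk j hj, h1]; rfl
      · rw [T_id k hk j hj, T_id k hk b hb, h2]
      · rw [T_id k hk b hb]
        exact h3.imp (hho b hb j hj) (hho j hj b hb)
  · rintro i j u w hu hw ⟨i₁, j₁, u₁, w₁, u', w', hij, hu₁, hw₁, hadj, hc, hc', hd, -, hs⟩ -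
    rcases Sym2.eq_iff.1 hs with ⟨rfl, rfl⟩ | ⟨rfl, rfl⟩
    · rw [uniq i i₁ u hu hu₁, uniq j j₁ w hw hw₁]
      exact ⟨u', w', hc, hc', hd⟩
    · rw [uniq i j₁ u hu hw₁, uniq j i₁ w hw hu₁]
      refine ⟨w', u', hc', hc, ?_⟩
      rw [← neg_sub w' u', hd, neg_sub]
  · rintro i j u w hu hw ⟨i₁, j₁, u₁, w₁, u', w', hij, hu₁, hw₁, hadj, hc, hc', hd, hor, hs⟩
    rcases Sym2.eq_iff.1 hs with ⟨rfl, rfl⟩ | ⟨rfl, rfl⟩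
    · rw [uniq i i₁ u hu hu₁, uniq j j₁ w hw hw₁]
      exact hor
    · rw [uniq i j₁ u hu hw₁, uniq j i₁ w hw hu₁, Sym2.eq_swap]
      exact hor.imp Eq.symm (fun h => h)

/-! ### The invariant of the states, and legality of their rounds -/

variable {ι : Type*}

/-- A state in which every amoebot belongs to exactly one column, and all stages fit. -/
structure Good (st : List (Piece ι)) : Prop where
  nodup : (allIds st).Nodup
  ok : ∀ p ∈ st, p.OK
  cover : ∀ i, i ∈ allIds st

theorem allIds_next_perm {st : List (Piece ι)} (h : ∀ p ∈ st, p.OK) :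
    (allIds (st.flatMap Piece.next)).Perm (allIds st) := by
  induction st with
  | nil => rfl
  | cons p st ih =>
    rw [List.flatMap_cons, allIds_append, allIds_cons]
    exact (h p (by simp)).next.2.2.append (ih fun q hq => h q (by simp [hq]))

theorem Good.next {st : List (Piece ι)} (h : Good st) : Good (st.flatMap Piece.next) where
  nodup := (allIds_next_perm h.ok).nodup_iff.2 h.nodup
  ok q hq := by
    obtain ⟨p, hp, hq⟩ := List.mem_flatMap.1 hq
    exact ((h.ok p hp).next.2.1 q hq).1
  cover i := (allIds_next_perm h.ok).mem_iff.2 (h.cover i)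

theorem stateAt_succ (L : List (Piece ι)) (t : ℕ) :
    stateAt L (t + 1) = (stateAt L t).flatMap Piece.next := by
  rw [stateAt, Function.iterate_succ_apply', stateAt]

theorem Good.stateAt {L : List (Piece ι)} (h : Good L) (t : ℕ) : Good (stateAt L t) := by
  induction t with
  | zero => exact h
  | succ t ih => rw [stateAt_succ]; exact ih.next

theorem Piece.entry_fst (p : Piece ι) : p.entry.1 = 1 := by
  unfold entry; split <;> rfl

theorem Piece.adj_entry (p : Piece ι) : grid.Adj 0 p.entry := by
  rw [grid_adj_iff]
  unfold entry; split <;> simp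

theorem origin_vec (A : Axis) (o : Node) (c : ℤ × ℤ) (st : List (Piece ι)) (k : ℕ) :
    origin A (o + A.vec c) st k = o + A.vec (origin .y c st k) := by
  induction st generalizing c k with
  | nil => rfl
  | cons p st ih =>
    cases k with
    | zero => rfl
    | succ k =>
      simp only [origin]
      rw [← ih]
      cases st with
      | nil => rfl
      | cons q st => simp [originAfter, nextOrigin, A.vec_add, add_assoc]

theorem origin_eq (A : Axis) (o : Node) (st : List (Piece ι)) (k : ℕ) :
    origin A o st k = o + A.vec (origin .y 0 st k) := by
  have := origin_vec A o 0 st k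
  rwa [A.vec_zero, add_zero] at this

/-- Every entry advances by exactly one in the first coordinate, so the strip of a later column
begins strictly to the right of where an earlier one ends. -/
theorem origin_lt {st : List (Piece ι)} (h : ∀ p ∈ st, p.OK) {k l : ℕ} (hkl : k < l)
    {p q : Piece ι} (hp : st[k]? = some p) (hq : st[l]? = some q) :
    (origin .y 0 st k).1 + p.exit.1 < (origin .y 0 st l).1 := by
  have step : ∀ j a b, st[j]? = some a → st[j + 1]? = some b →
      (origin .y 0 st (j + 1)).1 = (origin .y 0 st j).1 + a.exit.1 + 1 := by
    intro j a b ha hb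
    rw [origin_succ _ _ _ _ ha hb, nextOrigin, Axis.vec_y, Axis.vec_y, ← b.entry_fst]
    rfl
  induction l generalizing q with
  | zero => omega
  | succ l ih =>
    rcases Nat.lt_succ_iff_lt_or_eq.1 hkl with hl | rfl
    · have hlt : l < st.length := by
        have := (List.getElem?_eq_some_iff.1 hq).1
        omega
      have hr : st[l]? = some st[l] := List.getElem?_eq_getElem hlt
      have := ih hl hr
      -- The exit node is occupied and therefore lies in the strip; so strips have nonnegative
      -- width.
      obtain ⟨i, hi, h0⟩ := (h _ (List.getElem_mem hlt)).localValid.exit_mem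
      have := ((h _ (List.getElem_mem hlt)).localValid.strip i hi _ h0).1
      rw [step l _ _ hr hq]
      omega
    · rw [step k _ _ hp hq]
      omega

/-- The origin of what becomes of the `k`-th column in one round. -/
def nextOrigins (A : Axis) : Node → List (Piece ι) → ℕ → Node
  | o, [], _ => o
  | o, _ :: _, 0 => o
  | o, p :: st, k + 1 => nextOrigins A (lastExit A o p.next + A.vec (1, 0)) st k

theorem lastExit_eq (A : Axis) (o : Node) (st : List (Piece ι)) :
    lastExit A o st = o + A.vec (lastExit .y 0 st) := by
  have := lastExit_vec A o 0 st
  rwa [A.vec_zero, add_zero] at this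

theorem nextOrigins_succ (A : Axis) (o : Node) (st : List (Piece ι)) (k : ℕ) {p : Piece ι}
    (hp : st[k]? = some p) (hk : k + 1 < st.length) :
    nextOrigins A o st (k + 1) =
      nextOrigins A o st k + A.vec (lastExit .y 0 p.next) + A.vec (1, 0) := by
  induction st generalizing o k with
  | nil => simp at hp
  | cons a st ih =>
    cases k with
    | zero =>
      simp only [List.getElem?_cons_zero, Option.some.injEq] at hp
      subst hp
      cases st with
      | nil => simp at hk
      | cons b st => rw [← lastExit_eq]; rfl
    | succ k =>
      simp only [List.getElem?_cons_succ] at hp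
      exact ih _ k hp (by simpa using hk)

section Decidable

variable [DecidableEq ι]

/-- Within one column local validity excludes collisions; between different columns the disjoint
strips do. -/
theorem Good.valid {st : List (Piece ι)} (h : Good st) (A : Axis) (o : Node) :
    (toConfig A o st).Valid := by
  have find : ∀ i, ∃ k p, st[k]? = some p ∧ p ∈ st ∧ p.col.ids[p.col.ids.idxOf i]? = some i ∧
      p.col.ids.idxOf i < p.col.m ∧ (toConfig A o st).occ i =
        (p.nodes (p.col.ids.idxOf i)).image (fun c => origin A o st k + A.vec c) := by
    intro i
    obtain ⟨p, hp, hi⟩ := mem_allIds.1 (h.cover i)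
    obtain ⟨k, hk⟩ := List.mem_iff_getElem?.1 hp
    have hlt := List.idxOf_lt_length_iff.2 hi
    exact ⟨k, p, hk, hp, by rw [List.getElem?_eq_getElem hlt, List.getElem_idxOf], hlt,
      place_eq A o st h.nodup k hk hi⟩
  constructor
  · intro i
    obtain ⟨k, p, -, hp, -, hlt, hocc⟩ := find i
    rcases (h.ok p hp).localValid.shape _ hlt with ⟨u, hu⟩ | ⟨u, v, huv, hu⟩
    · refine .inl ⟨origin A o st k + A.vec u, ?_⟩
      change p.nodes _ = _ at hu
      rw [hocc, hu, Finset.image_singleton]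
    · refine .inr ⟨_, _, (A.adj_add_vec (origin A o st k)).2 huv, ?_⟩
      change p.nodes _ = _ at hu
      rw [hocc, hu, Finset.image_insert, Finset.image_singleton]
  · intro i j hij
    obtain ⟨k, p, hk, hp, hpi, hi, hocci⟩ := find i
    obtain ⟨l, q, hl, hq, hqj, hj, hoccj⟩ := find j
    rw [Finset.disjoint_left, hocci, hoccj]
    rintro w hw hw'
    obtain ⟨u, hu, rfl⟩ := Finset.mem_image.1 hw
    obtain ⟨v, hv, hvu⟩ := Finset.mem_image.1 hw'
    rw [origin_eq A o st k, origin_eq A o st l, add_assoc, add_assoc, ← A.vec_add, ← A.vec_add,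
      A.vec_add_inj] at hvu
    have h1 : (origin .y 0 st l).1 + v.1 = (origin .y 0 st k).1 + u.1 := congrArg Prod.fst hvu
    have su := (h.ok p hp).localValid.strip _ hi u hu
    have sv := (h.ok q hq).localValid.strip _ hj v hv
    rcases lt_trichotomy k l with hkl | rfl | hkl
    · have := origin_lt h.ok hkl hk hl
      omega
    · rw [hk] at hl
      cases hl
      rw [add_right_inj] at hvu
      subst hvu
      have := (h.ok p hp).localValid.disjoint _ hi _ hj v hu hv
      rw [this, hqj] at hpi
      exact hij (Option.some.inj hpi).symm
    · have := origin_lt h.ok hkl hl hk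
      omega

theorem place_next (A : Axis) (o : Node) (st : List (Piece ι)) (h : ∀ p ∈ st, p.OK)
    (hn : (allIds st).Nodup) (k : ℕ) {p : Piece ι} (hp : st[k]? = some p) {i : ι}
    (hi : i ∈ p.col.ids) :
    place A o (st.flatMap Piece.next) i =
      (place .y 0 p.next i).image (fun c => nextOrigins A o st k + A.vec c) := by
  have hvec : ∀ o, place A o p.next i = (place .y 0 p.next i).image (fun c => o + A.vec c) := by
    intro o
    have := place_vec A o 0 p.next i
    rwa [A.vec_zero, add_zero] at this
  induction st generalizing o k with
  | nil => simp at hp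
  | cons a st ih =>
    have ha := (h a (by simp)).next
    have hst : ∀ q ∈ st, q.OK := fun q hq => h q (by simp [hq])
    rw [allIds_cons, List.nodup_append] at hn
    rw [List.flatMap_cons]
    cases k with
    | zero =>
      simp only [List.getElem?_cons_zero, Option.some.injEq] at hp
      subst hp
      have hi' : i ∈ allIds a.next := ha.2.2.mem_iff.2 hi
      cases hf : st.flatMap Piece.next with
      | nil => rw [List.append_nil, hvec]; rfl
      | cons q qs => rw [place_append _ _ _ _ _ _ ha.1, if_pos hi', hvec]; rfl
    | succ k =>
      simp only [List.getElem?_cons_succ] at hp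
      have hpst := List.mem_of_getElem? hp
      have hi' : i ∉ allIds a.next := fun hia =>
        hn.2.2 i (ha.2.2.mem_iff.1 hia) i (mem_allIds.2 ⟨p, hpst, hi⟩) rfl
      cases hf : st.flatMap Piece.next with
      | nil =>
        have := List.flatMap_eq_nil_iff.1 hf p hpst
        exact absurd this (hst p hpst).next.1
      | cons q qs =>
        have hq : q.entry = (1, 0) := by
          have : q ∈ st.flatMap Piece.next := by simp [hf]
          obtain ⟨b, hb, hqb⟩ := List.mem_flatMap.1 this
          exact ((hst b hb).next.2.1 q hqb).2
        rw [place_append _ _ _ _ _ _ ha.1, if_neg hi', hq, ← hf, ih _ hst hn.2.1 k hp]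
        rfl

/-- Legality follows from the invariant alone, in whatever combination of stages the columns are. -/
theorem Good.round [Nonempty ι] {st : List (Piece ι)} (h : Good st) (A : Axis) (o : Node) :
    ∃ R, Round (toConfig A o st) R (toConfig A o (st.flatMap Piece.next)) ∧
      KeepsOnlyLinks A o st R := by
  have find : ∀ i, ∃ (k : ℕ) (p : Piece ι), st[k]? = some p ∧ i ∈ p.col.ids := by
    intro i
    obtain ⟨p, hp, hi⟩ := mem_allIds.1 (h.cover i)
    obtain ⟨k, hk⟩ := List.mem_iff_getElem?.1 hp
    exact ⟨k, p, hk, hi⟩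
  have uniq : ∀ {k l : ℕ} {p q : Piece ι} {i : ι}, st[k]? = some p → st[l]? = some q →
      i ∈ p.col.ids → i ∈ q.col.ids → k = l := by
    intro k l p q i hk hl hi hj
    obtain ⟨hk', rfl⟩ := List.getElem?_eq_some_iff.1 hk
    obtain ⟨hl', rfl⟩ := List.getElem?_eq_some_iff.1 hl
    by_contra hne
    have hp := (List.nodup_flatMap.1 h.nodup).2
    rw [List.pairwise_iff_getElem] at hp
    rcases Nat.lt_or_gt_of_ne hne with hlt | hlt
    · exact hp k l hk' hl' hlt hi hj
    · exact hp l k hl' hk' hlt hj hi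
  choose K pK hK hiK using find
  -- The default piece only makes the function total; it is never used for indices below the length.
  set pc : ℕ → Piece ι := fun k => st[k]?.getD ⟨⟨[], 0, 0⟩, .wait0⟩ with hpc
  have pc_eq : ∀ k < st.length, st[k]? = some (pc k) := by
    intro k hk
    simp [hpc, List.getElem?_eq_getElem hk]
  have pc_mem : ∀ k < st.length, pc k ∈ st := fun k hk => List.mem_of_getElem? (pc_eq k hk)
  have pc_nodup : ∀ k < st.length, (pc k).col.ids.Nodup := fun k hk =>
    (List.nodup_flatMap.1 h.nodup).1 _ (pc_mem k hk)
  have hKlt : ∀ i, K i < st.length := fun i => (List.getElem?_eq_some_iff.1 (hK i)).1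
  have hpK : ∀ i, i ∈ (pc (K i)).col.ids := by
    intro i
    have := pc_eq _ (hKlt i)
    rw [hK i] at this
    rw [← Option.some.inj this]
    exact hiK i
  set id : ℕ → ℕ → ι := fun k b => (pc k).col.ids[b]?.getD (Classical.arbitrary ι) with hid
  have id_eq : ∀ k, ∀ b < (pc k).col.m, (pc k).col.ids[b]? = some (id k b) := by
    intro k b hb
    simp [hid, List.getElem?_eq_getElem hb]
  have id_mem : ∀ k, ∀ b < (pc k).col.m, id k b ∈ (pc k).col.ids := fun k b hb =>
    List.mem_of_getElem? (id_eq k b hb)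
  have hround : ∀ k, ∃ N', k < st.length → LocalRound (pc k).col.m (pc k).nodes N' (pc k).exit
      (lastExit .y 0 (pc k).next) ((pc k).entry - (1, 0)) ∧
      ∀ i b, (pc k).col.ids[b]? = some i → place .y 0 (pc k).next i = N' b := by
    intro k
    by_cases hk : k < st.length
    · obtain ⟨N', hN'⟩ := (h.ok _ (pc_mem k hk)).localRound (pc_nodup k hk)
      exact ⟨N', fun _ => hN'⟩
    · exact ⟨fun _ => ∅, fun hk' => absurd hk' hk⟩
  choose N' hN' using hround
  have hid' : ∀ k < st.length, ∀ b < (pc k).col.m,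
      K (id k b) = k ∧ (pc (K (id k b))).col.ids.idxOf (id k b) = b := by
    intro k hk b hb
    have e : K (id k b) = k :=
      uniq (pc_eq _ (hKlt _)) (pc_eq k hk) (hpK _) (id_mem k b hb)
    refine ⟨e, ?_⟩
    rw [e]
    exact idxOf_of_getElem? (pc_nodup k hk) (id_eq k b hb)
  obtain ⟨R, hR, hlink⟩ := glue_round A st.length (fun k => (pc k).col.m) id K
    (fun i => (pc (K i)).col.ids.idxOf i) (origin A o st) (nextOrigins A o st)
    (fun k => (pc k).nodes) N' (fun k => (pc k).exit) (fun k => lastExit .y 0 (pc k).next)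
    (fun k => (pc k).entry) (toConfig A o st) (toConfig A o (st.flatMap Piece.next))
    (links A o st)
    (fun i => ⟨hKlt i, List.idxOf_lt_length_iff.2 (hpK i), by
      have hlt := List.idxOf_lt_length_iff.2 (hpK i)
      have := id_eq (K i) _ hlt
      rw [List.getElem?_eq_getElem hlt, List.getElem_idxOf] at this
      exact (Option.some.inj this).symm⟩)
    hid'
    (fun k hk b hb => by
      have := place_eq A o st h.nodup k (pc_eq k hk) (id_mem k b hb)
      rwa [idxOf_of_getElem? (pc_nodup k hk) (id_eq k b hb)] at this)
    (fun k hk b hb => by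
      have := place_next A o st h.ok h.nodup k (pc_eq k hk) (id_mem k b hb)
      rwa [(hN' k hk).2 _ b (id_eq k b hb)] at this)
    (fun k hk => origin_succ A o st k (pc_eq k (by omega)) (pc_eq _ hk))
    (fun k hk => nextOrigins_succ A o st k (pc_eq k (by omega)) hk)
    (fun k _ => (pc k).adj_entry)
    (fun k hk => mem_links A o st k (pc_eq k (by omega)) (pc_eq _ hk))
    (h.valid A o) (h.next.valid A o)
    (fun k hk => (hN' k hk).1)
  refine ⟨R, hR, fun i j u w hu hw hs => (hlink i j u w hu hw hs).imp (fun e => ?_) (fun e => e)⟩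
  exact ⟨pc (K i), pc_mem _ (hKlt i), hpK i, e ▸ hpK j⟩

end Decidable

/-! ### Counting rounds and rule applications -/

variable {ι : Type*}

/-- The largest number of rounds of the rules that may be applied to a column and, later, to the
columns that arise from it, when it starts with the given rule. -/
def roundsLeft : Option Rule → ℕ
  | none => 0
  | some .r1b => 2
  | some .r2b => 4
  | some .r3d | some .r3e => 7
  | some .r3b | some .r3c => 10
  | some .r1a => 12
  | some .r3a => 13
  | some .r2a => 14

/-- The largest number of rules in a sequence of rules that starts with the given one. -/
def rulesLeft : Option Rule → ℕ
  | none => 0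
  | some .r1b | some .r2b => 1
  | some .r3d | some .r3e => 2
  | some .r3b | some .r3c => 3
  | some .r1a | some .r2a | some .r3a => 4

theorem roundsLeft_le (ρ : Option Rule) : roundsLeft ρ ≤ 14 := by
  rcases ρ with _ | ρ
  · simp [roundsLeft]
  · cases ρ <;> simp [roundsLeft]

theorem rulesLeft_le (ρ : Option Rule) : rulesLeft ρ ≤ 4 := by
  rcases ρ with _ | ρ
  · simp [rulesLeft]
  · cases ρ <;> simp [rulesLeft]

theorem rounds_le_roundsLeft (ρ : Rule) : ρ.rounds ≤ roundsLeft (some ρ) := by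
  cases ρ <;> simp [roundsLeft, Rule.rounds]

theorem rulesLeft_pos (ρ : Rule) : 0 < rulesLeft (some ρ) := by
  cases ρ <;> simp [rulesLeft]

/-- Rules 1a, 2a, 3a lead only to 3b–3e; 3b leads only to 3d and 3c to 3e; 3d and 3e lead only to 1b
and 2b; and these leave single amoebots. The values of the potentials are the longest paths in this
order, weighted by rounds or by one. -/
theorem Column.left_children (c : Column ι) (hc : c.WellFormed) {ρ : Rule} (h : c.rule = some ρ)
    {c' : Column ι} (hc' : c' ∈ c.children ρ) :
    roundsLeft c'.rule + ρ.rounds ≤ roundsLeft (some ρ) ∧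
      rulesLeft c'.rule + 1 ≤ rulesLeft (some ρ) := by
  have hwf := c.children_wellFormed hc h c' hc'
  cases h' : c'.rule with
  | none => exact ⟨by simpa [roundsLeft] using rounds_le_roundsLeft ρ,
      Nat.succ_le_of_lt (rulesLeft_pos ρ)⟩
  | some σ =>
    have hs := c.rule_spec hc h
    have hs' := c'.rule_spec hwf h'
    have h1 := hc.1
    have h2 := hc.2
    clear hwf
    simp only [m] at *
    cases ρ <;> dsimp only at hs <;>
      simp only [children, List.mem_append, List.mem_cons, List.mem_map, List.not_mem_nil,
        or_false, m] at hc' <;>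
      rcases hc' with (rfl | ⟨v, -, rfl⟩) | rfl
    all_goals
      cases σ <;> dsimp only at hs' <;>
      (try simp only [List.length_take, List.length_drop, List.length_cons, List.length_nil,
        length_everySecond, List.length_tail, true_and, and_true,
        not_true, and_false] at hs') <;>
      -- Either the child's size and links contradict the conditions of `σ`, or the pair `(ρ, σ)`
      -- can occur and the tabulated values are compared.
      first
        | (exfalso; omega)
        | (simp only [roundsLeft, rulesLeft, Rule.rounds]; omega)

theorem StateEdge.rulesLeft_lt {ρ σ : Rule} (h : StateEdge ρ σ) :
    rulesLeft (some σ) < rulesLeft (some ρ) := by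
  obtain ⟨c, hc, hρ, c', hc', -, hσ⟩ := h
  have := (c.left_children hc hρ hc').2
  rw [hσ] at this
  omega

theorem stateGraph_acyclic (ρ : Rule) : ¬ Relation.TransGen StateEdge ρ ρ := by
  have key : ∀ σ, Relation.TransGen StateEdge ρ σ →
      rulesLeft (some σ) < rulesLeft (some ρ) := by
    intro σ h
    induction h with
    | single h => exact h.rulesLeft_lt
    | tail _ h ih => exact h.rulesLeft_lt.trans ih
  exact fun h => lt_irrefl _ (key ρ h)

namespace Piece

/-- A bound for the number of rounds until the column has been split into single amoebots. -/
def roundsLeft (p : Piece ι) : ℕ :=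
  match p.stage with
  | .wait0 | .shift0 => 16
  | .wait1 | .shift1 => 15
  | .run t => Amoebot.roundsLeft p.col.rule - t

/-- A bound for the number of rules that begin from now on. -/
def rulesLeft (p : Piece ι) : ℕ :=
  match p.stage with
  | .wait0 | .shift0 | .wait1 | .shift1 => 4
  | .run 0 => Amoebot.rulesLeft p.col.rule
  | .run (_ + 1) => Amoebot.rulesLeft p.col.rule - 1

/-- The rule in progress is charged when its first round is executed, so `rulesLeft` drops exactly
where `BeginsRule` counts. -/
theorem OK.left_next {p q : Piece ι} (hp : p.OK) (hq : q ∈ p.next) :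
    q.roundsLeft ≤ p.roundsLeft - 1 ∧ q.rulesLeft ≤ p.rulesLeft ∧
      (p.stage = .run 0 → p.col.rule ≠ none → q.rulesLeft + 1 ≤ p.rulesLeft) := by
  obtain ⟨c, s⟩ := p
  obtain ⟨hc, hs⟩ := hp
  dsimp only at hc hs ⊢
  have b1 := roundsLeft_le c.rule
  have b2 := rulesLeft_le c.rule
  cases s with
  | wait0 =>
    simp only [Piece.next, List.mem_singleton] at hq
    subst hq
    simp [roundsLeft, rulesLeft]
  | shift0 =>
    simp only [Piece.next, List.mem_singleton] at hq
    subst hq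
    simp [roundsLeft, rulesLeft]
  | wait1 =>
    simp only [Piece.next, List.mem_singleton] at hq
    subst hq
    simpa [roundsLeft, rulesLeft] using ⟨b1, b2⟩
  | shift1 =>
    simp only [Piece.next, List.mem_singleton] at hq
    subst hq
    simpa [roundsLeft, rulesLeft] using ⟨b1, b2⟩
  | run t =>
    cases h : c.rule with
    | none =>
      simp only [h] at hs
      simp only [Piece.next, h, List.mem_singleton] at hq
      subst hq hs
      simp [roundsLeft, rulesLeft, h, Amoebot.roundsLeft]
    | some ρ =>
      simp only [h] at hs
      simp only [Piece.next, h] at hq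
      have hpos := rulesLeft_pos ρ
      split_ifs at hq with ht
      · rw [List.mem_singleton] at hq
        subst hq
        cases t <;> simp [roundsLeft, rulesLeft, h] <;> omega
      · obtain ⟨c', hc', rfl⟩ := List.mem_map.1 hq
        obtain ⟨h1, h2⟩ := c.left_children hc h hc'
        cases t <;> simp [roundsLeft, rulesLeft, h] <;> omega

theorem OK.of_roundsLeft_eq_zero {p : Piece ι} (hp : p.OK) (h0 : p.roundsLeft = 0) :
    p.stage = .run 0 ∧ p.col.m = 1 := by
  obtain ⟨c, s⟩ := p
  obtain ⟨hc, hs⟩ := hp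
  dsimp only at hc hs ⊢
  cases s with
  | run t =>
    cases h : c.rule with
    | none =>
      simp only [h] at hs
      have h1 := hc.1
      have := (c.rule_eq_none).1 h
      exact ⟨by rw [hs], by omega⟩
    | some ρ =>
      simp only [h] at hs
      have := rounds_le_roundsLeft ρ
      simp only [roundsLeft, h] at h0
      omega
  | _ => simp [roundsLeft] at h0

end Piece

theorem terminated_of_start {L : List (Piece ι)} (h : Good L) {T : ℕ}
    (hT : ∀ p ∈ L, p.roundsLeft ≤ T) : Terminated (stateAt L T) := by
  have key : ∀ t, ∀ p ∈ stateAt L t, p.roundsLeft ≤ T - t := by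
    intro t
    induction t with
    | zero => exact hT
    | succ t ih =>
      intro q hq
      rw [stateAt_succ] at hq
      obtain ⟨p, hp, hq⟩ := List.mem_flatMap.1 hq
      have := (((h.stateAt t).ok p hp).left_next hq).1
      have := ih p hp
      omega
  intro p hp
  refine ((h.stateAt T).ok p hp).of_roundsLeft_eq_zero ?_
  have := key T p hp
  omega

theorem Good.eq_of_mem {st : List (Piece ι)} (h : Good st) {p q : Piece ι} (hp : p ∈ st)
    (hq : q ∈ st) {i : ι} (hi : i ∈ p.col.ids) (hj : i ∈ q.col.ids) : p = q := by
  have hd := (List.nodup_flatMap.1 h.nodup).2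
  by_contra hne
  have hsymm : Std.Symm (Function.onFun List.Disjoint fun p : Piece ι => p.col.ids) :=
    ⟨fun _ _ h => h.symm⟩
  exact hd.forall hp hq hne hi hj

/-- The rules begun before time `t`, plus the potential of the column that contains `i` at time `t`,
never exceed 4. -/
theorem encard_beginsRule_le {L : List (Piece ι)} (h : Good L) (i : ι) :
    {t : ℕ | BeginsRule (stateAt L t) i}.encard ≤ 4 := by
  classical
  have key : ∀ t, ∀ p ∈ stateAt L t, i ∈ p.col.ids →
      ((Finset.range t).filter (fun s => BeginsRule (stateAt L s) i)).card + p.rulesLeft ≤ 4 := by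
    intro t
    induction t with
    | zero =>
      intro p _ _
      simp only [Finset.range_zero, Finset.filter_empty, Finset.card_empty, zero_add]
      have := rulesLeft_le p.col.rule
      unfold Piece.rulesLeft
      split <;> omega
    | succ t ih =>
      intro q hq hiq
      rw [stateAt_succ] at hq
      obtain ⟨p, hp, hq⟩ := List.mem_flatMap.1 hq
      have hok := (h.stateAt t).ok p hp
      have hip : i ∈ p.col.ids := hok.next.2.2.mem_iff.1 (mem_allIds.2 ⟨q, hq, hiq⟩)
      have hle := ih p hp hip
      obtain ⟨-, h1, h2⟩ := hok.left_next hq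
      rw [Finset.range_add_one, Finset.filter_insert]
      split_ifs with hb
      · obtain ⟨p', hp', hip', hs, hr⟩ := hb
        obtain rfl := (h.stateAt t).eq_of_mem hp hp' hip hip'
        have := h2 hs hr
        have := Finset.card_insert_le t
          ((Finset.range t).filter (fun s => BeginsRule (stateAt L s) i))
        omega
      · omega
  by_contra hlt
  rw [not_le] at hlt
  have h5 : (5 : ℕ∞) ≤ {t : ℕ | BeginsRule (stateAt L t) i}.encard := by
    have := Order.add_one_le_of_lt hlt
    rwa [show (4 : ℕ∞) + 1 = 5 by norm_num] at this
  -- The invariant controls only finite initial segments of time; five starting times would all lie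
  -- in one of them.
  obtain ⟨s, hs, hs5⟩ := Set.exists_subset_encard_eq h5
  have hfin : s.Finite := Set.finite_of_encard_eq_coe (k := 5) hs5
  obtain ⟨N, hN⟩ := hfin.bddAbove
  obtain ⟨p, hp, hip⟩ := mem_allIds.1 ((h.stateAt (N + 1)).cover i)
  have hle := key (N + 1) p hp hip
  have hsub : hfin.toFinset ⊆
      (Finset.range (N + 1)).filter (fun s => BeginsRule (stateAt L s) i) := by
    intro t ht
    rw [Set.Finite.mem_toFinset] at ht
    rw [Finset.mem_filter, Finset.mem_range]
    exact ⟨Nat.lt_succ_of_le (hN ht), hs ht⟩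
  have hcard := Finset.card_le_card hsub
  rw [hfin.encard_eq_coe_toFinset_card] at hs5
  have : hfin.toFinset.card = 5 := by exact_mod_cast hs5
  omega

/-- Single amoebots have both links at their only node, so consecutive origins differ by `A.across`,
a unit vector up to sign along another axis. -/
theorem Terminated.isLineSegment [DecidableEq ι] [Nonempty ι] {st : List (Piece ι)}
    (ht : Terminated st) (h : Good st) (A : Axis) (o : Node) :
    (toConfig A o st).IsLineSegment := by
  have hpiece : ∀ p ∈ st, p = p.col.ready ∧ p.col.l = 0 ∧ p.col.r = 0 := by
    intro p hp
    obtain ⟨h1, h2⟩ := ht p hp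
    have := (h.ok p hp).1.1
    have := (h.ok p hp).1.2
    refine ⟨?_, by omega, by omega⟩
    obtain ⟨c, s⟩ := p
    dsimp only at h1
    rw [h1]
    rfl
  have horigin : ∀ k p, st[k]? = some p → origin A o st k = o + (k : ℤ) • A.across := by
    intro k
    induction k with
    | zero => intro p _; simp
    | succ k ih =>
      intro q hq
      have hk : k < st.length := by
        have := (List.getElem?_eq_some_iff.1 hq).1
        omega
      have hp := List.getElem?_eq_getElem hk
      obtain ⟨hp1, hp2, hp3⟩ := hpiece _ (List.getElem_mem hk)
      obtain ⟨hq1, -, -⟩ := hpiece _ (List.mem_of_getElem? hq)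
      rw [origin_succ A o st k hp hq, nextOrigin, ih _ hp, hp1, hq1, Column.ready_exit,
        Column.ready_entry, hp2, hp3]
      simp only [Axis.vec]
      push_cast
      simp [add_smul, add_assoc]
  have hocc : ∀ (k : ℕ) (p : Piece ι), st[k]? = some p → ∀ i ∈ p.col.ids,
      (toConfig A o st).occ i = {o + (k : ℤ) • A.across} := by
    intro k p hp i hi
    obtain ⟨hp1, hp2, hp3⟩ := hpiece _ (List.mem_of_getElem? hp)
    have h1 := (ht p (List.mem_of_getElem? hp)).2
    have hlt := List.idxOf_lt_length_iff.2 hi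
    have h0 : p.col.ids.idxOf i = 0 := by
      simp only [Column.m] at h1
      omega
    have := place_eq A o st h.nodup k hp hi
    rw [h0, hp1, Column.ready_nodes, Column.nodesRest, hp2, horigin k p hp] at this
    change place A o st i = _
    simpa [Axis.vec] using this
  have hoccupied : (toConfig A o st).occupied =
      {v | ∃ k : ℕ, k < st.length ∧ v = o + (k : ℤ) • A.across} := by
    ext v
    constructor
    · rintro ⟨i, hi⟩
      obtain ⟨p, hp, hip⟩ := mem_allIds.1 (h.cover i)
      obtain ⟨k, hk⟩ := List.mem_iff_getElem?.1 hp
      rw [hocc k p hk i hip, Finset.mem_singleton] at hi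
      exact ⟨k, (List.getElem?_eq_some_iff.1 hk).1, hi⟩
    · rintro ⟨k, hk, rfl⟩
      have hp := List.getElem?_eq_getElem hk
      have hlt := (h.ok _ (List.getElem_mem hk)).1.1
      refine ⟨st[k].col.ids[0]'(by simp only [Column.m] at hlt; omega), ?_⟩
      rw [hocc k _ hp _ (List.getElem_mem _)]
      exact Finset.mem_singleton_self _
  refine ⟨⟨h.valid A o, ?_, ?_⟩, ?_⟩
  -- Connectedness is part of the legality of one further round, and its set `R` consists of bonds.
  · obtain ⟨R, ⟨hR, hconn, -⟩, -⟩ := h.round A o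
    intro u hu v hv
    exact (hconn u hu v hv).mono
      (SimpleGraph.fromEdgeSet_mono (Set.union_subset_union_right _ hR))
  · intro i
    obtain ⟨p, hp, hip⟩ := mem_allIds.1 (h.cover i)
    obtain ⟨k, hk⟩ := List.mem_iff_getElem?.1 hp
    exact ⟨_, hocc k p hk i hip⟩
  · rw [hoccupied]
    cases A with
    | x =>
      -- Here `A.across` is the negative of `Axis.z.dir`, so the segment is listed from its other
      -- end.
      refine ⟨.z, o + ((st.length : ℤ) - 1) • Axis.x.across, st.length, ?_⟩
      have hz : Axis.x.across = -Axis.z.dir := rfl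
      ext v
      simp only [Set.mem_ofPred_eq]
      constructor
      · rintro ⟨k, hk, rfl⟩
        refine ⟨st.length - 1 - k, by omega, ?_⟩
        rw [← natCast_zsmul, Nat.cast_sub (by omega), Nat.cast_sub (by omega), hz]
        module
      · rintro ⟨k, hk, rfl⟩
        refine ⟨st.length - 1 - k, by omega, ?_⟩
        rw [← natCast_zsmul, Nat.cast_sub (by omega), Nat.cast_sub (by omega), hz]
        module
    | y => exact ⟨.x, o, st.length, by simp [Axis.across, Axis.dir]⟩
    | z => exact ⟨.y, o, st.length, by simp [Axis.across, Axis.dir]⟩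

/-! ### Starting the algorithm -/

/-- A walk that passes a level of `φ` has an edge that does. -/
theorem exists_adj_crossing {V : Type*} {G : SimpleGraph V} (φ : V → ℤ) (a : ℤ) {u v : V}
    (w : G.Walk u v) (hu : φ u ≤ a) (hv : a < φ v) : ∃ x y, G.Adj x y ∧ φ x ≤ a ∧ a < φ y := by
  induction w with
  | nil => omega
  | @cons u x v h w ih =>
    by_cases hx : φ x ≤ a
    · exact ih hx hv
    · exact ⟨u, x, h, hu, by omega⟩

variable {ι : Type*}

/-- The amoebots of a contracted structure that is monotone along `A`, in column coordinates. -/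
theorem exists_columnCoords (S : Config ι) (hS : S.IsContractedStructure) (A : Axis)
    (hA : S.MonotoneAlong A) : ∃ c : ι → ℤ × ℤ, Function.Injective c ∧
      (∀ i, S.occ i = {A.vec (c i)}) ∧
      (∀ i j b, (c i).1 = (c j).1 → (c i).2 ≤ b → b ≤ (c j).2 → ∃ k, c k = ((c i).1, b)) ∧
      (∀ i j a, (c i).1 ≤ a → a < (c j).1 →
        ∃ i' j', grid.Adj (c i') (c j') ∧ (c i').1 = a ∧ (c j').1 = a + 1) := by
  obtain ⟨⟨-, hdisj⟩, hconn, hcontr⟩ := hS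
  choose f hf using hcontr
  choose c hc using fun i => A.vec_surj (f i)
  have hocc : ∀ i, S.occ i = {A.vec (c i)} := fun i => by rw [hf, hc]
  have hmem : ∀ i, A.vec (c i) ∈ S.occupied := fun i => ⟨i, by rw [hocc]; simp⟩
  have hof : ∀ u ∈ S.occupied, ∃ i, A.vec (c i) = u := by
    rintro u ⟨i, hi⟩
    rw [hocc, Finset.mem_singleton] at hi
    exact ⟨i, hi.symm⟩
  choose inv hinv using A.vec_surj
  have hinvc : ∀ d, inv (A.vec d) = d := fun d => A.vec_inj.1 (hinv _)
  refine ⟨c, ?_, hocc, ?_, ?_⟩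
  · intro i j hij
    by_contra hne
    have := hdisj i j hne
    rw [hocc, hocc, hij] at this
    simp at this
  · intro i j b hij hib hbj
    rcases hib.eq_or_lt with rfl | hlt
    · exact ⟨i, rfl⟩
    have hline : ∀ d : ℤ × ℤ, A.vec d ∈ Config.line A (A.vec (c i)) ↔ d.1 = (c i).1 := by
      intro d
      have e : ∀ k : ℤ, A.vec (c i) + k • A.dir = A.vec (c i + (0, k)) := by
        intro k
        rw [A.vec_add]
        simp [Axis.vec]
      constructor
      · rintro ⟨k, hk⟩
        rw [e, A.vec_inj] at hk
        rw [hk]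
        simp
      · intro h
        refine ⟨d.2 - (c i).2, ?_⟩
        rw [e, A.vec_inj]
        ext <;> simp [h]
    obtain ⟨w⟩ := hA (A.vec (c i)) ⟨A.vec (c i), hmem i, (hline _).2 rfl⟩
      ⟨A.vec (c j), hmem j, (hline _).2 hij.symm⟩
    -- The walk stays on one line, so the edge that leaves the heights up to `b - 1` ends at height
    -- exactly `b`.
    obtain ⟨⟨x, hx1, hx2⟩, ⟨y, hy1, hy2⟩, hxy, h1, h2⟩ :=
      exists_adj_crossing (fun x => (inv x.1).2) (b - 1) w (by simp only [hinvc]; omega)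
        (by simp only [hinvc]; omega)
    obtain ⟨k, rfl⟩ := hof x hx1
    obtain ⟨l, rfl⟩ := hof y hy1
    rw [hline] at hx2 hy2
    simp only [hinvc] at h1 h2
    have hadj : grid.Adj (A.vec (c k)) (A.vec (c l)) := hxy
    rw [A.adj_vec, grid_adj_iff] at hadj
    exact ⟨l, Prod.ext hy2 (by dsimp only; omega)⟩
  · intro i j a hi hj
    obtain ⟨w⟩ := hconn _ (hmem i) _ (hmem j)
    obtain ⟨x, y, hxy, h1, h2⟩ :=
      exists_adj_crossing (fun x => (inv x).1) a w (by simpa only [hinvc] using hi)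
        (by simpa only [hinvc] using hj)
    rw [SimpleGraph.fromEdgeSet_adj] at hxy
    rcases hxy with ⟨⟨k, u, v, hu, hv, huv, -⟩ | ⟨k, l, u, v, -, hu, hv, huv, he⟩, -⟩
    · rw [hocc, Finset.mem_singleton] at hu hv
      exact absurd (hu.trans hv.symm) huv
    · rw [hocc, Finset.mem_singleton] at hu hv
      subst hu hv
      rw [A.adj_vec] at huv
      rcases Sym2.eq_iff.1 he with ⟨rfl, rfl⟩ | ⟨rfl, rfl⟩
      · simp only [hinvc] at h1 h2
        have := (grid_adj_iff _ _).1 huv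
        exact ⟨k, l, huv, by omega, by omega⟩
      · simp only [hinvc] at h1 h2
        have := (grid_adj_iff _ _).1 huv
        exact ⟨l, k, huv.symm, by omega, by omega⟩

/-- Numbered from the leftmost one, the columns are nonempty intervals `[lo k, hi k]`; it remains to
choose a bond between any two neighbours and to read off indices and stages. -/
theorem exists_isStart [Fintype ι] [Nonempty ι] [DecidableEq ι] (S : Config ι)
    (hS : S.IsContractedStructure) (A : Axis) (hA : S.MonotoneAlong A) :
    ∃ o L, IsStart A o S L := by
  obtain ⟨c, hinj, hocc, hconv, hedge⟩ := exists_columnCoords S hS A hA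
  obtain ⟨iL, -, hL⟩ := Finset.exists_min_image Finset.univ (fun i => (c i).1) Finset.univ_nonempty
  obtain ⟨iR, -, hR⟩ := Finset.exists_max_image Finset.univ (fun i => (c i).1) Finset.univ_nonempty
  replace hL : ∀ i, (c iL).1 ≤ (c i).1 := fun i => hL i (Finset.mem_univ i)
  replace hR : ∀ i, (c i).1 ≤ (c iR).1 := fun i => hR i (Finset.mem_univ i)
  set a := (c iL).1 with ha
  obtain ⟨K, hK⟩ : ∃ K : ℕ, (c iR).1 = a + K := ⟨((c iR).1 - a).toNat, by have := hL iR; omega⟩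
  have hcol : ∀ k : ℕ, ∃ lo hi : ℤ, k ≤ K → lo ≤ hi ∧
      ∀ b, (∃ i, c i = (a + k, b)) ↔ lo ≤ b ∧ b ≤ hi := by
    intro k
    by_cases hk : k ≤ K
    · have hne : ∃ i, (c i).1 = a + k := by
        rcases hk.eq_or_lt with rfl | hlt
        · exact ⟨iR, hK⟩
        · obtain ⟨i, j, -, hi, -⟩ := hedge iL iR (a + k) (by omega) (by omega)
          exact ⟨i, hi⟩
      obtain ⟨i₀, hi₀⟩ := hne
      have hne : (Finset.univ.filter (fun i => (c i).1 = a + k)).Nonempty := ⟨i₀, by simp [hi₀]⟩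
      obtain ⟨i, hi, hmin⟩ := Finset.exists_min_image _ (fun i => (c i).2) hne
      obtain ⟨j, hj, hmax⟩ := Finset.exists_max_image _ (fun i => (c i).2) hne
      simp only [Finset.mem_filter, Finset.mem_univ, true_and] at hi hj hmin hmax
      refine ⟨(c i).2, (c j).2, fun _ => ⟨hmin j hj, fun b => ⟨?_, fun hb => ?_⟩⟩⟩
      · rintro ⟨l, hl⟩
        have h1 := hmin l (by rw [hl])
        have h2 := hmax l (by rw [hl])
        rw [hl] at h1 h2
        exact ⟨h1, h2⟩
      · obtain ⟨l, hl⟩ := hconv i j b (by rw [hi, hj]) hb.1 hb.2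
        exact ⟨l, by rw [hl, hi]⟩
    · exact ⟨0, 0, fun h => absurd h hk⟩
  choose lo hi hlohi using hcol
  have hle : ∀ k ≤ K, lo k ≤ hi k := fun k hk => (hlohi k hk).1
  have hown : ∀ (k : ℕ) (b : ℤ), ∃ i, k ≤ K → lo k ≤ b → b ≤ hi k → c i = (a + k, b) := by
    intro k b
    by_cases h : k ≤ K ∧ lo k ≤ b ∧ b ≤ hi k
    · obtain ⟨i, hi⟩ := ((hlohi k h.1).2 b).2 h.2
      exact ⟨i, fun _ _ _ => hi⟩
    · exact ⟨Classical.arbitrary ι, fun h1 h2 h3 => absurd ⟨h1, h2, h3⟩ h⟩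
  choose own hown using hown
  have hbd : ∀ i, ∀ k : ℕ, k ≤ K → (c i).1 = a + k → lo k ≤ (c i).2 ∧ (c i).2 ≤ hi k :=
    fun i k hk h => ((hlohi k hk).2 _).1 ⟨i, Prod.ext h rfl⟩
  -- `e` and `f` are the heights of the chosen bond's ends in the left and the right column.
  have hlink : ∀ k : ℕ, ∃ e f : ℤ, k < K → lo k ≤ e ∧ e ≤ hi k ∧ lo (k + 1) ≤ f ∧ f ≤ hi (k + 1) ∧
      (f = e ∨ f = e - 1 ∧ e = lo k ∧ f = hi (k + 1)) := by
    intro k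
    by_cases hk : k < K
    · obtain ⟨i, j, hadj, hi1, hj1⟩ := hedge iL iR (a + k) (by omega) (by omega)
      have bi := hbd i k hk.le hi1
      have bj := hbd j (k + 1) hk (by rw [hj1]; push_cast; ring)
      rw [grid_adj_iff] at hadj
      by_cases hex : ∃ b, lo k ≤ b ∧ b ≤ hi k ∧ lo (k + 1) ≤ b ∧ b ≤ hi (k + 1)
      · obtain ⟨b, h1, h2, h3, h4⟩ := hex
        exact ⟨b, b, fun _ => ⟨h1, h2, h3, h4, .inl rfl⟩⟩
      -- Without a common height the edge must go one row down to the right; as neither of its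
      -- heights occurs in both intervals, it joins the bottom of the left column to the top of the
      -- right one.
      · have n1 : ¬ (lo (k + 1) ≤ (c i).2 ∧ (c i).2 ≤ hi (k + 1)) := fun h =>
          hex ⟨_, bi.1, bi.2, h.1, h.2⟩
        have n2 : ¬ (lo k ≤ (c j).2 ∧ (c j).2 ≤ hi k) := fun h =>
          hex ⟨_, h.1, h.2, bj.1, bj.2⟩
        exact ⟨(c i).2, (c j).2, fun _ => ⟨bi.1, bi.2, bj.1, bj.2, .inr (by omega)⟩⟩
    · exact ⟨0, 0, fun h => absurd h hk⟩
  choose e f hef using hlink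
  -- `E` and `F` are the heights of the right and the left link, with the prescribed substitutes:
  -- the top of the last column and the bottom of the first one.
  set E : ℕ → ℤ := fun k => if k < K then e k else hi k with hE
  set F : ℕ → ℤ := fun k => Nat.casesOn k (lo 0) f with hF
  set stg : ℕ → Stage := fun k =>
    Nat.casesOn k .wait0 (fun k => if f k = e k then .wait0 else .shift0) with hstg
  have hEb : ∀ k ≤ K, lo k ≤ E k ∧ E k ≤ hi k := by
    intro k hk
    simp only [hE]
    split_ifs with h
    · exact ⟨(hef k h).1, (hef k h).2.1⟩
    · exact ⟨hle k hk, le_rfl⟩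
  have hFb : ∀ k ≤ K, lo k ≤ F k ∧ F k ≤ hi k := by
    intro k hk
    cases k with
    | zero => exact ⟨le_rfl, hle 0 hk⟩
    | succ k => exact ⟨(hef k hk).2.2.1, (hef k hk).2.2.2.1⟩
  set ids : ℕ → List ι := fun k =>
    (List.range (hi k - lo k + 1).toNat).map (fun t : ℕ => own k (lo k + t)) with hids
  set piece : ℕ → Piece ι := fun k =>
    ⟨⟨ids k, (F k - lo k).toNat, (E k - lo k).toNat⟩, stg k⟩ with hpiece
  have hm : ∀ k, (piece k).col.m = (hi k - lo k + 1).toNat := by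
    intro k; simp [hpiece, hids, Column.m]
  have hget : ∀ k ≤ K, ∀ t : ℕ, lo k + t ≤ hi k → (ids k)[t]? = some (own k (lo k + t)) := by
    intro k hk t ht
    simp only [hids]
    rw [List.getElem?_map, List.getElem?_range (by omega)]
    rfl
  have hmem : ∀ k ≤ K, ∀ i ∈ ids k, (c i).1 = a + k := by
    intro k hk i hi'
    simp only [hids, List.mem_map, List.mem_range] at hi'
    obtain ⟨t, ht, rfl⟩ := hi'
    rw [hown k _ hk (by omega) (by omega)]
  have hnodup : ∀ k ≤ K, (ids k).Nodup := by
    intro k hk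
    refine (List.nodup_map_iff_inj_on List.nodup_range).2 ?_
    intro s hs t ht hst
    rw [List.mem_range] at hs ht
    have h1 := hown k (lo k + s) hk (by omega) (by omega)
    have h2 := hown k (lo k + t) hk (by omega) (by omega)
    rw [hst, h2] at h1
    have := congrArg Prod.snd h1
    dsimp only at this
    omega
  have hLget : ∀ k ≤ K, ((List.range (K + 1)).map piece)[k]? = some (piece k) := by
    intro k hk
    rw [List.getElem?_map, List.getElem?_range (by omega)]
    rfl
  have hnd : (allIds ((List.range (K + 1)).map piece)).Nodup := by
    refine List.nodup_flatMap.2 ⟨?_, ?_⟩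
    · intro p hp
      obtain ⟨k, hk, rfl⟩ := List.mem_map.1 hp
      exact hnodup k (by rw [List.mem_range] at hk; omega)
    · rw [List.pairwise_map, List.pairwise_iff_getElem]
      intro k l hk hl hkl
      simp only [List.length_range] at hk hl
      simp only [List.getElem_range, Function.onFun]
      intro i hik hil
      have h1 := hmem k (by omega) i hik
      have h2 := hmem l (by omega) i hil
      omega
  have hwait : ∀ k, stg k = .wait0 ∨ stg k = .shift0 := by
    intro k
    cases k with
    | zero => exact .inl rfl
    | succ k =>
      simp only [hstg]
      split_ifs
      · exact .inl rfl
      · exact .inr rfl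
  have horigin : ∀ k ≤ K,
      origin A (A.vec (a, lo 0)) ((List.range (K + 1)).map piece) k = A.vec (a + k, F k) := by
    intro k
    induction k with
    | zero => intro _; simp [hF]
    | succ k ih =>
      intro hk
      have hk' : k ≤ K := by omega
      rw [origin_succ A _ _ k (hLget k hk') (hLget _ hk), ih hk', nextOrigin, ← A.vec_add,
        ← A.vec_add, A.vec_inj]
      have hexit : (piece k).exit = (0, E k - F k) := by
        have h1 := hEb k hk'
        have h2 := hFb k hk'
        have : (((E k - lo k).toNat : ℕ) : ℤ) - ((F k - lo k).toNat : ℕ) = E k - F k := by omega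
        rcases hwait k with h | h <;> simp only [hpiece, Piece.exit, h, this]
      have hentry : (piece (k + 1)).entry = (1, f k - e k) := by
        have := (hef k hk).2.2.2.2
        simp only [hpiece, Piece.entry, hstg]
        split_ifs with h
        · simp [h]
        · have : f k - e k = -1 := by omega
          simp [this]
      rw [hexit, hentry]
      have hEk : E k = e k := by simp only [hE]; rw [if_pos (Nat.lt_of_succ_le hk)]
      rw [hEk]
      simp only [hF, Prod.mk_add_mk]
      ext
      · push_cast; ring
      · ring
  refine ⟨A.vec (a, lo 0), (List.range (K + 1)).map piece, ?_, hnd, ?_, ?_, ?_, ?_, ?_⟩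
  · have : ∀ i, (toConfig A (A.vec (a, lo 0)) ((List.range (K + 1)).map piece)).occ i = S.occ i := by
      intro i
      obtain ⟨k, hk⟩ : ∃ k : ℕ, (c i).1 = a + k :=
        ⟨((c i).1 - a).toNat, by have := hL i; omega⟩
      have hkK : k ≤ K := by have := hR i; omega
      obtain ⟨b1, b2⟩ := hbd i k hkK hk
      obtain ⟨t, ht⟩ : ∃ t : ℕ, (c i).2 = lo k + t := ⟨((c i).2 - lo k).toNat, by omega⟩
      have hi' : own k (lo k + t) = i := by
        apply hinj
        rw [hown k _ hkK (by omega) (by omega), ← hk, ← ht]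
      have hidx : (ids k)[t]? = some i := by rw [hget k hkK t (by omega), hi']
      have := place_eq A (A.vec (a, lo 0)) _ hnd k (hLget k hkK)
        (List.mem_of_getElem? hidx : i ∈ (piece k).col.ids)
      change place A _ _ i = _
      rw [this, horigin k hkK, hocc]
      have hidx' : (piece k).col.ids.idxOf i = t := idxOf_of_getElem? (hnodup k hkK) hidx
      rw [hidx']
      have hnodes : (piece k).nodes t = {(0, (t : ℤ) - (F k - lo k).toNat)} := by
        rcases hwait k with h | h <;> simp only [hpiece, Piece.nodes, h]
      rw [hnodes, Finset.image_singleton, ← A.vec_add]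
      congr 2
      have := hFb k hkK
      ext
      · simp [hk]
      · simp only [Prod.snd_add]; omega
    cases S
    exact congrArg Config.mk (funext this)
  · intro p hp
    obtain ⟨k, hk, rfl⟩ := List.mem_map.1 hp
    rw [List.mem_range] at hk
    have h1 := hEb k (by omega)
    have h2 := hFb k (by omega)
    refine ⟨?_, ?_⟩
    · rw [hm]; simp only [hpiece]; omega
    · rw [hm]; simp only [hpiece]; omega
  · intro p hp
    obtain ⟨k, hk, rfl⟩ := List.mem_map.1 hp
    exact hwait k
  · intro p hp
    rw [List.head?_eq_getElem?, hLget 0 (by omega)] at hp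
    cases hp
    exact ⟨rfl, by simp [hpiece, hF]⟩
  · intro p hp
    rw [List.getLast?_eq_getElem?] at hp
    simp only [List.length_map, List.length_range, Nat.add_sub_cancel] at hp
    rw [hLget K le_rfl] at hp
    cases hp
    have := hle K le_rfl
    rw [hm]
    simp only [hpiece, hE, lt_irrefl, if_false]
    omega
  · rw [List.isChain_iff_getElem]
    intro k hk hs
    simp only [List.length_map, List.length_range] at hk
    simp only [List.getElem_map, List.getElem_range] at hs ⊢
    have hkK : k < K := by omega
    have hne : f k ≠ e k := by
      intro h
      simp [hpiece, hstg, h] at hs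
    have h := hef k hkK
    have h2 := hle (k + 1) hkK
    rw [hm]
    simp only [hpiece, hE, hF, if_pos hkK]
    omega

/-- An amoebot missing from all columns would be placed on no node, which the validity of `S`
forbids; the chain condition makes shifted columns have their left link at the top. -/
theorem IsStart.good [DecidableEq ι] {A : Axis} {o : Node} {S : Config ι} {L : List (Piece ι)}
    (h : IsStart A o S L) (hS : S.Valid) : Good L where
  nodup := h.nodup
  ok p hp := by
    refine ⟨h.wellFormed p hp, ?_⟩
    rcases h.stage p hp with hs | hs
    · simp only [hs]
    · simp only [hs]
      obtain ⟨k, hk, rfl⟩ := List.mem_iff_getElem.1 hp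
      cases k with
      | zero =>
        have := (h.first L[0] (by rw [List.head?_eq_getElem?, List.getElem?_eq_getElem hk])).1
        rw [this] at hs
        cases hs
      | succ k => exact (List.isChain_iff_getElem.1 h.shift k hk hs).2
  cover i := by
    by_contra hi
    have h1 : S.occ i = ∅ := by
      rw [← h.config_eq]
      exact place_eq_empty A o L hi
    rcases hS.1 i with ⟨u, hu⟩ | ⟨u, v, -, hu⟩ <;> rw [h1] at hu
    · exact Finset.singleton_ne_empty u hu.symm
    · exact Finset.insert_ne_empty u _ hu.symm

end Amoebot

theorem mainTheorem3 {ι : Type*} [Fintype ι] [Nonempty ι] [DecidableEq ι]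
    (S : Amoebot.Config ι) (hS : S.IsMonotone) :
    -- the algorithm can be started on `S`, along each axis for which `S` is monotone
    (∀ A : Amoebot.Axis, S.MonotoneAlong A → ∃ o L, Amoebot.IsStart A o S L) ∧
    -- for every choice of bonds, it reconfigures `S` into a line segment in at most 16 rounds,
    -- and every amoebot takes part in at most 4 rule applications
    (∀ (A : Amoebot.Axis) (o : Amoebot.Node) (L : List (Amoebot.Piece ι)),
      Amoebot.IsStart A o S L →
        (∃ T : ℕ, T ≤ 16 ∧
          Amoebot.toConfig A o (Amoebot.stateAt L 0) = S ∧
          (∀ t < T, ∃ R : Set (Sym2 Amoebot.Node),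
            Amoebot.Round (Amoebot.toConfig A o (Amoebot.stateAt L t)) R
              (Amoebot.toConfig A o (Amoebot.stateAt L (t + 1))) ∧
            Amoebot.KeepsOnlyLinks A o (Amoebot.stateAt L t) R) ∧
          Amoebot.Terminated (Amoebot.stateAt L T) ∧
          (Amoebot.toConfig A o (Amoebot.stateAt L T)).IsLineSegment) ∧
        ∀ i : ι, {t : ℕ | Amoebot.BeginsRule (Amoebot.stateAt L t) i}.encard ≤ 4) ∧
    -- the state graph is acyclic
    (∀ ρ : Amoebot.Rule, ¬ Relation.TransGen Amoebot.StateEdge ρ ρ) := by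
  refine ⟨fun A hA => Amoebot.exists_isStart S hS.1 A hA, fun A o L hL => ?_,
    Amoebot.stateGraph_acyclic⟩
  have hgood := hL.good hS.1.1
  have hterm : Amoebot.Terminated (Amoebot.stateAt L 16) := by
    refine Amoebot.terminated_of_start hgood fun p hp => ?_
    rcases hL.stage p hp with h | h <;> simp [Amoebot.Piece.roundsLeft, h]
  -- The uniform choice 16 works because columns that finish earlier just stay as they are in legal
  -- rounds.
  refine ⟨⟨16, le_rfl, hL.config_eq, fun t _ => ?_, hterm,
    hterm.isLineSegment (hgood.stateAt 16) A o⟩, Amoebot.encard_beginsRule_le hgood⟩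
  rw [Amoebot.stateAt_succ]
  exact (hgood.stateAt t).round A o
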